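/- Let $X$ be a compact connected smooth $n$-manifold and let $I=[t_0,\infty)$ or $I=(t_0,\infty)$. Let $(L,h,K)$ be a smooth expanding CMC Einstein flow on $X$: smooth families, for $t\in I$, of nonnegative functions $L(t)$, Riemannian metrics $h(t)$ and symmetric covariant $2$-tensor fields $K(t)$ on $X$ which, with $H=h^{ij}K_{ij}$, $K^0=K-\frac{H}{n}h$ and $R_{ij}$, $R$ the Ricci and scalar curvature of $h(t)$, satisfy $$R-|K^0|^2+\left(1-\tfrac1n\right)H^2=0,\qquad \nabla_iK^i{}_j-\nabla_jH=0,$$ $$\frac{\partial h_{ij}}{\partial t}=-2LK_{ij},\qquad \frac{\partial K_{ij}}{\partial t}=LHK_{ij}-2L\,h^{kl}K_{ik}K_{lj}-L_{;ij}+LR_{ij},$$ such that $H$ depends only on $t$, is negative and increasing in $t$, and takes all values in $[H_0,0)$ for some $H_0<0$. Assume that $t$ is the Hubble time, $t=-n/H$. For $s>0$ put $h_s(u)=s^{-2}h(su)$. Then the limit $\operatorname{dvol}_\infty=\lim_{t\to\infty}t^{-n}\operatorname{dvol}(X,h(t))$ exists as a measure on $X$ (setwise on Borel sets). Let $\Lambda>1$.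 For $s$ large and $x\in X$ let $H_{s,\Lambda}(x)\in\operatorname{End}(T_xX)$ be an endomorphism of positive determinant with $$h_s(x,\Lambda)=H_{s,\Lambda}(x)^*\,h_s(x,1)\,H_{s,\Lambda}(x),$$ i.e. $h_s(\Lambda)(v,w)=h_s(1)(H_{s,\Lambda}v,H_{s,\Lambda}w)$ on $T_xX$; it is unique up to left multiplication by orientation-preserving isometries of $(T_xX,h_s(x,1))$. Let $H^1_{s,\Lambda}(x)=\det(H_{s,\Lambda}(x))^{-1/n}H_{s,\Lambda}(x)$ be its rescaling of determinant one. In an orthonormal basis of $(T_xX,h_s(x,1))$, it defines a point of $\operatorname{SO}(n)\backslash\operatorname{SL}(n)$, which is identified with the space of positive definite symmetric $n\times n$ matrices of determinant one through $\operatorname{SO}(n)G\mapsto G^TG$. Let $d_{symm}$ be the distance of the $\operatorname{SL}(n)$-invariant Riemannian metric $\langle V,V\rangle_P=\operatorname{Tr}((P^{-1}V)^2)$ on this space, which is $\operatorname{Tr}(V^2)$ for a traceless symmetric matrix $V$ at the basepoint $I_n$. Then, for every such choice of the endomorphisms and bases, the function $x\mapsto d_{symm}(H^1_{s,\Lambda}(x),I_n)$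 lies in $L^2(X,\operatorname{dvol}_\infty)$ for all large $s$, and $$\lim_{s\to\infty}d_{symm}(H^1_{s,\Lambda},I_n)=0\quad\text{in } L^2(X,\operatorname{dvol}_\infty).$$ -/

import Mathlib

open Set Filter Topology MeasureTheory Bundle
open scoped Manifold ContDiff Matrix

noncomputable section

/-! ### Tensor calculus in a coordinate domain of `ℝⁿ` -/

namespace Coord

/-- The partial derivative `∂ₖ f` at `y`. -/
def pd {n : ℕ} (k : Fin n) (f : EuclideanSpace ℝ (Fin n) → ℝ) (y : EuclideanSpace ℝ (Fin n)) : ℝ :=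
  fderiv ℝ f y (EuclideanSpace.single k 1)

/-- The Christoffel symbol `Γᵏᵢⱼ` of the metric with components `g`. -/
def christoffel {n : ℕ} (g : EuclideanSpace ℝ (Fin n) → Matrix (Fin n) (Fin n) ℝ)
    (k i j : Fin n) (y : EuclideanSpace ℝ (Fin n)) : ℝ :=
  (1 / 2 : ℝ) * ∑ l, (g y)⁻¹ k l *
    (pd i (fun z => g z j l) y + pd j (fun z => g z i l) y - pd l (fun z => g z i j) y)

/-- The Ricci curvature `Rᵢⱼ = ∂ₖΓᵏᵢⱼ - ∂ⱼΓᵏᵢₖ + ΓᵏₖₗΓˡᵢⱼ - ΓᵏⱼₗΓˡᵢₖ`. -/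
def ricci {n : ℕ} (g : EuclideanSpace ℝ (Fin n) → Matrix (Fin n) (Fin n) ℝ)
    (i j : Fin n) (y : EuclideanSpace ℝ (Fin n)) : ℝ :=
  ∑ k, (pd k (christoffel g k i j) y - pd j (christoffel g k i k) y +
    ∑ l, (christoffel g k k l y * christoffel g l i j y -
      christoffel g k j l y * christoffel g l i k y))

/-- The trace `gⁱʲ Tᵢⱼ` of a covariant 2-tensor. -/
def tr {n : ℕ} (g T : Matrix (Fin n) (Fin n) ℝ) : ℝ :=
  ∑ i, ∑ j, g⁻¹ i j * T i j

/-- The scalar curvature `R = gⁱʲ Rᵢⱼ`. -/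
def scalarCurv {n : ℕ} (g : EuclideanSpace ℝ (Fin n) → Matrix (Fin n) (Fin n) ℝ)
    (y : EuclideanSpace ℝ (Fin n)) : ℝ :=
  tr (g y) (Matrix.of fun i j => ricci g i j y)

/-- The traceless part `T⁰ = T - (gᵏˡTₖₗ / n) g`. -/
def tracelessPart {n : ℕ} (g T : Matrix (Fin n) (Fin n) ℝ) : Matrix (Fin n) (Fin n) ℝ :=
  T - (tr g T / n) • g

/-- The squared norm `|T|² = gⁱᵏ gʲˡ Tᵢⱼ Tₖₗ` of a covariant 2-tensor. -/
def normSq {n : ℕ} (g T : Matrix (Fin n) (Fin n) ℝ) : ℝ :=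
  ∑ i, ∑ j, ∑ k, ∑ l, g⁻¹ i k * g⁻¹ j l * T i j * T k l

/-- The covariant Hessian `f_{;ij} = ∂ᵢ∂ⱼf - Γᵏᵢⱼ ∂ₖf`. -/
def hessian {n : ℕ} (g : EuclideanSpace ℝ (Fin n) → Matrix (Fin n) (Fin n) ℝ)
    (f : EuclideanSpace ℝ (Fin n) → ℝ) (i j : Fin n) (y : EuclideanSpace ℝ (Fin n)) : ℝ :=
  pd i (pd j f) y - ∑ k, christoffel g k i j y * pd k f y

/-- The covariant derivative `∇ₖTᵢⱼ = ∂ₖTᵢⱼ - ΓˡₖᵢTₗⱼ - ΓˡₖⱼTᵢₗ`. -/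
def covDeriv {n : ℕ} (g T : EuclideanSpace ℝ (Fin n) → Matrix (Fin n) (Fin n) ℝ)
    (k i j : Fin n) (y : EuclideanSpace ℝ (Fin n)) : ℝ :=
  pd k (fun z => T z i j) y
    - ∑ l, (christoffel g l k i y * T y l j + christoffel g l k j y * T y i l)

/-- The divergence `∇ᵢTⁱⱼ = gⁱᵏ ∇ₖTᵢⱼ`. -/
def divergence {n : ℕ} (g T : EuclideanSpace ℝ (Fin n) → Matrix (Fin n) (Fin n) ℝ)
    (j : Fin n) (y : EuclideanSpace ℝ (Fin n)) : ℝ :=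
  ∑ i, ∑ k, (g y)⁻¹ i k * covDeriv g T k i j y

end Coord

/-! ### Tensors on a manifold -/

/-- Covariant 2-tensor fields on an `n`-manifold. -/
abbrev Cov2Tensor (n : ℕ) (X : Type*) [TopologicalSpace X]
    [ChartedSpace (EuclideanSpace ℝ (Fin n)) X] : Type _ :=
  ∀ x : X, TangentSpace (𝓡 n) x →L[ℝ] TangentSpace (𝓡 n) x →L[ℝ] ℝ

/-- Smooth Riemannian metrics on an `n`-manifold. -/
abbrev SmoothMetric (n : ℕ) (X : Type*) [TopologicalSpace X]
    [ChartedSpace (EuclideanSpace ℝ (Fin n)) X] [IsManifold (𝓡 n) ∞ X] : Type _ :=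
  ContMDiffRiemannianMetric (𝓡 n) ∞ (EuclideanSpace ℝ (Fin n))
    (fun x : X => TangentSpace (𝓡 n) x)

/-- The components `Tᵢⱼ(y) = T(∂ᵢ, ∂ⱼ)` of a covariant 2-tensor field in the chart `e`, at the
point with coordinates `y`; here `∂ᵢ` is the image of the `i`-th basis vector of `ℝⁿ` under the
differential of `e⁻¹`. -/
def components {n : ℕ} {X : Type*} [TopologicalSpace X]
    [ChartedSpace (EuclideanSpace ℝ (Fin n)) X]
    (e : OpenPartialHomeomorph X (EuclideanSpace ℝ (Fin n))) (T : Cov2Tensor n X)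
    (y : EuclideanSpace ℝ (Fin n)) : Matrix (Fin n) (Fin n) ℝ :=
  Matrix.of fun i j =>
    T (e.symm y) (mfderiv (𝓡 n) (𝓡 n) e.symm y (EuclideanSpace.single i (1 : ℝ)))
      (mfderiv (𝓡 n) (𝓡 n) e.symm y (EuclideanSpace.single j (1 : ℝ)))

/-- The Riemannian measure `dvol(X, h)`: the smallest measure on `X` that dominates, for each
chart of the atlas, the measure `√(det hᵢⱼ) dy` on the chart domain. (These local measures agree on
overlaps, so the supremum restricts to each of them.) -/
def riemannianVolume {n : ℕ} {X : Type*} [TopologicalSpace X]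
    [ChartedSpace (EuclideanSpace ℝ (Fin n)) X] [MeasurableSpace X]
    (h : Cov2Tensor n X) : Measure X :=
  ⨆ e ∈ atlas (EuclideanSpace ℝ (Fin n)) X,
    ((volume.restrict e.target).withDensity
      (fun y => ENNReal.ofReal (Real.sqrt (components e h y).det))).map e.symm

/-! ### Einstein flows -/

/-- `(L, h, K)`, restricted to times in the interval `I`, is a smooth Einstein flow on `X`: the
constraint and the evolution equations hold in all charts of the atlas. Values at times outside `I`
play no role. -/
structure IsEinsteinFlow {n : ℕ} {X : Type*} [TopologicalSpace X]
    [ChartedSpace (EuclideanSpace ℝ (Fin n)) X] [IsManifold (𝓡 n) ∞ X]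
    (I : Set ℝ) (L : ℝ → X → ℝ) (h : ℝ → SmoothMetric n X) (K : ℝ → Cov2Tensor n X) : Prop where
  interval : I.OrdConnected
  lapse_nonneg : ∀ t ∈ I, ∀ x, 0 ≤ L t x
  symm : ∀ t ∈ I, ∀ (x : X) (v w : TangentSpace (𝓡 n) x), K t x v w = K t x w v
  smooth_L : ∀ e ∈ atlas (EuclideanSpace ℝ (Fin n)) X,
    ContDiffOn ℝ ∞ (fun p : ℝ × EuclideanSpace ℝ (Fin n) => L p.1 (e.symm p.2)) (I ×ˢ e.target)
  smooth_h : ∀ e ∈ atlas (EuclideanSpace ℝ (Fin n)) X, ∀ i j,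
    ContDiffOn ℝ ∞ (fun p : ℝ × EuclideanSpace ℝ (Fin n) =>
      components e (h p.1).inner p.2 i j) (I ×ˢ e.target)
  smooth_K : ∀ e ∈ atlas (EuclideanSpace ℝ (Fin n)) X, ∀ i j,
    ContDiffOn ℝ ∞ (fun p : ℝ × EuclideanSpace ℝ (Fin n) =>
      components e (K p.1) p.2 i j) (I ×ˢ e.target)
  /-- `R - |K⁰|² + (1 - 1/n) H² = 0`. -/
  hamiltonian_constraint : ∀ e ∈ atlas (EuclideanSpace ℝ (Fin n)) X, ∀ t ∈ I, ∀ y ∈ e.target,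
    Coord.scalarCurv (components e (h t).inner) y
      - Coord.normSq (components e (h t).inner y)
          (Coord.tracelessPart (components e (h t).inner y) (components e (K t) y))
      + (1 - 1 / (n : ℝ)) * Coord.tr (components e (h t).inner y) (components e (K t) y) ^ 2 = 0
  /-- `∇ᵢKⁱⱼ - ∇ⱼH = 0`. -/
  momentum_constraint : ∀ e ∈ atlas (EuclideanSpace ℝ (Fin n)) X, ∀ t ∈ I, ∀ y ∈ e.target, ∀ j,
    Coord.divergence (components e (h t).inner) (components e (K t)) j y
      - Coord.pd j (fun z => Coord.tr (components e (h t).inner z) (components e (K t) z)) y = 0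
  /-- `∂hᵢⱼ/∂t = - 2 L Kᵢⱼ`. -/
  evolution_h : ∀ e ∈ atlas (EuclideanSpace ℝ (Fin n)) X, ∀ t ∈ I, ∀ y ∈ e.target, ∀ i j,
    HasDerivWithinAt (fun τ => components e (h τ).inner y i j)
      (-2 * L t (e.symm y) * components e (K t) y i j) I t
  /-- `∂Kᵢⱼ/∂t = L H Kᵢⱼ - 2 L hᵏˡ Kᵢₖ Kₗⱼ - L_{;ij} + L Rᵢⱼ`. -/
  evolution_K : ∀ e ∈ atlas (EuclideanSpace ℝ (Fin n)) X, ∀ t ∈ I, ∀ y ∈ e.target, ∀ i j,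
    HasDerivWithinAt (fun τ => components e (K τ) y i j)
      (L t (e.symm y) * Coord.tr (components e (h t).inner y) (components e (K t) y)
          * components e (K t) y i j
        - 2 * L t (e.symm y) * ∑ k, ∑ l, (components e (h t).inner y)⁻¹ k l
            * components e (K t) y i k * components e (K t) y l j
        - Coord.hessian (components e (h t).inner) (fun z => L t (e.symm z)) i j y
        + L t (e.symm y) * Coord.ricci (components e (h t).inner) i j y) I t

/-- `(L, h, K)` is an expanding CMC Einstein flow on the time interval `I`, with mean curvature
function `H = hⁱʲKᵢⱼ` depending only on time. -/
structure IsExpandingCMCEinsteinFlow {n : ℕ} {X : Type*} [TopologicalSpace X]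
    [ChartedSpace (EuclideanSpace ℝ (Fin n)) X] [IsManifold (𝓡 n) ∞ X]
    (I : Set ℝ) (L : ℝ → X → ℝ) (h : ℝ → SmoothMetric n X) (K : ℝ → Cov2Tensor n X)
    (H : ℝ → ℝ) : Prop extends IsEinsteinFlow I L h K where
  cmc : ∀ e ∈ atlas (EuclideanSpace ℝ (Fin n)) X, ∀ t ∈ I, ∀ y ∈ e.target,
    Coord.tr (components e (h t).inner y) (components e (K t) y) = H t
  half_line : ∃ t₀ : ℝ, I = Ici t₀ ∨ I = Ioi t₀
  monotone : MonotoneOn H I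
  neg : ∀ t ∈ I, H t < 0
  values : ∃ H₀ < 0, Ico H₀ 0 ⊆ H '' I

/-- The rescaled metric `h_s(u) = s⁻² h(su)`. -/
def rescaledMetric {n : ℕ} {X : Type*} [TopologicalSpace X]
    [ChartedSpace (EuclideanSpace ℝ (Fin n)) X] [IsManifold (𝓡 n) ∞ X]
    (h : ℝ → SmoothMetric n X) (s u : ℝ) : Cov2Tensor n X :=
  fun x => (s ^ 2)⁻¹ • (h (s * u)).inner x

/-- `μ = lim_{t → ∞} t⁻ⁿ dvol(X, h(t))`, as a limit of measures on every measurable set. -/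
def IsLimitVolume {n : ℕ} {X : Type*} [TopologicalSpace X]
    [ChartedSpace (EuclideanSpace ℝ (Fin n)) X] [IsManifold (𝓡 n) ∞ X] [MeasurableSpace X]
    (h : ℝ → SmoothMetric n X) (μ : Measure X) : Prop :=
  ∀ A : Set X, MeasurableSet A →
    Tendsto (fun t : ℝ => ENNReal.ofReal ((t ^ n)⁻¹) * riemannianVolume (h t).inner A)
      atTop (𝓝 (μ A))

/-! ### The symmetric space `SO(n) \ SL(n)` -/

/-- The point of the space of positive definite symmetric matrices of determinant one that
corresponds to the coset `SO(n) G`, for `G ∈ SL(n)`. -/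
def cosetPoint {n : ℕ} (G : Matrix (Fin n) (Fin n) ℝ) : Matrix (Fin n) (Fin n) ℝ := Gᵀ * G

/-- `γ : [0,1] → SO(n) \ SL(n)` is a `C¹` curve from `P` to `Q`. -/
structure IsSymmCurve {n : ℕ} (P Q : Matrix (Fin n) (Fin n) ℝ)
    (γ : ℝ → Matrix (Fin n) (Fin n) ℝ) : Prop where
  smooth : ∀ i j, ContDiffOn ℝ 1 (fun τ => γ τ i j) (Icc 0 1)
  posDef : ∀ τ ∈ Icc (0 : ℝ) 1, (γ τ).PosDef
  det_one : ∀ τ ∈ Icc (0 : ℝ) 1, (γ τ).det = 1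
  source : γ 0 = P
  target : γ 1 = Q

/-- The velocity of a curve of matrices on `[0,1]`. -/
def velocity {n : ℕ} (γ : ℝ → Matrix (Fin n) (Fin n) ℝ) (τ : ℝ) : Matrix (Fin n) (Fin n) ℝ :=
  Matrix.of fun i j => derivWithin (fun σ => γ σ i j) (Icc 0 1) τ

/-- The length of a curve for the `SL(n)`-invariant Riemannian metric `⟨V, V⟩_P = Tr((P⁻¹V)²)`,
which at the basepoint `P = Iₙ` is `Tr(V²)`. -/
def symmLength {n : ℕ} (γ : ℝ → Matrix (Fin n) (Fin n) ℝ) : ENNReal :=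
  ∫⁻ τ in Icc (0 : ℝ) 1,
    ENNReal.ofReal (Real.sqrt (Matrix.trace (((γ τ)⁻¹ * velocity γ τ) ^ 2)))

/-- The Riemannian distance on `SO(n) \ SL(n)`: the infimum of the lengths of curves. -/
def symmDist {n : ℕ} (P Q : Matrix (Fin n) (Fin n) ℝ) : ENNReal :=
  ⨅ (γ : ℝ → Matrix (Fin n) (Fin n) ℝ) (_ : IsSymmCurve P Q γ), symmLength γ

/-! ### The endomorphism relating two inner products -/

/-- `k = A^* g A`, that is, `k(v, w) = g(Av, Aw)`; among the endomorphisms with this property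
we take those that preserve the orientation. -/
def Relates {V : Type*} [AddCommGroup V] [Module ℝ V] [TopologicalSpace V]
    (g k : V →L[ℝ] V →L[ℝ] ℝ) (A : V →ₗ[ℝ] V) : Prop :=
  (∀ v w, k v w = g (A v) (A w)) ∧ 0 < LinearMap.det A

/-- The rescaling of an endomorphism `A` of positive determinant of an `n`-dimensional space to
have determinant one. -/
def unimodularPart {V : Type*} [AddCommGroup V] [Module ℝ V] (n : ℕ) (A : V →ₗ[ℝ] V) :
    V →ₗ[ℝ] V :=
  (LinearMap.det A ^ (-(1 / (n : ℝ)))) • A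

/-- The basis `b` is orthonormal for the inner product `g`. -/
def IsOrthonormalBasis {n : ℕ} {V : Type*} [AddCommGroup V] [Module ℝ V] [TopologicalSpace V]
    (g : V →L[ℝ] V →L[ℝ] ℝ) (b : Module.Basis (Fin n) ℝ V) : Prop :=
  ∀ i j, g (b i) (b j) = if i = j then 1 else 0

end

/-!
Taking the trace of the evolution of `K` and using the Hamiltonian constraint, the condition that
`H = -n/t` depends only on `t` becomes the elliptic equation `ΔL = L |K⁰|² - (n/t²)(1 - L)` for the
lapse. At a maximum of `L` it gives `L ≤ 1`. Hence `t⁻ⁿ dvol(h(t))`, whose logarithmic derivative is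
`-(n/t)(1 - L)`, is nonincreasing and converges. Integrating the lapse equation over `X`, the volume
lost on `[s, S]` equals the integral over `τ ∈ [s, S]` of `τ ∫ L |K⁰|² τ⁻ⁿ dvol(h(τ))`.

On the other hand `d_symm(H¹_{s,Λ}, I)` is the distance between the conformal classes of `h(s)` and
`h(Λs)`, and the traceless part of `∂ₜh` being `-2LK⁰`, it is at most `∫ 2L |K⁰| dτ` over `[s, Λs]`.
By Cauchy–Schwarz in time and `L ≤ 1` its square is at most `4 log Λ · ∫ τ L |K⁰|² dτ`. Since the
limit measure is at most `τ⁻ⁿ dvol(h(τ))` for every `τ`, the squared `L²` norm is at most `4 log Λ`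
times the volume lost on `[s, Λs]`, which tends to zero.
-/

/-! ### Calculus of matrix-valued functions -/

section MatrixCalculus

variable {m 𝕜 : Type*} [Fintype m] [DecidableEq m] [NontriviallyNormedField 𝕜]

theorem trace_adjugate_mul_eq_sum_det_updateCol {R : Type*} [CommRing R] (A B : Matrix m m R) :
    (A.adjugate * B).trace = ∑ j, (A.updateCol j fun i => B i j).det := by
  refine Finset.sum_congr rfl fun j _ => ?_
  rw [← Matrix.cramer_apply, Matrix.cramer_eq_adjugate_mulVec]
  rfl

theorem det_updateCol_eq_sum_perm {R : Type*} [CommRing R] (A : Matrix m m R) (j : m) (v : m → R) :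
    (A.updateCol j v).det = ∑ σ : Equiv.Perm m,
      Equiv.Perm.sign σ • ((∏ i ∈ Finset.univ.erase j, A (σ i) i) * v (σ j)) := by
  rw [Matrix.det_apply]
  refine Finset.sum_congr rfl fun σ _ => ?_
  rw [← Finset.mul_prod_erase _ _ (Finset.mem_univ j), Matrix.updateCol_self, mul_comm]
  congr 2
  exact Finset.prod_congr rfl fun i hi => Matrix.updateCol_ne (Finset.ne_of_mem_erase hi)

theorem hasDerivWithinAt_det {M : 𝕜 → Matrix m m 𝕜} {M' : Matrix m m 𝕜} {s : Set 𝕜} {t : 𝕜}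
    (hM : ∀ i j, HasDerivWithinAt (fun τ => M τ i j) (M' i j) s t) :
    HasDerivWithinAt (fun τ => (M τ).det) (((M t).adjugate * M').trace) s t := by
  simp only [trace_adjugate_mul_eq_sum_det_updateCol, det_updateCol_eq_sum_perm]
  rw [Finset.sum_comm]
  simp only [Matrix.det_apply]
  refine HasDerivWithinAt.fun_sum fun σ _ => ?_
  simpa only [Finset.smul_sum, smul_eq_mul] using
    (HasDerivWithinAt.fun_finsetProd (u := Finset.univ) fun i _ => hM (σ i) i).fun_const_smul
      (Equiv.Perm.sign σ)

theorem hasDerivWithinAt_det_of_ne_zero {M : 𝕜 → Matrix m m 𝕜} {M' : Matrix m m 𝕜} {s : Set 𝕜}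
    {t : 𝕜} (hM : ∀ i j, HasDerivWithinAt (fun τ => M τ i j) (M' i j) s t)
    (h0 : (M t).det ≠ 0) :
    HasDerivWithinAt (fun τ => (M τ).det) ((M t).det * ((M t)⁻¹ * M').trace) s t := by
  convert hasDerivWithinAt_det hM using 1
  rw [Matrix.inv_def, Matrix.smul_mul, Matrix.trace_smul, smul_eq_mul, ← mul_assoc,
    Ring.inverse_eq_inv', mul_inv_cancel₀ h0, one_mul]

theorem hasDerivWithinAt_inv_apply {M : 𝕜 → Matrix m m 𝕜} {M' : Matrix m m 𝕜} {s : Set 𝕜} {t : 𝕜}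
    (hM : ∀ i j, HasDerivWithinAt (fun τ => M τ i j) (M' i j) s t) (h0 : (M t).det ≠ 0) (i j : m) :
    HasDerivWithinAt (fun τ => (M τ)⁻¹ i j) (-((M t)⁻¹ * M' * (M t)⁻¹) i j) s t := by
  have hcont : ContinuousWithinAt M s t :=
    tendsto_pi_nhds.2 fun a => tendsto_pi_nhds.2 fun b => (hM a b).continuousWithinAt
  have hne : ∀ᶠ τ in 𝓝[s \ {t}] t, (M τ).det ≠ 0 :=
    ((hasDerivWithinAt_det hM).continuousWithinAt.mono Set.sdiff_subset).eventually_ne h0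
  have hinv : Tendsto (fun τ => (M τ)⁻¹) (𝓝[s \ {t}] t) (𝓝 (M t)⁻¹) := by
    have hdet : ContinuousAt Ring.inverse (M t).det := by
      simpa only [Ring.inverse_eq_inv'] using continuousAt_inv₀ h0
    exact (continuousAt_matrix_inv _ hdet).tendsto.comp (hcont.mono Set.sdiff_subset)
  have hslope : Tendsto (fun τ => slope M t τ) (𝓝[s \ {t}] t) (𝓝 M') :=
    tendsto_pi_nhds.2 fun a => tendsto_pi_nhds.2 fun b =>
      hasDerivWithinAt_iff_tendsto_slope.1 (hM a b)
  have hlim := ((hinv.mul hslope).mul_const (M t)⁻¹).neg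
  rw [hasDerivWithinAt_iff_tendsto_slope]
  refine (tendsto_pi_nhds.1 (tendsto_pi_nhds.1 hlim i) j).congr' ?_
  filter_upwards [hne] with τ hτ
  have hresolvent : (M τ)⁻¹ - (M t)⁻¹ = -((M τ)⁻¹ * (M τ - M t) * (M t)⁻¹) := by
    rw [Matrix.mul_sub, Matrix.sub_mul, Matrix.nonsing_inv_mul _ hτ.isUnit,
      Matrix.mul_nonsing_inv_cancel_right _ _ h0.isUnit, Matrix.one_mul, neg_sub]
  simp only [slope, vsub_eq_sub]
  rw [← Matrix.sub_apply, hresolvent]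
  simp

variable {E : Type*} [NormedAddCommGroup E] [NormedSpace 𝕜 E]

theorem contDiffOn_det {M : E → Matrix m m 𝕜} {s : Set E} {k : WithTop ℕ∞}
    (hM : ∀ i j, ContDiffOn 𝕜 k (fun z => M z i j) s) :
    ContDiffOn 𝕜 k (fun z => (M z).det) s := by
  simp only [Matrix.det_apply']
  exact ContDiffOn.sum fun σ _ => contDiffOn_const.mul (contDiffOn_prod fun i _ => hM _ _)

theorem contDiffOn_inv_apply {M : E → Matrix m m 𝕜} {s : Set E} {k : WithTop ℕ∞}
    (hM : ∀ i j, ContDiffOn 𝕜 k (fun z => M z i j) s) (h0 : ∀ z ∈ s, (M z).det ≠ 0) (i j : m) :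
    ContDiffOn 𝕜 k (fun z => (M z)⁻¹ i j) s := by
  simp only [Matrix.inv_def, Matrix.smul_apply, smul_eq_mul, Ring.inverse_eq_inv',
    Matrix.adjugate_apply]
  refine ((contDiffOn_det hM).inv h0).mul (contDiffOn_det fun a b => ?_)
  by_cases h : a = j
  · subst h; simpa using contDiffOn_const
  · simpa [Matrix.updateRow_ne h] using hM a b

end MatrixCalculus

section PosDef

variable {m : Type*}

theorem isSymm_of_posDef {g : Matrix m m ℝ} (hg : g.PosDef) : g.IsSymm :=
  Matrix.isHermitian_iff_isSymm.1 hg.isHermitian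

variable [Fintype m]

open scoped MatrixOrder in
theorem exists_eq_transpose_mul_self_of_posDef {g : Matrix m m ℝ} (hg : g.PosDef) :
    ∃ B : Matrix m m ℝ, g = Bᵀ * B := by
  classical
  exact CStarAlgebra.nonneg_iff_eq_star_mul_self.mp hg.posSemidef.nonneg

theorem posDef_transpose_mul_mul [DecidableEq m] {g J : Matrix m m ℝ} (hg : g.PosDef)
    (hJ : J.det ≠ 0) : (Jᵀ * g * J).PosDef :=
  hg.conjTranspose_mul_mul_same (Matrix.mulVec_injective_of_isUnit
    ((Matrix.isUnit_iff_isUnit_det _).2 (isUnit_iff_ne_zero.2 hJ)))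

end PosDef

/-! ### Algebra of covariant 2-tensors on an inner product space -/

namespace Coord

variable {n : ℕ} {g T : Matrix (Fin n) (Fin n) ℝ}

theorem tr_eq_trace_of_isSymm (g : Matrix (Fin n) (Fin n) ℝ) (hT : T.IsSymm) :
    tr g T = (g⁻¹ * T).trace := by
  simp only [tr, Matrix.trace, Matrix.diag, Matrix.mul_apply, hT.apply]

theorem normSq_eq_trace (g T : Matrix (Fin n) (Fin n) ℝ) :
    normSq g T = (g⁻¹ * T * (g⁻¹)ᵀ * Tᵀ).trace := by
  simp only [normSq, Matrix.trace, Matrix.diag, Matrix.mul_apply, Matrix.transpose_apply,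
    Finset.sum_mul]
  refine Finset.sum_congr rfl fun i _ => Finset.sum_congr rfl fun j _ => ?_
  rw [Finset.sum_comm]
  exact Finset.sum_congr rfl fun l _ => Finset.sum_congr rfl fun k _ => by ring

theorem normSq_nonneg (hg : g.PosDef) (T : Matrix (Fin n) (Fin n) ℝ) : 0 ≤ normSq g T := by
  obtain ⟨B, hB⟩ := exists_eq_transpose_mul_self_of_posDef hg.inv
  have hsquare : normSq g T = ((B * T * Bᵀ) * (B * T * Bᵀ)ᵀ).trace := by
    rw [normSq_eq_trace, isSymm_of_posDef hg.inv, hB]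
    simp only [Matrix.transpose_mul, Matrix.transpose_transpose, Matrix.mul_assoc]
    rw [Matrix.trace_mul_comm]
    simp only [Matrix.mul_assoc]
  rw [hsquare]
  exact (Matrix.posSemidef_self_mul_conjTranspose _).trace_nonneg

theorem normSq_eq_trace_sq (hg : g.PosDef) (hT : T.IsSymm) :
    normSq g T = ((g⁻¹ * T) ^ 2).trace := by
  rw [normSq_eq_trace, isSymm_of_posDef hg.inv, hT, pow_two, ← Matrix.mul_assoc]

theorem isSymm_tracelessPart (hg : g.PosDef) (hT : T.IsSymm) : (tracelessPart g T).IsSymm :=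
  hT.sub ((isSymm_of_posDef hg).smul _)

theorem inv_mul_tracelessPart (hg : g.PosDef) (hT : T.IsSymm) :
    g⁻¹ * tracelessPart g T = g⁻¹ * T - ((g⁻¹ * T).trace / n) • (1 : Matrix (Fin n) (Fin n) ℝ) := by
  rw [tracelessPart, Matrix.mul_sub, Matrix.mul_smul, tr_eq_trace_of_isSymm g hT,
    Matrix.nonsing_inv_mul _ hg.det_pos.ne'.isUnit]

theorem normSq_tracelessPart (hg : g.PosDef) (hT : T.IsSymm) :
    normSq g (tracelessPart g T) = ((g⁻¹ * T) ^ 2).trace - (g⁻¹ * T).trace ^ 2 / n := by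
  rcases eq_or_ne n 0 with rfl | hn
  · simp [normSq, Matrix.trace]
  rw [normSq_eq_trace_sq hg (isSymm_tracelessPart hg hT), inv_mul_tracelessPart hg hT]
  simp only [pow_two, Matrix.mul_sub, Matrix.sub_mul, Matrix.mul_smul, Matrix.smul_mul,
    Matrix.mul_one, Matrix.one_mul, Matrix.trace_sub, Matrix.trace_smul, Matrix.trace_one,
    smul_eq_mul, Fintype.card_fin]
  field_simp
  ring

theorem normSq_tracelessPart_congr {J : Matrix (Fin n) (Fin n) ℝ} (hg : g.PosDef)
    (hT : T.IsSymm) (hJ : J.det ≠ 0) :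
    normSq (Jᵀ * g * J) (tracelessPart (Jᵀ * g * J) (Jᵀ * T * J)) =
      normSq g (tracelessPart g T) := by
  have hJu : IsUnit J.det := hJ.isUnit
  have hJt : IsUnit Jᵀ.det := by rwa [Matrix.det_transpose]
  have hconj : (Jᵀ * g * J)⁻¹ * (Jᵀ * T * J) = J⁻¹ * (g⁻¹ * T) * J := by
    simp only [Matrix.mul_inv_rev, Matrix.mul_assoc, Matrix.nonsing_inv_mul_cancel_left _ _ hJt]
  have hconj_sq : (J⁻¹ * (g⁻¹ * T) * J) ^ 2 = J⁻¹ * (g⁻¹ * T) ^ 2 * J := by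
    simp only [pow_two, Matrix.mul_assoc, Matrix.mul_nonsing_inv_cancel_left _ _ hJu]
  have htrace (A : Matrix (Fin n) (Fin n) ℝ) : (J⁻¹ * A * J).trace = A.trace := by
    rw [Matrix.trace_mul_cycle, Matrix.mul_nonsing_inv _ hJu, Matrix.one_mul]
  have hTJ : (Jᵀ * T * J).IsSymm := by
    simp [Matrix.IsSymm, Matrix.transpose_mul, hT.eq, Matrix.mul_assoc]
  rw [normSq_tracelessPart (posDef_transpose_mul_mul hg hJ) hTJ, normSq_tracelessPart hg hT, hconj,
    hconj_sq, htrace, htrace]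

end Coord

/-! ### Conformal classes of inner products -/

section ConformalClass

variable {n : ℕ} {P Q V C : Matrix (Fin n) (Fin n) ℝ} {s : Set ℝ} {t : ℝ}
  {γ W : ℝ → Matrix (Fin n) (Fin n) ℝ}

/-- The multiple of determinant one of a positive definite matrix: the normalization that
represents the conformal class of an inner product by a point of `SO(n) \ SL(n)`. -/
noncomputable def detNormalize (P : Matrix (Fin n) (Fin n) ℝ) : Matrix (Fin n) (Fin n) ℝ :=
  (P.det ^ (-(1 / (n : ℝ)))) • P

/-- The distance in `SO(n) \ SL(n)` between the conformal classes of two inner products, given by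
their Gram matrices in a common basis. -/
noncomputable def conformalDist (P Q : Matrix (Fin n) (Fin n) ℝ) : ENNReal :=
  symmDist (detNormalize P) (detNormalize Q)

/-- The speed at which the conformal class of a moving inner product `P` varies when `P` has
velocity `V`: the `P`-norm of the traceless part of `V`. -/
noncomputable def conformalSpeed (P V : Matrix (Fin n) (Fin n) ℝ) : ℝ :=
  √(Coord.normSq P (Coord.tracelessPart P V))

theorem posDef_detNormalize (hP : P.PosDef) : (detNormalize P).PosDef :=
  hP.smul (Real.rpow_pos_of_pos hP.det_pos _)

theorem det_detNormalize (hP : P.PosDef) : (detNormalize P).det = 1 := by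
  rcases eq_or_ne n 0 with rfl | hn
  · exact Matrix.det_isEmpty
  have hn' : (n : ℝ) ≠ 0 := Nat.cast_ne_zero.2 hn
  rw [detNormalize, Matrix.det_smul, Fintype.card_fin, ← Real.rpow_natCast,
    ← Real.rpow_mul hP.det_pos.le, ← Real.rpow_add_one hP.det_pos.ne', neg_mul,
    one_div_mul_cancel hn', neg_add_cancel, Real.rpow_zero]

theorem detNormalize_of_det_eq_one (hP : P.det = 1) : detNormalize P = P := by
  simp [detNormalize, hP]

theorem detNormalize_smul (hP : P.PosDef) {c : ℝ} (hc : 0 < c) :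
    detNormalize (c • P) = detNormalize P := by
  rcases eq_or_ne n 0 with rfl | hn
  · exact Subsingleton.elim _ _
  have hn' : (n : ℝ) ≠ 0 := Nat.cast_ne_zero.2 hn
  have hexp : (n : ℝ) * -(1 / (n : ℝ)) + 1 = 0 := by field_simp; ring
  rw [detNormalize, detNormalize, Matrix.det_smul, Fintype.card_fin, smul_smul,
    Real.mul_rpow (by positivity) hP.det_pos.le, ← Real.rpow_natCast, ← Real.rpow_mul hc.le,
    mul_right_comm, ← Real.rpow_add_one hc.ne', hexp, Real.rpow_zero, one_mul]

theorem continuousAt_detNormalize (hP : P.det ≠ 0) : ContinuousAt detNormalize P :=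
  (continuous_id.matrix_det.continuousAt.rpow_const (Or.inl hP)).smul continuousAt_id

theorem contDiffOn_detNormalize_apply (hγ : ∀ i j, ContDiffOn ℝ 1 (fun τ => γ τ i j) s)
    (hpos : ∀ τ ∈ s, (γ τ).PosDef) (i j : Fin n) :
    ContDiffOn ℝ 1 (fun τ => detNormalize (γ τ) i j) s :=
  ((contDiffOn_det hγ).rpow_const_of_ne fun τ hτ => (hpos τ hτ).det_pos.ne').mul (hγ i j)

theorem hasDerivWithinAt_detNormalize_apply (hV : V.IsSymm) (hpos : (γ t).PosDef)
    (hγ : ∀ i j, HasDerivWithinAt (fun τ => γ τ i j) (V i j) s t) (i j : Fin n) :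
    HasDerivWithinAt (fun τ => detNormalize (γ τ) i j)
      (((γ t).det ^ (-(1 / (n : ℝ))) • Coord.tracelessPart (γ t) V) i j) s t := by
  have hdet := hasDerivWithinAt_det_of_ne_zero hγ hpos.det_pos.ne'
  refine ((hdet.rpow_const (p := -(1 / (n : ℝ))) (Or.inl hpos.det_pos.ne')).mul
    (hγ i j)).congr_deriv ?_
  simp only [Coord.tracelessPart, Matrix.smul_apply, Matrix.sub_apply, smul_eq_mul,
    Coord.tr_eq_trace_of_isSymm _ hV]
  rw [Real.rpow_sub_one hpos.det_pos.ne']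
  field_simp [hpos.det_pos.ne']
  ring

theorem isSymm_of_hasDerivWithinAt (hs : UniqueDiffWithinAt ℝ s t) (ht : t ∈ s)
    (hsymm : ∀ τ ∈ s, (γ τ).IsSymm)
    (hγ : ∀ i j, HasDerivWithinAt (fun τ => γ τ i j) (V i j) s t) : V.IsSymm :=
  Matrix.IsSymm.ext fun i j => hs.eq_deriv _ (hγ j i)
    ((hγ i j).congr (fun τ hτ => (hsymm τ hτ).apply i j) ((hsymm t ht).apply i j))

theorem trace_sq_inv_mul_smul {c : ℝ} (hc : c ≠ 0) (hP : P.det ≠ 0) :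
    (((c • P)⁻¹ * (c • V)) ^ 2).trace = ((P⁻¹ * V) ^ 2).trace := by
  have := invertibleOfNonzero hc
  rw [Matrix.inv_smul _ _ hP.isUnit, Matrix.smul_mul, Matrix.mul_smul, smul_smul, invOf_mul_self,
    one_smul]

theorem conformalDist_le_lintegral_conformalSpeed
    (hγ : ∀ i j, ContDiffOn ℝ 1 (fun τ => γ τ i j) (Icc 0 1))
    (hpos : ∀ τ ∈ Icc (0 : ℝ) 1, (γ τ).PosDef)
    (hW : ∀ τ ∈ Icc (0 : ℝ) 1, ∀ i j,
      HasDerivWithinAt (fun σ => γ σ i j) (W τ i j) (Icc 0 1) τ) :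
    conformalDist (γ 0) (γ 1) ≤
      ∫⁻ τ in Icc (0 : ℝ) 1, ENNReal.ofReal (conformalSpeed (γ τ) (W τ)) := by
  have hcurve : IsSymmCurve (detNormalize (γ 0)) (detNormalize (γ 1))
      (fun τ => detNormalize (γ τ)) :=
    ⟨contDiffOn_detNormalize_apply hγ hpos, fun τ hτ => posDef_detNormalize (hpos τ hτ),
      fun τ hτ => det_detNormalize (hpos τ hτ), rfl, rfl⟩
  refine (iInf₂_le _ hcurve).trans (setLIntegral_congr_fun measurableSet_Icc fun τ hτ => ?_).le
  have hunique : UniqueDiffWithinAt ℝ (Icc (0 : ℝ) 1) τ := uniqueDiffOn_Icc one_pos τ hτ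
  have hsymm : (W τ).IsSymm :=
    isSymm_of_hasDerivWithinAt hunique hτ (fun σ hσ => isSymm_of_posDef (hpos σ hσ)) (hW τ hτ)
  have hvelocity : velocity (fun τ => detNormalize (γ τ)) τ =
      (γ τ).det ^ (-(1 / (n : ℝ))) • Coord.tracelessPart (γ τ) (W τ) := by
    ext i j
    exact (hasDerivWithinAt_detNormalize_apply hsymm (hpos τ hτ) (hW τ hτ) i j).derivWithin hunique
  have hdet := (hpos τ hτ).det_pos
  simp only
  rw [hvelocity, detNormalize, trace_sq_inv_mul_smul (Real.rpow_pos_of_pos hdet _).ne' hdet.ne',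
    conformalSpeed,
    Coord.normSq_eq_trace_sq (hpos τ hτ) (Coord.isSymm_tracelessPart (hpos τ hτ) hsymm)]

theorem conformalSpeed_le_sqrt_trace_sq (hP : P.PosDef) (hV : V.IsSymm) :
    conformalSpeed P V ≤ √((P⁻¹ * V) ^ 2).trace := by
  rw [conformalSpeed, Coord.normSq_tracelessPart hP hV]
  exact Real.sqrt_le_sqrt (sub_le_self _ (by positivity))

theorem continuousAt_conformalSpeed (hP : P.det ≠ 0) :
    ContinuousAt (fun p : Matrix (Fin n) (Fin n) ℝ × Matrix (Fin n) (Fin n) ℝ =>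
      conformalSpeed p.1 p.2) (P, V) := by
  have hinv : ContinuousAt (fun p : Matrix (Fin n) (Fin n) ℝ × Matrix (Fin n) (Fin n) ℝ => p.1⁻¹)
      (P, V) := by
    have hdet : ContinuousAt Ring.inverse P.det := by
      simpa only [Ring.inverse_eq_inv'] using continuousAt_inv₀ hP
    exact (continuousAt_matrix_inv _ hdet).comp (x := (P, V)) continuousAt_fst
  have hinv' (i j : Fin n) : ContinuousAt
      (fun p : Matrix (Fin n) (Fin n) ℝ × Matrix (Fin n) (Fin n) ℝ => p.1⁻¹ i j) (P, V) :=
    (continuous_id.matrix_elem i j).continuousAt.comp hinv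
  unfold conformalSpeed Coord.normSq Coord.tracelessPart Coord.tr
  simp only [Matrix.sub_apply, Matrix.smul_apply, smul_eq_mul]
  fun_prop

theorem IsSymmCurve.hasDerivWithinAt (hγ : IsSymmCurve P Q γ) {τ : ℝ} (hτ : τ ∈ Icc (0 : ℝ) 1)
    (i j : Fin n) : HasDerivWithinAt (fun σ => γ σ i j) (velocity γ τ i j) (Icc 0 1) τ :=
  ((hγ.smooth i j).differentiableOn one_ne_zero τ hτ).hasDerivWithinAt

theorem IsSymmCurve.isSymm_velocity (hγ : IsSymmCurve P Q γ) {τ : ℝ} (hτ : τ ∈ Icc (0 : ℝ) 1) :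
    (velocity γ τ).IsSymm :=
  isSymm_of_hasDerivWithinAt (uniqueDiffOn_Icc one_pos τ hτ) hτ
    (fun σ hσ => isSymm_of_posDef (hγ.posDef σ hσ)) (hγ.hasDerivWithinAt hτ)

theorem IsSymmCurve.conformalSpeed_le (hγ : IsSymmCurve P Q γ) {τ : ℝ} (hτ : τ ∈ Icc (0 : ℝ) 1) :
    conformalSpeed (γ τ) (velocity γ τ) ≤
      √(((γ τ)⁻¹ * velocity γ τ) ^ 2).trace :=
  conformalSpeed_le_sqrt_trace_sq (hγ.posDef τ hτ) (hγ.isSymm_velocity hτ)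

theorem conformalDist_smul_smul (hP : P.PosDef) (hQ : Q.PosDef) {c d : ℝ} (hc : 0 < c)
    (hd : 0 < d) : conformalDist (c • P) (d • Q) = conformalDist P Q := by
  rw [conformalDist, detNormalize_smul hP hc, detNormalize_smul hQ hd, conformalDist]

theorem conformalDist_detNormalize (hP : P.PosDef) (hQ : Q.PosDef) :
    conformalDist (detNormalize P) (detNormalize Q) = conformalDist P Q :=
  conformalDist_smul_smul hP hQ (Real.rpow_pos_of_pos hP.det_pos _)
    (Real.rpow_pos_of_pos hQ.det_pos _)

theorem IsSymmCurve.conformalDist_transpose_mul_mul_le (hγ : IsSymmCurve P Q γ)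
    (hC : C.det ≠ 0) : conformalDist (Cᵀ * P * C) (Cᵀ * Q * C) ≤ symmLength γ := by
  have hentry (A : Matrix (Fin n) (Fin n) ℝ) (i j : Fin n) :
      (Cᵀ * A * C) i j = ∑ b, ∑ a, C a i * A a b * C b j := by
    simp [Matrix.mul_apply, Finset.sum_mul]
  have hsmooth (i j : Fin n) : ContDiffOn ℝ 1 (fun τ => (Cᵀ * γ τ * C) i j) (Icc 0 1) := by
    simp only [hentry]
    exact ContDiffOn.sum fun b _ => ContDiffOn.sum fun a _ =>
      (contDiffOn_const.mul (hγ.smooth a b)).mul contDiffOn_const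
  have hderiv : ∀ τ ∈ Icc (0 : ℝ) 1, ∀ i j, HasDerivWithinAt (fun σ => (Cᵀ * γ σ * C) i j)
      ((Cᵀ * velocity γ τ * C) i j) (Icc 0 1) τ := fun τ hτ i j => by
    simp only [hentry]
    exact HasDerivWithinAt.fun_sum fun b _ => HasDerivWithinAt.fun_sum fun a _ =>
      ((hγ.hasDerivWithinAt hτ a b).const_mul _).mul_const _
  have hle := conformalDist_le_lintegral_conformalSpeed hsmooth
    (fun τ hτ => posDef_transpose_mul_mul (hγ.posDef τ hτ) hC) hderiv
  rw [hγ.source, hγ.target] at hle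
  refine hle.trans (setLIntegral_mono' measurableSet_Icc fun τ hτ => ENNReal.ofReal_le_ofReal ?_)
  rw [conformalSpeed, Coord.normSq_tracelessPart_congr (hγ.posDef τ hτ) (hγ.isSymm_velocity hτ) hC]
  exact hγ.conformalSpeed_le hτ

theorem conformalDist_transpose_mul_mul_le (hP : P.PosDef) (hQ : Q.PosDef) (hC : C.det ≠ 0) :
    conformalDist (Cᵀ * P * C) (Cᵀ * Q * C) ≤ conformalDist P Q := by
  have hnormalize (A : Matrix (Fin n) (Fin n) ℝ) :
      Cᵀ * detNormalize A * C = (A.det ^ (-(1 / (n : ℝ)))) • (Cᵀ * A * C) := by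
    rw [detNormalize, Matrix.mul_smul, Matrix.smul_mul]
  have heq : conformalDist (Cᵀ * detNormalize P * C) (Cᵀ * detNormalize Q * C) =
      conformalDist (Cᵀ * P * C) (Cᵀ * Q * C) := by
    rw [hnormalize, hnormalize]
    exact conformalDist_smul_smul (posDef_transpose_mul_mul hP hC)
      (posDef_transpose_mul_mul hQ hC) (Real.rpow_pos_of_pos hP.det_pos _)
      (Real.rpow_pos_of_pos hQ.det_pos _)
  rw [← heq]
  exact le_iInf₂ fun γ hγ => hγ.conformalDist_transpose_mul_mul_le hC

theorem conformalDist_transpose_mul_mul (hP : P.PosDef) (hQ : Q.PosDef) (hC : C.det ≠ 0) :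
    conformalDist (Cᵀ * P * C) (Cᵀ * Q * C) = conformalDist P Q := by
  have hCt : IsUnit Cᵀ.det := by rw [Matrix.det_transpose]; exact hC.isUnit
  have hcancel (A : Matrix (Fin n) (Fin n) ℝ) : (C⁻¹)ᵀ * (Cᵀ * A * C) * C⁻¹ = A := by
    rw [Matrix.transpose_nonsing_inv]
    simp only [Matrix.mul_assoc, Matrix.mul_nonsing_inv _ hC.isUnit, Matrix.mul_one,
      Matrix.nonsing_inv_mul_cancel_left _ _ hCt]
  refine (conformalDist_transpose_mul_mul_le hP hQ hC).antisymm ?_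
  simpa only [hcancel] using conformalDist_transpose_mul_mul_le (C := C⁻¹)
    (posDef_transpose_mul_mul hP hC) (posDef_transpose_mul_mul hQ hC)
    (Matrix.isUnit_nonsing_inv_det _ hC.isUnit).ne_zero

theorem eventually_posDef_of_isSymm (hP : P.PosDef) : ∀ᶠ A in 𝓝 P, A.IsSymm → A.PosDef := by
  have hform : Continuous fun p : Matrix (Fin n) (Fin n) ℝ × (Fin n → ℝ) =>
      p.2 ⬝ᵥ (p.1 *ᵥ p.2) :=
    continuous_snd.dotProduct (continuous_fst.matrix_mulVec continuous_snd)
  have hsphere := (isCompact_sphere (0 : Fin n → ℝ) 1).eventually_forall_of_forall_eventually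
    (x₀ := P) (P := fun A v => 0 < v ⬝ᵥ (A *ᵥ v)) fun v hv =>
      hform.continuousAt.eventually_const_lt <| by
        have hv0 : v ≠ 0 := ne_zero_of_mem_unit_sphere ⟨v, hv⟩
        simpa using hP.dotProduct_mulVec_pos hv0
  filter_upwards [hsphere] with A hA hsymm
  refine Matrix.PosDef.of_dotProduct_mulVec_pos (Matrix.isHermitian_iff_isSymm.2 hsymm)
    fun v hv => ?_
  have hnorm : 0 < ‖v‖ := norm_pos_iff.2 hv
  have hunit := hA (‖v‖⁻¹ • v) (by simp [norm_smul, hnorm.ne'])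
  rw [Matrix.mulVec_smul, smul_dotProduct, dotProduct_smul, smul_smul, smul_eq_mul] at hunit
  simpa using pos_of_mul_pos_right hunit (by positivity)

/-- The curve `γ` on `[0,1]`, with its end points moved to `p.1` and `p.2` by adding an affine
function of time. -/
def moveEndpoints (γ : ℝ → Matrix (Fin n) (Fin n) ℝ)
    (p : Matrix (Fin n) (Fin n) ℝ × Matrix (Fin n) (Fin n) ℝ) (τ : ℝ) : Matrix (Fin n) (Fin n) ℝ :=
  γ τ + (1 - τ) • (p.1 - γ 0) + τ • (p.2 - γ 1)

theorem hasDerivWithinAt_moveEndpoints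
    (hγ : ∀ i j, HasDerivWithinAt (fun σ => γ σ i j) (V i j) s t)
    (p : Matrix (Fin n) (Fin n) ℝ × Matrix (Fin n) (Fin n) ℝ) (i j : Fin n) :
    HasDerivWithinAt (fun σ => moveEndpoints γ p σ i j)
      ((V - (p.1 - γ 0) + (p.2 - γ 1)) i j) s t := by
  have hid := hasDerivWithinAt_id t s
  refine (((hγ i j).add ((hid.const_sub 1).mul_const ((p.1 - γ 0) i j))).add
    (hid.mul_const ((p.2 - γ 1) i j))).congr_deriv ?_
  simp only [Matrix.add_apply, Matrix.sub_apply]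
  ring

theorem IsSymmCurve.conformalDist_moveEndpoints_le (hγ : IsSymmCurve P Q γ)
    {p : Matrix (Fin n) (Fin n) ℝ × Matrix (Fin n) (Fin n) ℝ}
    (hpos : ∀ τ ∈ Icc (0 : ℝ) 1, (moveEndpoints γ p τ).PosDef) :
    conformalDist p.1 p.2 ≤ ∫⁻ τ in Icc (0 : ℝ) 1, ENNReal.ofReal (conformalSpeed
      (moveEndpoints γ p τ) (velocity γ τ - (p.1 - γ 0) + (p.2 - γ 1))) := by
  have hsmooth (i j : Fin n) : ContDiffOn ℝ 1 (fun τ => moveEndpoints γ p τ i j) (Icc 0 1) :=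
    ((hγ.smooth i j).add ((contDiffOn_const.sub contDiffOn_id).mul contDiffOn_const)).add
      (contDiffOn_id.mul contDiffOn_const)
  simpa [moveEndpoints] using conformalDist_le_lintegral_conformalSpeed hsmooth hpos
    fun τ hτ => hasDerivWithinAt_moveEndpoints (hγ.hasDerivWithinAt hτ) p

theorem IsSymmCurve.moveEndpoints_self (hγ : IsSymmCurve P Q γ) :
    moveEndpoints γ (P, Q) = γ := by
  ext τ : 1
  simp [moveEndpoints, hγ.source, hγ.target]

theorem IsSymmCurve.continuous_moveEndpoints (hγ : IsSymmCurve P Q γ) :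
    Continuous fun q : (Matrix (Fin n) (Fin n) ℝ × Matrix (Fin n) (Fin n) ℝ) × Icc (0 : ℝ) 1 =>
      moveEndpoints γ q.1 q.2 := by
  have hcont : Continuous fun τ : Icc (0 : ℝ) 1 => γ τ :=
    continuous_matrix fun i j => (hγ.smooth i j).continuousOn.domRestrict
  exact ((hcont.comp continuous_snd).add (by fun_prop)).add (by fun_prop)

theorem IsSymmCurve.continuous_velocity (hγ : IsSymmCurve P Q γ) :
    Continuous fun τ : Icc (0 : ℝ) 1 => velocity γ τ :=
  continuous_matrix fun i j => ((hγ.smooth i j).continuousOn_derivWithin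
    (uniqueDiffOn_Icc one_pos) le_rfl).domRestrict

theorem IsSymmCurve.eventually_posDef_moveEndpoints (hγ : IsSymmCurve P Q γ) :
    ∀ᶠ p in 𝓝 (P, Q), p.1.IsSymm → p.2.IsSymm →
      ∀ τ ∈ Icc (0 : ℝ) 1, (moveEndpoints γ p τ).PosDef := by
  have hnear : ∀ᶠ p in 𝓝 (P, Q), ∀ τ ∈ (univ : Set (Icc (0 : ℝ) 1)),
      (moveEndpoints γ p τ).IsSymm → (moveEndpoints γ p τ).PosDef :=
    isCompact_univ.eventually_forall_of_forall_eventually fun τ _ =>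
      hγ.continuous_moveEndpoints.continuousAt.eventually
        (eventually_posDef_of_isSymm <| by
          simpa only [hγ.moveEndpoints_self] using hγ.posDef τ τ.2)
  filter_upwards [hnear] with p hp hsymm₁ hsymm₂ τ hτ
  have hsymm (σ : ℝ) (hσ : σ ∈ Icc (0 : ℝ) 1) := isSymm_of_posDef (hγ.posDef σ hσ)
  exact hp ⟨τ, hτ⟩ (mem_univ _) (((hsymm τ hτ).add
    ((hsymm₁.sub (hsymm 0 (by simp))).smul _)).add ((hsymm₂.sub (hsymm 1 (by simp))).smul _))

theorem IsSymmCurve.eventually_conformalSpeed_moveEndpoints_lt (hγ : IsSymmCurve P Q γ) {ε : ℝ}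
    (hε : 0 < ε) :
    ∀ᶠ p in 𝓝 (P, Q), ∀ τ ∈ (univ : Set (Icc (0 : ℝ) 1)),
      conformalSpeed (moveEndpoints γ p τ) (velocity γ τ - (p.1 - γ 0) + (p.2 - γ 1)) <
        conformalSpeed (γ τ) (velocity γ τ) + ε := by
  have hvelocity : Continuous
      fun q : (Matrix (Fin n) (Fin n) ℝ × Matrix (Fin n) (Fin n) ℝ) × Icc (0 : ℝ) 1 =>
        velocity γ q.2 - (q.1.1 - γ 0) + (q.1.2 - γ 1) :=
    ((hγ.continuous_velocity.comp continuous_snd).sub (by fun_prop)).add (by fun_prop)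
  have hpair : Continuous
      fun q : (Matrix (Fin n) (Fin n) ℝ × Matrix (Fin n) (Fin n) ℝ) × Icc (0 : ℝ) 1 =>
        (moveEndpoints γ (P, Q) q.2, velocity γ q.2) :=
    (hγ.continuous_moveEndpoints.comp (continuous_const.prodMk continuous_snd)).prodMk
      (hγ.continuous_velocity.comp continuous_snd)
  refine isCompact_univ.eventually_forall_of_forall_eventually fun τ _ => ?_
  have hdet : (moveEndpoints γ (P, Q) τ).det ≠ 0 := by
    rw [hγ.moveEndpoints_self]; exact (hγ.posDef τ τ.2).det_pos.ne'
  have hleft := (continuousAt_conformalSpeed hdet).comp (x := ((P, Q), τ))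
    (hγ.continuous_moveEndpoints.prodMk hvelocity).continuousAt
  have hright := (continuousAt_conformalSpeed hdet).comp (x := ((P, Q), τ)) hpair.continuousAt
  rw [hγ.moveEndpoints_self] at hright
  refine hleft.eventually_lt (hright.add continuousAt_const) ?_
  simpa [hγ.moveEndpoints_self, hγ.source, hγ.target] using hε

theorem IsSymmCurve.eventually_conformalDist_lt (hγ : IsSymmCurve P Q γ) {c : ENNReal}
    (hlt : symmLength γ < c) :
    ∀ᶠ p in 𝓝 (P, Q), p.1.IsSymm → p.2.IsSymm → conformalDist p.1 p.2 < c := by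
  obtain ⟨ε, hε, hltε⟩ : ∃ ε : NNReal, 0 < ε ∧ symmLength γ + ε < c :=
    ENNReal.lt_iff_exists_add_pos_lt.1 hlt
  filter_upwards [hγ.eventually_posDef_moveEndpoints,
    hγ.eventually_conformalSpeed_moveEndpoints_lt (NNReal.coe_pos.2 hε)]
    with p hpos hspeed hsymm₁ hsymm₂
  calc conformalDist p.1 p.2
      ≤ ∫⁻ τ in Icc (0 : ℝ) 1, ENNReal.ofReal (conformalSpeed
          (moveEndpoints γ p τ) (velocity γ τ - (p.1 - γ 0) + (p.2 - γ 1))) :=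
        hγ.conformalDist_moveEndpoints_le (hpos hsymm₁ hsymm₂)
    _ ≤ ∫⁻ τ in Icc (0 : ℝ) 1, (ENNReal.ofReal
          (√(((γ τ)⁻¹ * velocity γ τ) ^ 2).trace) + ε) :=
        setLIntegral_mono' measurableSet_Icc fun τ hτ => by
          rw [← ENNReal.ofReal_coe_nnreal, ← ENNReal.ofReal_add (Real.sqrt_nonneg _) ε.coe_nonneg]
          exact ENNReal.ofReal_le_ofReal <| (hspeed ⟨τ, hτ⟩ (mem_univ _)).le.trans <|
            add_le_add_left (hγ.conformalSpeed_le hτ) _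
    _ = symmLength γ + ε := by rw [lintegral_add_right _ measurable_const]; simp [symmLength]
    _ < c := hltε

theorem eventually_conformalDist_lt (hP : P.PosDef) (hQ : Q.PosDef) {c : ENNReal}
    (hlt : conformalDist P Q < c) :
    ∀ᶠ p in 𝓝 (P, Q), p.1.PosDef → p.2.PosDef → conformalDist p.1 p.2 < c := by
  simp only [conformalDist, symmDist, iInf_lt_iff] at hlt
  obtain ⟨γ, hγ, hlt⟩ := hlt
  have hcont : ContinuousAt (Prod.map detNormalize detNormalize) (P, Q) :=
    (continuousAt_detNormalize hP.det_pos.ne').prodMap (continuousAt_detNormalize hQ.det_pos.ne')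
  filter_upwards [hcont.eventually (hγ.eventually_conformalDist_lt hlt)] with p hp hp₁ hp₂
  rw [← conformalDist_detNormalize hp₁ hp₂]
  exact hp (isSymm_of_posDef (posDef_detNormalize hp₁)) (isSymm_of_posDef (posDef_detNormalize hp₂))

end ConformalClass

/-! ### Gram matrices and components in charts -/

section Gram

variable {ι V : Type*} [AddCommGroup V] [Module ℝ V] [TopologicalSpace V]

/-- The matrix of the bilinear form `B` in the family of vectors `v`. -/
noncomputable def gramMatrix (B : V →L[ℝ] V →L[ℝ] ℝ) (v : ι → V) : Matrix ι ι ℝ :=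
  Matrix.of fun i j => B (v i) (v j)

theorem gramMatrix_of_eq_sum [Fintype ι] (B : V →L[ℝ] V →L[ℝ] ℝ) {v w : ι → V} {C : Matrix ι ι ℝ}
    (hw : ∀ i, w i = ∑ k, C k i • v k) :
    gramMatrix B w = Cᵀ * gramMatrix B v * C := by
  ext i j
  simp only [gramMatrix, Matrix.of_apply, hw, map_sum, map_smul, Matrix.mul_apply,
    Matrix.transpose_apply, _root_.sum_apply, _root_.smul_apply, smul_eq_mul, Finset.sum_mul,
    Finset.mul_sum]
  exact Finset.sum_congr rfl fun k _ => Finset.sum_congr rfl fun l _ => by ring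

theorem dotProduct_gramMatrix_mulVec [Fintype ι] (B : V →L[ℝ] V →L[ℝ] ℝ) (v : ι → V) (x : ι → ℝ) :
    x ⬝ᵥ (gramMatrix B v *ᵥ x) = B (∑ i, x i • v i) (∑ i, x i • v i) := by
  simp only [gramMatrix, dotProduct, Matrix.mulVec, Finset.mul_sum, _root_.sum_apply, map_sum,
    map_smul, _root_.smul_apply, Matrix.of_apply, smul_eq_mul]
  rw [Finset.sum_comm]
  exact Finset.sum_congr rfl fun j _ => Finset.sum_congr rfl fun i _ => by ring

theorem posDef_gramMatrix [Finite ι] {B : V →L[ℝ] V →L[ℝ] ℝ} {v : ι → V}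
    (hsymm : ∀ v w, B v w = B w v) (hpos : ∀ v, v ≠ 0 → 0 < B v v)
    (hv : LinearIndependent ℝ v) : (gramMatrix B v).PosDef := by
  cases nonempty_fintype ι
  refine Matrix.PosDef.of_dotProduct_mulVec_pos (Matrix.IsHermitian.ext fun i j => hsymm _ _)
    fun x hx => ?_
  rw [star_trivial, dotProduct_gramMatrix_mulVec]
  exact hpos _ fun h0 => hx (funext (Fintype.linearIndependent_iff.1 hv x h0))

end Gram

section Charts

variable {n : ℕ} {X : Type*} [TopologicalSpace X]

/-- The Jacobian matrix of the change of charts from `e` to `e'`. -/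
noncomputable def jacobian (e e' : OpenPartialHomeomorph X (EuclideanSpace ℝ (Fin n)))
    (y : EuclideanSpace ℝ (Fin n)) : Matrix (Fin n) (Fin n) ℝ :=
  LinearMap.toMatrix (EuclideanSpace.basisFun (Fin n) ℝ).toBasis
    (EuclideanSpace.basisFun (Fin n) ℝ).toBasis (fderiv ℝ (e' ∘ e.symm) y).toLinearMap

theorem det_jacobian (e e' : OpenPartialHomeomorph X (EuclideanSpace ℝ (Fin n)))
    (y : EuclideanSpace ℝ (Fin n)) :
    (jacobian e e' y).det = (fderiv ℝ (e' ∘ e.symm) y).det :=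
  LinearMap.det_toMatrix _ _

theorem fderiv_transition_single (e e' : OpenPartialHomeomorph X (EuclideanSpace ℝ (Fin n)))
    (y : EuclideanSpace ℝ (Fin n)) (i : Fin n) :
    fderiv ℝ (e' ∘ e.symm) y (EuclideanSpace.single i 1) =
      ∑ k, jacobian e e' y k i • EuclideanSpace.single k (1 : ℝ) := by
  have hrepr := (EuclideanSpace.basisFun (Fin n) ℝ).toBasis.sum_repr
    (fderiv ℝ (e' ∘ e.symm) y (EuclideanSpace.single i 1))
  simpa [jacobian, LinearMap.toMatrix_apply] using hrepr.symm

variable [ChartedSpace (EuclideanSpace ℝ (Fin n)) X]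

/-- The differential of the inverse of a chart, all tangent spaces being identified with `ℝⁿ` so
that the differentials of different charts can be compared. -/
noncomputable def chartDeriv (e : OpenPartialHomeomorph X (EuclideanSpace ℝ (Fin n)))
    (y : EuclideanSpace ℝ (Fin n)) : EuclideanSpace ℝ (Fin n) →L[ℝ] EuclideanSpace ℝ (Fin n) :=
  mfderiv (𝓡 n) (𝓡 n) e.symm y

/-- The coordinate frame `∂ᵢ` of the chart `e` at the point with coordinates `y`. -/
noncomputable def chartFrame (e : OpenPartialHomeomorph X (EuclideanSpace ℝ (Fin n)))
    (y : EuclideanSpace ℝ (Fin n)) (i : Fin n) : EuclideanSpace ℝ (Fin n) :=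
  chartDeriv e y (EuclideanSpace.single i 1)

/-- The value of a tensor field at a point, all tangent spaces being identified with `ℝⁿ`. -/
def tensorAt (T : Cov2Tensor n X) (x : X) :
    EuclideanSpace ℝ (Fin n) →L[ℝ] EuclideanSpace ℝ (Fin n) →L[ℝ] ℝ := T x

theorem components_eq_gramMatrix (e : OpenPartialHomeomorph X (EuclideanSpace ℝ (Fin n)))
    (T : Cov2Tensor n X) (y : EuclideanSpace ℝ (Fin n)) :
    components e T y = gramMatrix (tensorAt T (e.symm y)) (chartFrame e y) := rfl

theorem isSymm_components (e : OpenPartialHomeomorph X (EuclideanSpace ℝ (Fin n)))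
    {T : Cov2Tensor n X} (hT : ∀ (x : X) (v w : TangentSpace (𝓡 n) x), T x v w = T x w v)
    (y : EuclideanSpace ℝ (Fin n)) : (components e T y).IsSymm :=
  Matrix.IsSymm.ext fun _ _ => hT _ _ _

theorem continuousOn_sqrt_det {α : Type*} [TopologicalSpace α] {s : Set α}
    {M : α → Matrix (Fin n) (Fin n) ℝ} (hM : ∀ i j, ContinuousOn (fun y => M y i j) s) :
    ContinuousOn (fun y => √(M y).det) s :=
  Real.continuous_sqrt.comp_continuousOn (continuous_id.matrix_det.comp_continuousOn
    (continuousOn_pi.2 fun i => continuousOn_pi.2 fun j => hM i j))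

variable {e e' : OpenPartialHomeomorph X (EuclideanSpace ℝ (Fin n))}
  {y : EuclideanSpace ℝ (Fin n)}

variable [IsManifold (𝓡 n) ∞ X]

theorem linearIndependent_chartFrame (he : e ∈ atlas (EuclideanSpace ℝ (Fin n)) X)
    (hy : y ∈ e.target) : LinearIndependent ℝ (chartFrame e y) := by
  have hinj : Function.Injective (chartDeriv e y) :=
    (mdifferentiable_of_mem_atlas (I := 𝓡 n) he).symm.mfderiv_injective hy
  have hframe : chartFrame e y = chartDeriv e y ∘ (EuclideanSpace.basisFun (Fin n) ℝ).toBasis := by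
    ext1 i
    simp [chartFrame]
  rw [hframe]
  exact (EuclideanSpace.basisFun (Fin n) ℝ).toBasis.linearIndependent.map_injOn
    (chartDeriv e y).toLinearMap hinj.injOn

theorem differentiableAt_transition (he : e ∈ atlas (EuclideanSpace ℝ (Fin n)) X)
    (he' : e' ∈ atlas (EuclideanSpace ℝ (Fin n)) X) (hy : y ∈ e.target)
    (hy' : e.symm y ∈ e'.source) : DifferentiableAt ℝ (e' ∘ e.symm) y :=
  (MDifferentiableAt.comp (I := 𝓡 n) (I' := 𝓡 n) (I'' := 𝓡 n) y
    (mdifferentiableAt_atlas he' hy') (mdifferentiableAt_atlas_symm he hy)).differentiableAt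

theorem chartDeriv_eq_comp (he : e ∈ atlas (EuclideanSpace ℝ (Fin n)) X)
    (he' : e' ∈ atlas (EuclideanSpace ℝ (Fin n)) X) (hy : y ∈ e.target)
    (hy' : e.symm y ∈ e'.source) :
    chartDeriv e y = (chartDeriv e' (e' (e.symm y))).comp (fderiv ℝ (e' ∘ e.symm) y) := by
  have htransition : MDifferentiableAt (𝓡 n) (𝓡 n) (e' ∘ e.symm) y :=
    (differentiableAt_transition he he' hy hy').mdifferentiableAt
  have hsymm : MDifferentiableAt (𝓡 n) (𝓡 n) e'.symm ((e' ∘ e.symm) y) :=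
    mdifferentiableAt_atlas_symm he' (e'.map_source hy')
  have hnear : e.symm =ᶠ[𝓝 y] e'.symm ∘ e' ∘ e.symm := by
    filter_upwards [(e.continuousAt_symm hy).preimage_mem_nhds (e'.open_source.mem_nhds hy')]
      with z hz using (e'.left_inv hz).symm
  have hchain := (hnear.mfderiv_eq (I := 𝓡 n) (I' := 𝓡 n)).trans (mfderiv_comp y hsymm htransition)
  rwa [mfderiv_eq_fderiv] at hchain

theorem chartFrame_eq_sum (he : e ∈ atlas (EuclideanSpace ℝ (Fin n)) X)
    (he' : e' ∈ atlas (EuclideanSpace ℝ (Fin n)) X) (hy : y ∈ e.target)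
    (hy' : e.symm y ∈ e'.source) (i : Fin n) :
    chartFrame e y i = ∑ k, jacobian e e' y k i • chartFrame e' (e' (e.symm y)) k := by
  simp only [chartFrame]
  rw [chartDeriv_eq_comp he he' hy hy', ContinuousLinearMap.comp_apply, fderiv_transition_single,
    map_sum]
  simp only [map_smul]

theorem components_change (he : e ∈ atlas (EuclideanSpace ℝ (Fin n)) X)
    (he' : e' ∈ atlas (EuclideanSpace ℝ (Fin n)) X) (T : Cov2Tensor n X) (hy : y ∈ e.target)
    (hy' : e.symm y ∈ e'.source) :
    components e T y =
      (jacobian e e' y)ᵀ * components e' T (e' (e.symm y)) * jacobian e e' y := by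
  rw [components_eq_gramMatrix, components_eq_gramMatrix, e'.left_inv hy']
  exact gramMatrix_of_eq_sum _ (chartFrame_eq_sum he he' hy hy')

theorem det_jacobian_ne_zero (he : e ∈ atlas (EuclideanSpace ℝ (Fin n)) X)
    (he' : e' ∈ atlas (EuclideanSpace ℝ (Fin n)) X) (hy : y ∈ e.target)
    (hy' : e.symm y ∈ e'.source) : (jacobian e e' y).det ≠ 0 := by
  rw [← isUnit_iff_ne_zero, ← Matrix.isUnit_iff_isUnit_det, ← Matrix.mulVec_injective_iff_isUnit]
  refine (injective_iff_map_eq_zero (jacobian e e' y).mulVecLin).2 fun x hx => ?_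
  refine funext (Fintype.linearIndependent_iff.1 (linearIndependent_chartFrame he hy) x ?_)
  simp_rw [chartFrame_eq_sum he he' hy hy', Finset.smul_sum, smul_smul]
  rw [Finset.sum_comm]
  refine Finset.sum_eq_zero fun k _ => ?_
  rw [← Finset.sum_smul]
  have hk : ∑ i, x i * jacobian e e' y k i = 0 :=
    (Finset.sum_congr rfl fun i _ => mul_comm _ _).trans (congrFun hx k)
  rw [hk, zero_smul]

theorem sqrt_det_components_change {e e' : OpenPartialHomeomorph X (EuclideanSpace ℝ (Fin n))}
    (he : e ∈ atlas (EuclideanSpace ℝ (Fin n)) X) (he' : e' ∈ atlas (EuclideanSpace ℝ (Fin n)) X)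
    (h : Cov2Tensor n X) {y : EuclideanSpace ℝ (Fin n)} (hy : y ∈ e.target)
    (hy' : e.symm y ∈ e'.source) :
    √(components e h y).det =
      |(fderiv ℝ (e' ∘ e.symm) y).det| * √(components e' h (e' (e.symm y))).det := by
  rw [components_change he he' h hy hy', ← det_jacobian, Matrix.det_mul, Matrix.det_mul,
    Matrix.det_transpose, ← Real.sqrt_sq_eq_abs, ← Real.sqrt_mul (sq_nonneg _)]
  congr 1
  ring

theorem posDef_components (he : e ∈ atlas (EuclideanSpace ℝ (Fin n)) X) (h : SmoothMetric n X)
    (hy : y ∈ e.target) : (components e h.inner y).PosDef :=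
  posDef_gramMatrix (B := tensorAt h.inner (e.symm y)) (fun v w => h.symm (e.symm y) v w)
    (fun v hv => h.pos (e.symm y) v hv) (linearIndependent_chartFrame he hy)

theorem exists_partitionOfUnity [T2Space X] [CompactSpace X] :
    ∃ (t : Finset X) (ρ : X → X → ℝ), (∀ i ∈ t, ContMDiff (𝓡 n) 𝓘(ℝ) ∞ (ρ i)) ∧
      (∀ i ∈ t, ∀ x, 0 ≤ ρ i x) ∧ (∀ x, ∑ i ∈ t, ρ i x = 1) ∧
      ∀ i ∈ t, tsupport (ρ i) ⊆ (chartAt (EuclideanSpace ℝ (Fin n)) i).source := by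
  classical
  obtain ⟨t, ht⟩ := isCompact_univ.elim_nhds_subcover
    (fun x : X => (chartAt (EuclideanSpace ℝ (Fin n)) x).source)
    (fun x _ => chart_source_mem_nhds _ x)
  obtain ⟨f, hf⟩ := SmoothPartitionOfUnity.exists_isSubordinate (ι := t) (𝓡 n)
    (isClosed_univ (X := X))
    (fun i : t => (chartAt (EuclideanSpace ℝ (Fin n)) (i : X)).source)
    (fun i => (chartAt _ _).open_source) (by simpa [iUnion_subtype] using ht.2)
  refine ⟨t, fun i => if hi : i ∈ t then f ⟨i, hi⟩ else 0, fun i hi => ?_, fun i hi x => ?_,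
    fun x => ?_, fun i hi => ?_⟩
  · simpa [hi] using (f ⟨i, hi⟩).contMDiff
  · simpa [hi] using f.nonneg ⟨i, hi⟩ x
  · rw [← f.sum_eq_one (mem_univ x), finsum_eq_sum_of_fintype, ← Finset.sum_coe_sort t]
    exact Finset.sum_congr rfl fun i _ => by simp
  · simpa [hi] using hf ⟨i, hi⟩

end Charts

/-! ### The Riemannian measure -/

section Volume

variable {n : ℕ} {X : Type*} [TopologicalSpace X]

theorem symm_preimage_inter_target_eq_image
    {e e' : OpenPartialHomeomorph X (EuclideanSpace ℝ (Fin n))} {A : Set X} (hAe : A ⊆ e.source)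
    (hAe' : A ⊆ e'.source) :
    e'.symm ⁻¹' A ∩ e'.target = (e' ∘ e.symm) '' (e.symm ⁻¹' A ∩ e.target) := by
  have himage : e.symm '' (e '' A) = A := e.toPartialEquiv.symm_image_image_of_subset_source hAe
  rw [image_comp, inter_comm, inter_comm _ e.target, ← e.image_eq_target_inter_inv_preimage hAe,
    ← e'.image_eq_target_inter_inv_preimage hAe', himage]

variable [MeasurableSpace X]

theorem aemeasurable_chart_symm [BorelSpace X]
    (e : OpenPartialHomeomorph X (EuclideanSpace ℝ (Fin n)))
    (f : EuclideanSpace ℝ (Fin n) → ENNReal) :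
    AEMeasurable e.symm ((volume.restrict e.target).withDensity f) :=
  (e.continuousOn_symm.aemeasurable e.open_target.measurableSet).mono_ac
    (withDensity_absolutelyContinuous _ _)

theorem measurableSet_symm_preimage_inter_target [BorelSpace X]
    (e : OpenPartialHomeomorph X (EuclideanSpace ℝ (Fin n))) {A : Set X} (hA : MeasurableSet A) :
    MeasurableSet (e.symm ⁻¹' A ∩ e.target) := by
  have hmeas : Measurable (e.target.domRestrict e.symm) :=
    e.continuousOn_symm.domRestrict.measurable
  convert e.open_target.measurableSet.subtype_image (hmeas hA) using 1
  ext y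
  simp [domRestrict, and_comm]

variable [ChartedSpace (EuclideanSpace ℝ (Fin n)) X]

/-- The Riemannian measure on the domain of a chart. -/
noncomputable def chartVolume (e : OpenPartialHomeomorph X (EuclideanSpace ℝ (Fin n)))
    (h : Cov2Tensor n X) : Measure X :=
  ((volume.restrict e.target).withDensity
      (fun y => ENNReal.ofReal (√(components e h y).det))).map e.symm

theorem riemannianVolume_eq_iSup (h : Cov2Tensor n X) :
    riemannianVolume h = ⨆ e ∈ atlas (EuclideanSpace ℝ (Fin n)) X, chartVolume e h := rfl

theorem chartVolume_le_riemannianVolume {e : OpenPartialHomeomorph X (EuclideanSpace ℝ (Fin n))}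
    (he : e ∈ atlas (EuclideanSpace ℝ (Fin n)) X) (h : Cov2Tensor n X) :
    chartVolume e h ≤ riemannianVolume h :=
  le_iSup₂_of_le (f := fun e _ => chartVolume e h) e he le_rfl

variable [BorelSpace X]

theorem chartVolume_apply (e : OpenPartialHomeomorph X (EuclideanSpace ℝ (Fin n)))
    (h : Cov2Tensor n X) {A : Set X} (hA : MeasurableSet A) :
    chartVolume e h A = ∫⁻ y in e.symm ⁻¹' A ∩ e.target,
      ENNReal.ofReal (√(components e h y).det) := by
  rw [chartVolume, Measure.map_apply_of_aemeasurable (aemeasurable_chart_symm e _) hA,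
    withDensity_apply', Measure.restrict_restrict' e.open_target.measurableSet]

theorem chartVolume_compl_source (e : OpenPartialHomeomorph X (EuclideanSpace ℝ (Fin n)))
    (h : Cov2Tensor n X) : chartVolume e h e.sourceᶜ = 0 := by
  have hempty : e.symm ⁻¹' e.sourceᶜ ∩ e.target = ∅ :=
    disjoint_iff_inter_eq_empty.1 (disjoint_left.2 fun _ hy hy' => hy (e.map_target hy'))
  rw [chartVolume_apply e h e.open_source.measurableSet.compl, hempty, Measure.restrict_empty,
    lintegral_zero_measure]

theorem chartVolume_inter_source (e : OpenPartialHomeomorph X (EuclideanSpace ℝ (Fin n)))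
    (h : Cov2Tensor n X) (A : Set X) : chartVolume e h (A ∩ e.source) = chartVolume e h A :=
  measure_inter_conull (chartVolume_compl_source e h)

variable [IsManifold (𝓡 n) ∞ X]

theorem chartVolume_congr {e e' : OpenPartialHomeomorph X (EuclideanSpace ℝ (Fin n))}
    (he : e ∈ atlas (EuclideanSpace ℝ (Fin n)) X) (he' : e' ∈ atlas (EuclideanSpace ℝ (Fin n)) X)
    (h : Cov2Tensor n X) {A : Set X} (hA : MeasurableSet A) (hAe : A ⊆ e.source)
    (hAe' : A ⊆ e'.source) : chartVolume e h A = chartVolume e' h A := by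
  have hinj : InjOn (e' ∘ e.symm) (e.symm ⁻¹' A ∩ e.target) := fun y hy z hz hyz =>
    e.symm.injOn hy.2 hz.2 (e'.injOn (hAe' hy.1) (hAe' hz.1) hyz)
  rw [chartVolume_apply e h hA, chartVolume_apply e' h hA,
    symm_preimage_inter_target_eq_image hAe hAe',
    lintegral_image_eq_lintegral_abs_det_fderiv_mul volume
      (measurableSet_symm_preimage_inter_target e hA) (fun y hy => (differentiableAt_transition
        he he' hy.2 (hAe' hy.1)).hasFDerivAt.hasFDerivWithinAt) hinj]
  refine setLIntegral_congr_fun (measurableSet_symm_preimage_inter_target e hA) fun y hy => ?_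
  simp only [sqrt_det_components_change he he' h hy.2 (hAe' hy.1),
    ENNReal.ofReal_mul (abs_nonneg _), Function.comp_apply]

theorem chartVolume_restrict_le {e e' : OpenPartialHomeomorph X (EuclideanSpace ℝ (Fin n))}
    (he : e ∈ atlas (EuclideanSpace ℝ (Fin n)) X) (he' : e' ∈ atlas (EuclideanSpace ℝ (Fin n)) X)
    (h : Cov2Tensor n X) : (chartVolume e' h).restrict e.source ≤ chartVolume e h := by
  refine Measure.le_iff.2 fun B hB => ?_
  have hBe : MeasurableSet (B ∩ e.source ∩ e'.source) :=
    (hB.inter e.open_source.measurableSet).inter e'.open_source.measurableSet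
  rw [Measure.restrict_apply hB, ← chartVolume_inter_source,
    chartVolume_congr he' he h hBe inter_subset_right (inter_subset_left.trans inter_subset_right)]
  exact measure_mono (inter_subset_left.trans inter_subset_left)

theorem riemannianVolume_restrict_source {e : OpenPartialHomeomorph X (EuclideanSpace ℝ (Fin n))}
    (he : e ∈ atlas (EuclideanSpace ℝ (Fin n)) X) (h : Cov2Tensor n X) :
    (riemannianVolume h).restrict e.source = chartVolume e h := by
  have hle : riemannianVolume h ≤
      chartVolume e h + (riemannianVolume h).restrict e.sourceᶜ := by
    rw [riemannianVolume_eq_iSup]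
    refine iSup₂_le fun e' he' => ?_
    rw [← Measure.restrict_add_restrict_compl (μ := chartVolume e' h) e.open_source.measurableSet]
    exact add_le_add (chartVolume_restrict_le he he' h)
      (Measure.restrict_mono subset_rfl (chartVolume_le_riemannianVolume he' h))
  refine le_antisymm ((Measure.restrict_mono subset_rfl hle).trans ?_)
    (Measure.le_iff.2 fun A hA => ?_)
  · rw [Measure.restrict_add, Measure.restrict_restrict e.open_source.measurableSet,
      inter_compl_self, Measure.restrict_empty, add_zero]
    exact Measure.restrict_le_self
  · rw [Measure.restrict_apply hA, ← chartVolume_inter_source]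
    exact chartVolume_le_riemannianVolume he h _

theorem riemannianVolume_apply_of_subset {e : OpenPartialHomeomorph X (EuclideanSpace ℝ (Fin n))}
    (he : e ∈ atlas (EuclideanSpace ℝ (Fin n)) X) (h : Cov2Tensor n X) {A : Set X}
    (hAe : A ⊆ e.source) : riemannianVolume h A = chartVolume e h A := by
  rw [← riemannianVolume_restrict_source he, Measure.restrict_eq_self _ hAe]

theorem isFiniteMeasure_riemannianVolume [CompactSpace X] {h : Cov2Tensor n X}
    (hcont : ∀ e ∈ atlas (EuclideanSpace ℝ (Fin n)) X, ∀ i j,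
      ContinuousOn (fun y => components e h y i j) e.target) :
    IsFiniteMeasure (riemannianVolume h) := by
  refine ⟨isCompact_univ.measure_lt_top_of_nhdsWithin fun x _ => ?_⟩
  set e := chartAt (EuclideanSpace ℝ (Fin n)) x
  have he : e ∈ atlas (EuclideanSpace ℝ (Fin n)) X := chart_mem_atlas _ x
  have hx : x ∈ e.source := mem_chart_source _ x
  obtain ⟨C, hC, hCe, hCcomp⟩ := local_compact_nhds (e.open_target.mem_nhds (e.map_source hx))
  set U : Set X := e.source ∩ e ⁻¹' interior C
  have hU : IsOpen U := e.isOpen_inter_preimage isOpen_interior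
  have hsub : e.symm ⁻¹' U ∩ e.target ⊆ C := fun y ⟨hyU, hy⟩ =>
    interior_subset (e.right_inv hy ▸ hyU.2)
  refine ⟨U, mem_nhdsWithin_of_mem_nhds (hU.mem_nhds ⟨hx, mem_interior_iff_mem_nhds.2 hC⟩), ?_⟩
  rw [riemannianVolume_apply_of_subset he h inter_subset_left,
    chartVolume_apply e h hU.measurableSet]
  exact (lintegral_mono_set hsub).trans_lt
    (((continuousOn_sqrt_det (hcont e he)).mono hCe).integrableOn_compact hCcomp).lintegral_lt_top

theorem integral_riemannianVolume {e : OpenPartialHomeomorph X (EuclideanSpace ℝ (Fin n))}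
    (he : e ∈ atlas (EuclideanSpace ℝ (Fin n)) X) {h : Cov2Tensor n X}
    (hcont : ∀ i j, ContinuousOn (fun y => components e h y i j) e.target) {φ : X → ℝ}
    (hφ : AEStronglyMeasurable φ (riemannianVolume h)) (h0 : ∀ x, x ∉ e.source → φ x = 0) :
    ∫ x, φ x ∂riemannianVolume h =
      ∫ y in e.target, √(components e h y).det * φ (e.symm y) := by
  rw [← setIntegral_eq_integral_of_forall_compl_eq_zero h0, riemannianVolume_restrict_source he,
    chartVolume, integral_map (aemeasurable_chart_symm e _),
    integral_withDensity_eq_integral_toReal_smul₀]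
  · refine integral_congr_ae (Eventually.of_forall fun y => ?_)
    simp [ENNReal.toReal_ofReal (Real.sqrt_nonneg _)]
  · exact ((continuousOn_sqrt_det hcont).aemeasurable
      e.open_target.measurableSet).ennreal_ofReal
  · exact Eventually.of_forall fun y => ENNReal.ofReal_lt_top
  · exact hφ.mono_measure (chartVolume_le_riemannianVolume he h)

end Volume

/-! ### The Laplacian in coordinates -/

theorem deriv_deriv_nonpos_of_isLocalMax {φ : ℝ → ℝ} {a : ℝ} (hφ : ContinuousAt φ a)
    (hmax : IsLocalMax φ a) : deriv (deriv φ) a ≤ 0 := by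
  by_contra! hlt
  have hmin : IsLocalMin φ a := isLocalMin_of_deriv_deriv_pos hlt hmax.deriv_eq_zero hφ
  have hconst : φ =ᶠ[𝓝 a] fun _ => φ a := by
    filter_upwards [hmax, hmin] with τ hle hge using le_antisymm hle hge
  have hderiv : deriv φ =ᶠ[𝓝 a] fun _ => 0 := by simpa using hconst.deriv
  exact hlt.ne' (by rw [hderiv.deriv_eq, deriv_const])

theorem fderiv_fderiv_apply_self_nonpos_of_isLocalMax {E : Type*} [NormedAddCommGroup E]
    [NormedSpace ℝ E] {f : E → ℝ} {y : E} (hf : ContDiffAt ℝ 2 f y) (hmax : IsLocalMax f y)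
    (v : E) : fderiv ℝ (fderiv ℝ f) y v v ≤ 0 := by
  let line : ℝ → E := fun τ => y + τ • v
  have hline (τ : ℝ) : HasDerivAt line v τ :=
    (((hasDerivAt_id τ).smul_const v).const_add y).congr_deriv (one_smul _ _)
  have hline0 : line 0 = y := by simp [line]
  have hto : Tendsto line (𝓝 0) (𝓝 y) := hline0 ▸ (hline 0).continuousAt.tendsto
  have hfirst : deriv (f ∘ line) =ᶠ[𝓝 0] fun τ => fderiv ℝ f (line τ) v := by
    filter_upwards [hto.eventually (hf.eventually (by simp))] with τ hτ
    exact ((hτ.differentiableAt (by simp)).hasFDerivAt.comp_hasDerivAt τ (hline τ)).deriv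
  have hfderiv : HasFDerivAt (fderiv ℝ f) (fderiv ℝ (fderiv ℝ f) y) (line 0) := hline0 ▸
    ((hf.fderiv_right (m := 1) (by norm_num)).differentiableAt (by simp)).hasFDerivAt
  have hsecond : deriv (deriv (f ∘ line)) 0 = fderiv ℝ (fderiv ℝ f) y v v := by
    rw [hfirst.deriv_eq]
    simpa using ((hfderiv.comp_hasDerivAt 0 (hline 0)).clm_apply
      (hasDerivAt_const (0 : ℝ) v)).deriv
  rw [← hsecond]
  refine deriv_deriv_nonpos_of_isLocalMax ?_ ?_
  · exact ContinuousAt.comp (hline0 ▸ hf.continuousAt) (hline 0).continuousAt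
  · filter_upwards [hto.eventually hmax] with τ hτ using by simpa [hline0] using hτ

namespace Coord

variable {n : ℕ}

/-- The Laplacian `Δf = gⁱʲ f_{;ij}`. -/
noncomputable def laplacian (g : EuclideanSpace ℝ (Fin n) → Matrix (Fin n) (Fin n) ℝ)
    (f : EuclideanSpace ℝ (Fin n) → ℝ) (y : EuclideanSpace ℝ (Fin n)) : ℝ :=
  ∑ i, ∑ j, (g y)⁻¹ i j * hessian g f i j y

/-- The density `√(det g) gⁱʲ ∂ⱼf`. -/
noncomputable def flux (g : EuclideanSpace ℝ (Fin n) → Matrix (Fin n) (Fin n) ℝ)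
    (f : EuclideanSpace ℝ (Fin n) → ℝ) (i : Fin n) (y : EuclideanSpace ℝ (Fin n)) : ℝ :=
  √(g y).det * ∑ j, (g y)⁻¹ i j * pd j f y

theorem contDiffOn_pd {f : EuclideanSpace ℝ (Fin n) → ℝ} {U : Set (EuclideanSpace ℝ (Fin n))}
    (hU : IsOpen U) (hf : ContDiffOn ℝ ∞ f U) (k : Fin n) : ContDiffOn ℝ ∞ (pd k f) U :=
  (hf.fderiv_of_isOpen (m := ∞) hU (by simp)).clm_apply contDiffOn_const

theorem contDiffOn_sqrt_det {g : EuclideanSpace ℝ (Fin n) → Matrix (Fin n) (Fin n) ℝ}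
    {U : Set (EuclideanSpace ℝ (Fin n))}
    (hg : ∀ i j, ContDiffOn ℝ ∞ (fun z => g z i j) U) (hpos : ∀ z ∈ U, (g z).PosDef) :
    ContDiffOn ℝ ∞ (fun z => √(g z).det) U :=
  (contDiffOn_det hg).sqrt fun z hz => (hpos z hz).det_pos.ne'

theorem contDiffOn_flux {g : EuclideanSpace ℝ (Fin n) → Matrix (Fin n) (Fin n) ℝ}
    {f : EuclideanSpace ℝ (Fin n) → ℝ} {U : Set (EuclideanSpace ℝ (Fin n))} (hU : IsOpen U)
    (hg : ∀ i j, ContDiffOn ℝ ∞ (fun z => g z i j) U) (hpos : ∀ z ∈ U, (g z).PosDef)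
    (hf : ContDiffOn ℝ ∞ f U) (i : Fin n) : ContDiffOn ℝ ∞ (flux g f i) U :=
  (contDiffOn_sqrt_det hg hpos).mul (ContDiffOn.sum fun j _ =>
    (contDiffOn_inv_apply hg (fun z hz => (hpos z hz).det_pos.ne') i j).mul
      (contDiffOn_pd hU hf j))

theorem sum_inv_mul_christoffel_eq {G : Matrix (Fin n) (Fin n) ℝ}
    {D : Fin n → Matrix (Fin n) (Fin n) ℝ} (hG : G.IsSymm) (hD : ∀ k, (D k).IsSymm) (k : Fin n) :
    ∑ i, ∑ j, G i j * (1 / 2 * ∑ l, G k l * (D i j l + D j i l - D l i j)) =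
      ∑ i, ((G * D i * G) i k - 1 / 2 * (G * D i).trace * G i k) := by
  have hfirst : ∑ i, ∑ j, ∑ l, G i j * G k l * D i j l = ∑ i, (G * D i * G) i k := by
    refine Finset.sum_congr rfl fun i _ => ?_
    simp only [Matrix.mul_apply, Finset.sum_mul]
    rw [Finset.sum_comm]
    exact Finset.sum_congr rfl fun l _ => Finset.sum_congr rfl fun j _ => by
      rw [hG.apply l k]; ring
  have hsecond : ∑ i, ∑ j, ∑ l, G i j * G k l * D j i l = ∑ i, (G * D i * G) i k := by
    rw [← hfirst, Finset.sum_comm]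
    simp only [hG.apply]
  have hthird : ∑ i, ∑ j, ∑ l, G i j * G k l * D l i j = ∑ l, (G * D l).trace * G l k := by
    simp only [Matrix.trace, Matrix.diag, Matrix.mul_apply, Finset.sum_mul]
    rw [Finset.sum_congr rfl fun i _ => Finset.sum_comm, Finset.sum_comm]
    exact Finset.sum_congr rfl fun l _ => Finset.sum_congr rfl fun i _ =>
      Finset.sum_congr rfl fun j _ => by rw [hG.apply l k, (hD l).apply]; ring
  calc
    _ = 1 / 2 * (∑ i, ∑ j, ∑ l, G i j * G k l * D i j l + ∑ i, ∑ j, ∑ l, G i j * G k l * D j i l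
          - ∑ i, ∑ j, ∑ l, G i j * G k l * D l i j) := by
      simp only [Finset.mul_sum, ← Finset.sum_add_distrib, ← Finset.sum_sub_distrib]
      exact Finset.sum_congr rfl fun i _ => Finset.sum_congr rfl fun j _ =>
        Finset.sum_congr rfl fun l _ => by ring
    _ = _ := by
      rw [hfirst, hsecond, hthird, Finset.sum_sub_distrib]
      simp only [mul_assoc, ← Finset.mul_sum]
      ring

theorem pd_flux {g : EuclideanSpace ℝ (Fin n) → Matrix (Fin n) (Fin n) ℝ}
    {f : EuclideanSpace ℝ (Fin n) → ℝ} {U : Set (EuclideanSpace ℝ (Fin n))} (hU : IsOpen U)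
    (hg : ∀ i j, ContDiffOn ℝ ∞ (fun z => g z i j) U) (hpos : ∀ z ∈ U, (g z).PosDef)
    (hf : ContDiffOn ℝ ∞ f U) {y : EuclideanSpace ℝ (Fin n)} (hy : y ∈ U)
    {i : Fin n} {D : Matrix (Fin n) (Fin n) ℝ} (hD : ∀ a b, D a b = pd i (fun z => g z a b) y) :
    pd i (flux g f i) y = √(g y).det *
      ∑ j, ((g y)⁻¹ i j * pd i (pd j f) y - (((g y)⁻¹ * D * (g y)⁻¹) i j
        - 1 / 2 * ((g y)⁻¹ * D).trace * (g y)⁻¹ i j) * pd j f y) := by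
  have hline {F : EuclideanSpace ℝ (Fin n) → ℝ} (hF : ContDiffOn ℝ ∞ F U) :
      HasDerivWithinAt (fun τ : ℝ => F (y + τ • EuclideanSpace.single i (1 : ℝ))) (pd i F y)
        univ 0 :=
    (((hF.contDiffAt (hU.mem_nhds hy)).differentiableAt (by simp)).hasFDerivAt.hasLineDerivAt
      _).hasDerivWithinAt
  have hline_g (a b : Fin n) := hD a b ▸ hline (hg a b)
  have hdet : 0 < (g y).det := (hpos y hy).det_pos
  have hline0 : y + (0 : ℝ) • EuclideanSpace.single i (1 : ℝ) = y := by simp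
  have hdet0 : (g (y + (0 : ℝ) • EuclideanSpace.single i (1 : ℝ))).det ≠ 0 := by
    rw [hline0]; exact hdet.ne'
  have hproduct := ((hasDerivWithinAt_det_of_ne_zero hline_g hdet0).sqrt hdet0).fun_mul
    (HasDerivWithinAt.fun_sum (u := Finset.univ) fun j _ =>
      (hasDerivWithinAt_inv_apply hline_g hdet0 i j).fun_mul (hline (contDiffOn_pd hU hf j)))
  have hderiv := (hasDerivWithinAt_univ.1 (hline (contDiffOn_flux hU hg hpos hf i))).unique
    (hasDerivWithinAt_univ.1 hproduct)
  have hsqrt : (g y).det * ((g y)⁻¹ * D).trace / (2 * √(g y).det) =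
      √(g y).det * (1 / 2 * ((g y)⁻¹ * D).trace) := by
    field_simp
    rw [Real.sq_sqrt hdet.le, mul_comm]
  rw [hderiv, hline0, hsqrt, mul_assoc, ← mul_add, Finset.mul_sum, ← Finset.sum_add_distrib]
  congr 1
  exact Finset.sum_congr rfl fun j _ => by ring

theorem laplacian_eq_sub (g : EuclideanSpace ℝ (Fin n) → Matrix (Fin n) (Fin n) ℝ)
    (f : EuclideanSpace ℝ (Fin n) → ℝ) (y : EuclideanSpace ℝ (Fin n)) :
    laplacian g f y = ∑ i, ∑ j, (g y)⁻¹ i j * pd i (pd j f) y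
      - ∑ k, (∑ i, ∑ j, (g y)⁻¹ i j * christoffel g k i j y) * pd k f y := by
  have hswap : ∀ F : Fin n → Fin n → Fin n → ℝ,
      ∑ i, ∑ j, ∑ k, F i j k = ∑ k, ∑ i, ∑ j, F i j k := fun F => by
    rw [Finset.sum_congr rfl fun i _ => Finset.sum_comm, Finset.sum_comm]
  simp only [laplacian, hessian, mul_sub, Finset.sum_sub_distrib]
  congr 1
  simp only [Finset.sum_mul, Finset.mul_sum]
  rw [hswap]
  exact Finset.sum_congr rfl fun k _ => Finset.sum_congr rfl fun i _ =>
    Finset.sum_congr rfl fun j _ => (mul_assoc _ _ _).symm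

theorem sqrt_det_mul_laplacian {g : EuclideanSpace ℝ (Fin n) → Matrix (Fin n) (Fin n) ℝ}
    {f : EuclideanSpace ℝ (Fin n) → ℝ} {U : Set (EuclideanSpace ℝ (Fin n))} (hU : IsOpen U)
    (hg : ∀ i j, ContDiffOn ℝ ∞ (fun z => g z i j) U) (hpos : ∀ z ∈ U, (g z).PosDef)
    (hf : ContDiffOn ℝ ∞ f U) {y : EuclideanSpace ℝ (Fin n)} (hy : y ∈ U) :
    √(g y).det * laplacian g f y = ∑ i, pd i (flux g f i) y := by
  let D (k : Fin n) : Matrix (Fin n) (Fin n) ℝ := Matrix.of fun a b => pd k (fun z => g z a b) y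
  have hDsymm (k : Fin n) : (D k).IsSymm := by
    refine Matrix.IsSymm.ext fun a b => ?_
    have hnear : (fun z => g z b a) =ᶠ[𝓝 y] fun z => g z a b := by
      filter_upwards [hU.mem_nhds hy] with z hz using (isSymm_of_posDef (hpos z hz)).apply a b
    change pd k (fun z => g z b a) y = pd k (fun z => g z a b) y
    rw [pd, pd, hnear.fderiv_eq]
  have hchristoffel (k : Fin n) : ∑ i, ∑ j, (g y)⁻¹ i j * christoffel g k i j y =
      ∑ i, (((g y)⁻¹ * D i * (g y)⁻¹) i k - 1 / 2 * ((g y)⁻¹ * D i).trace * (g y)⁻¹ i k) :=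
    sum_inv_mul_christoffel_eq (isSymm_of_posDef (hpos y hy).inv) hDsymm k
  have hflux (i : Fin n) : pd i (flux g f i) y = √(g y).det *
      (∑ j, (g y)⁻¹ i j * pd i (pd j f) y - ∑ j, (((g y)⁻¹ * D i * (g y)⁻¹) i j
        - 1 / 2 * ((g y)⁻¹ * D i).trace * (g y)⁻¹ i j) * pd j f y) := by
    rw [pd_flux hU hg hpos hf hy (D := D i) fun _ _ => rfl, Finset.sum_sub_distrib]
  simp only [hflux, ← Finset.mul_sum, laplacian_eq_sub, hchristoffel]
  rw [Finset.sum_sub_distrib]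
  congr 2
  simp only [Finset.sum_mul]
  exact Finset.sum_comm

theorem pd_pd_eq_fderiv_fderiv {f : EuclideanSpace ℝ (Fin n) → ℝ} {y : EuclideanSpace ℝ (Fin n)}
    (hf : ContDiffAt ℝ 2 f y) (i j : Fin n) :
    pd i (pd j f) y =
      fderiv ℝ (fderiv ℝ f) y (EuclideanSpace.single i 1) (EuclideanSpace.single j 1) := by
  have hfderiv := ((hf.fderiv_right (m := 1) (by norm_num)).differentiableAt (by simp)).hasFDerivAt
  have hpd := hfderiv.clm_apply (hasFDerivAt_const (EuclideanSpace.single j (1 : ℝ)) y)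
  change fderiv ℝ (fun z => fderiv ℝ f z (EuclideanSpace.single j 1)) y _ = _
  rw [hpd.fderiv]
  simp

theorem posSemidef_neg_pd_pd_of_isLocalMax {f : EuclideanSpace ℝ (Fin n) → ℝ}
    {y : EuclideanSpace ℝ (Fin n)} (hf : ContDiffAt ℝ 2 f y) (hmax : IsLocalMax f y) :
    (-Matrix.of fun i j => pd i (pd j f) y).PosSemidef := by
  have hgram : (Matrix.of fun i j => pd i (pd j f) y) =
      gramMatrix (fderiv ℝ (fderiv ℝ f) y) fun i => EuclideanSpace.single i 1 := by
    ext i j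
    exact pd_pd_eq_fderiv_fderiv hf i j
  have hsymm : IsSymmSndFDerivAt ℝ f y := hf.isSymmSndFDerivAt (by simp)
  rw [hgram]
  refine Matrix.PosSemidef.of_dotProduct_mulVec_nonneg
    (Matrix.IsHermitian.ext fun i j => congrArg Neg.neg (hsymm _ _)) fun x => ?_
  rw [star_trivial, Matrix.neg_mulVec, dotProduct_neg, dotProduct_gramMatrix_mulVec]
  exact neg_nonneg.2 (fderiv_fderiv_apply_self_nonpos_of_isLocalMax hf hmax _)

theorem tr_nonneg_of_posSemidef {g T : Matrix (Fin n) (Fin n) ℝ} (hg : g.PosDef)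
    (hT : T.PosSemidef) : 0 ≤ tr g T := by
  obtain ⟨B, hB⟩ := exists_eq_transpose_mul_self_of_posDef hg.inv
  rw [tr_eq_trace_of_isSymm g (Matrix.isHermitian_iff_isSymm.1 hT.isHermitian), hB,
    Matrix.mul_assoc, Matrix.trace_mul_comm]
  exact (hT.mul_mul_conjTranspose_same B).trace_nonneg

theorem laplacian_nonpos_of_isLocalMax {g : EuclideanSpace ℝ (Fin n) → Matrix (Fin n) (Fin n) ℝ}
    {f : EuclideanSpace ℝ (Fin n) → ℝ} {y : EuclideanSpace ℝ (Fin n)} (hpos : (g y).PosDef)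
    (hf : ContDiffAt ℝ 2 f y) (hmax : IsLocalMax f y) : laplacian g f y ≤ 0 := by
  have hneg := tr_nonneg_of_posSemidef hpos (posSemidef_neg_pd_pd_of_isLocalMax hf hmax)
  have hgrad (k : Fin n) : pd k f y = 0 := by simp [pd, hmax.fderiv_eq_zero]
  have hlap : laplacian g f y = -tr (g y) (-Matrix.of fun i j => pd i (pd j f) y) := by
    simp [laplacian, hessian, hgrad, tr]
  linarith

end Coord

/-! ### The divergence theorem -/

theorem continuous_mul_of_tsupport_subset {E : Type*} [TopologicalSpace E] {ψ G : E → ℝ} {U : Set E}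
    (hU : IsOpen U) (hψ : Continuous ψ) (hs : tsupport ψ ⊆ U) (hG : ContinuousOn G U) :
    Continuous fun y => ψ y * G y := by
  refine continuous_of_tsupport fun y hy => ?_
  have hyU : y ∈ U := hs (tsupport_mul_subset_left hy)
  exact hψ.continuousAt.mul (hG.continuousAt (hU.mem_nhds hyU))

theorem integrable_mul_of_tsupport_subset {n : ℕ} {ψ G : EuclideanSpace ℝ (Fin n) → ℝ}
    {U : Set (EuclideanSpace ℝ (Fin n))} (hU : IsOpen U) (hψ : Continuous ψ)
    (hcs : HasCompactSupport ψ) (hs : tsupport ψ ⊆ U) (hG : ContinuousOn G U) :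
    Integrable (fun y => ψ y * G y) :=
  (continuous_mul_of_tsupport_subset hU hψ hs hG).integrable_of_hasCompactSupport hcs.mul_right

namespace Coord

variable {n : ℕ}

theorem tsupport_pd_subset (ψ : EuclideanSpace ℝ (Fin n) → ℝ) (k : Fin n) :
    tsupport (pd k ψ) ⊆ tsupport ψ :=
  tsupport_fderiv_apply_subset ℝ _

theorem integral_mul_laplacian {g : EuclideanSpace ℝ (Fin n) → Matrix (Fin n) (Fin n) ℝ}
    {f ψ : EuclideanSpace ℝ (Fin n) → ℝ} {U : Set (EuclideanSpace ℝ (Fin n))} (hU : IsOpen U)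
    (hg : ∀ i j, ContDiffOn ℝ ∞ (fun z => g z i j) U) (hpos : ∀ z ∈ U, (g z).PosDef)
    (hf : ContDiffOn ℝ ∞ f U) (hψ : ContDiff ℝ ∞ ψ) (hcs : HasCompactSupport ψ)
    (hs : tsupport ψ ⊆ U) :
    ∫ y, ψ y * (√(g y).det * laplacian g f y) =
      -∫ y, ∑ i, pd i ψ y * flux g f i y := by
  have hflux := contDiffOn_flux hU hg hpos hf
  have hpdψ (i : Fin n) : Continuous (pd i ψ) :=
    (hψ.continuous_fderiv (by simp)).clm_apply continuous_const
  have hint_div (i : Fin n) : Integrable fun y => ψ y * pd i (flux g f i) y :=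
    integrable_mul_of_tsupport_subset hU hψ.continuous hcs hs
      (contDiffOn_pd hU (hflux i) i).continuousOn
  have hint_grad (i : Fin n) : Integrable fun y => pd i ψ y * flux g f i y :=
    integrable_mul_of_tsupport_subset hU (hpdψ i)
      (hcs.mono' ((subset_tsupport _).trans (tsupport_pd_subset ψ i)))
      ((tsupport_pd_subset ψ i).trans hs) (hflux i).continuousOn
  have hint (i : Fin n) : Integrable fun y => ψ y * flux g f i y :=
    integrable_mul_of_tsupport_subset hU hψ.continuous hcs hs (hflux i).continuousOn
  have hdiv (y : EuclideanSpace ℝ (Fin n)) : ψ y * (√(g y).det * laplacian g f y) =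
      ∑ i, ψ y * pd i (flux g f i) y := by
    by_cases hy : y ∈ U
    · rw [sqrt_det_mul_laplacian hU hg hpos hf hy, Finset.mul_sum]
    · simp [image_eq_zero_of_notMem_tsupport fun h => hy (hs h)]
  simp only [hdiv]
  rw [integral_finsetSum _ fun i _ => hint_div i, integral_finsetSum _ fun i _ => hint_grad i,
    ← Finset.sum_neg_distrib]
  exact Finset.sum_congr rfl fun i _ =>
    integral_bilinear_fderiv_right_eq_neg_left_of_integrable
      (B := ContinuousLinearMap.mul ℝ ℝ) (v := EuclideanSpace.single i (1 : ℝ))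
      (hint_grad i) (hint_div i) (hint i) (fun y _ => (hψ.differentiable (by simp)) y)
      (fun y hy => ((hflux i).contDiffAt (hU.mem_nhds (hs hy))).differentiableAt (by simp))

end Coord

section Gradient

variable {n : ℕ} {X : Type*} [TopologicalSpace X]

/-- The partial derivatives of a function on a manifold in a chart. -/
noncomputable def chartGradient (e : OpenPartialHomeomorph X (EuclideanSpace ℝ (Fin n)))
    (F : X → ℝ) (y : EuclideanSpace ℝ (Fin n)) : Fin n → ℝ :=
  fun k => Coord.pd k (fun z => F (e.symm z)) y

theorem chartGradient_eq_zero_of_notMem_tsupport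
    {e : OpenPartialHomeomorph X (EuclideanSpace ℝ (Fin n))} {F : X → ℝ}
    {y : EuclideanSpace ℝ (Fin n)} (hy : y ∈ e.target) (hF : e.symm y ∉ tsupport F) :
    chartGradient e F y = 0 := by
  have hzero : (fun z => F (e.symm z)) =ᶠ[𝓝 y] fun _ => 0 :=
    (e.continuousAt_symm hy).eventually (notMem_tsupport_iff_eventuallyEq.1 hF)
  ext k
  rw [chartGradient, Coord.pd, hzero.fderiv_eq]
  simp

/-- The coordinate expression, extended by zero, of a function supported in a chart domain. -/
noncomputable def chartExtend (e : OpenPartialHomeomorph X (EuclideanSpace ℝ (Fin n)))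
    (F : X → ℝ) : EuclideanSpace ℝ (Fin n) → ℝ :=
  e.target.indicator fun z => F (e.symm z)

theorem chartExtend_eventuallyEq (e : OpenPartialHomeomorph X (EuclideanSpace ℝ (Fin n)))
    (F : X → ℝ) {y : EuclideanSpace ℝ (Fin n)} (hy : y ∈ e.target) :
    chartExtend e F =ᶠ[𝓝 y] fun z => F (e.symm z) := by
  filter_upwards [e.open_target.mem_nhds hy] with z hz using indicator_of_mem hz _

theorem pd_chartExtend (e : OpenPartialHomeomorph X (EuclideanSpace ℝ (Fin n)))
    (F : X → ℝ) {y : EuclideanSpace ℝ (Fin n)} (hy : y ∈ e.target) (k : Fin n) :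
    Coord.pd k (chartExtend e F) y = chartGradient e F y k := by
  rw [Coord.pd, (chartExtend_eventuallyEq e F hy).fderiv_eq, chartGradient, Coord.pd]

theorem isCompact_image_tsupport [CompactSpace X]
    {e : OpenPartialHomeomorph X (EuclideanSpace ℝ (Fin n))} {F : X → ℝ}
    (hF : tsupport F ⊆ e.source) : IsCompact (e '' tsupport F) :=
  (isClosed_tsupport F).isCompact.image_of_continuousOn (e.continuousOn.mono hF)

theorem tsupport_chartExtend_subset [CompactSpace X]
    {e : OpenPartialHomeomorph X (EuclideanSpace ℝ (Fin n))} {F : X → ℝ}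
    (hF : tsupport F ⊆ e.source) : tsupport (chartExtend e F) ⊆ e '' tsupport F := by
  refine closure_minimal (fun y hy => ?_) (isCompact_image_tsupport hF).isClosed
  have hyt : y ∈ e.target := by
    by_contra h
    exact hy (indicator_of_notMem h _)
  have hne : F (e.symm y) ≠ 0 := by rwa [Function.mem_support, chartExtend,
    indicator_of_mem hyt] at hy
  exact ⟨e.symm y, subset_tsupport _ hne, e.right_inv hyt⟩

theorem tsupport_chartExtend_subset_target [CompactSpace X]
    {e : OpenPartialHomeomorph X (EuclideanSpace ℝ (Fin n))} {F : X → ℝ}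
    (hF : tsupport F ⊆ e.source) : tsupport (chartExtend e F) ⊆ e.target :=
  (tsupport_chartExtend_subset hF).trans
    (image_subset_iff.2 fun _ hx => e.map_source (hF hx))

theorem hasCompactSupport_chartExtend [CompactSpace X]
    {e : OpenPartialHomeomorph X (EuclideanSpace ℝ (Fin n))} {F : X → ℝ}
    (hF : tsupport F ⊆ e.source) : HasCompactSupport (chartExtend e F) :=
  (isCompact_image_tsupport hF).of_isClosed_subset (isClosed_tsupport _)
    (tsupport_chartExtend_subset hF)

theorem contDiff_chartExtend [CompactSpace X]
    {e : OpenPartialHomeomorph X (EuclideanSpace ℝ (Fin n))} {F : X → ℝ}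
    (hF : tsupport F ⊆ e.source) (hsmooth : ContDiffOn ℝ ∞ (fun z => F (e.symm z)) e.target) :
    ContDiff ℝ ∞ (chartExtend e F) := by
  refine contDiff_iff_contDiffAt.2 fun y => ?_
  by_cases hy : y ∈ tsupport (chartExtend e F)
  · have hyt := tsupport_chartExtend_subset_target hF hy
    exact (hsmooth.contDiffAt (e.open_target.mem_nhds hyt)).congr_of_eventuallyEq
      (chartExtend_eventuallyEq e F hyt)
  · exact contDiffAt_const.congr_of_eventuallyEq (notMem_tsupport_iff_eventuallyEq.1 hy)

variable [ChartedSpace (EuclideanSpace ℝ (Fin n)) X]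

/-- The inner product `⟨∇F, ∇G⟩ = hᵏˡ ∂ₖF ∂ₗG`, computed in a chart. -/
noncomputable def gradInner (e : OpenPartialHomeomorph X (EuclideanSpace ℝ (Fin n)))
    (h : Cov2Tensor n X) (F G : X → ℝ) (y : EuclideanSpace ℝ (Fin n)) : ℝ :=
  chartGradient e F y ⬝ᵥ ((components e h y)⁻¹ *ᵥ chartGradient e G y)

/-- The inner product of the gradients of two functions, computed at each point in the preferred
chart there. -/
noncomputable def gradientInner (h : Cov2Tensor n X) (F G : X → ℝ) (x : X) : ℝ :=
  gradInner (chartAt (EuclideanSpace ℝ (Fin n)) x) h F G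
    (chartAt (EuclideanSpace ℝ (Fin n)) x x)

theorem gradientInner_eq_zero_of_notMem_tsupport (h : Cov2Tensor n X) {F : X → ℝ} (G : X → ℝ)
    {x : X} (hx : x ∉ tsupport F) : gradientInner h F G x = 0 := by
  rw [gradientInner, gradInner, chartGradient_eq_zero_of_notMem_tsupport
    (OpenPartialHomeomorph.map_source _ (mem_chart_source _ x))
    (by rwa [OpenPartialHomeomorph.left_inv _ (mem_chart_source _ x)]), zero_dotProduct]

theorem sum_chartGradient_mul_flux (e : OpenPartialHomeomorph X (EuclideanSpace ℝ (Fin n)))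
    (h : Cov2Tensor n X) (F G : X → ℝ) (y : EuclideanSpace ℝ (Fin n)) :
    ∑ i, chartGradient e F y i * Coord.flux (components e h) (fun z => G (e.symm z)) i y =
      √(components e h y).det * gradInner e h F G y := by
  simp only [gradInner, dotProduct, Matrix.mulVec, Coord.flux, Finset.mul_sum]
  refine Finset.sum_congr rfl fun i _ => Finset.sum_congr rfl fun j _ => ?_
  rw [chartGradient, chartGradient, mul_left_comm]

/-- A function on a manifold that is smooth in all charts of the atlas. -/
def SmoothInCharts (n : ℕ) {X : Type*} [TopologicalSpace X]
    [ChartedSpace (EuclideanSpace ℝ (Fin n)) X] (F : X → ℝ) : Prop :=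
  ∀ e ∈ atlas (EuclideanSpace ℝ (Fin n)) X, ContDiffOn ℝ ∞ (fun z => F (e.symm z)) e.target

/-- A covariant 2-tensor field whose components are smooth in all charts of the atlas. -/
def SmoothComponents (T : Cov2Tensor n X) : Prop :=
  ∀ e ∈ atlas (EuclideanSpace ℝ (Fin n)) X, ∀ i j,
    ContDiffOn ℝ ∞ (fun y => components e T y i j) e.target

theorem SmoothInCharts.differentiableAt {F : X → ℝ} (hF : SmoothInCharts n F)
    {e : OpenPartialHomeomorph X (EuclideanSpace ℝ (Fin n))}
    (he : e ∈ atlas (EuclideanSpace ℝ (Fin n)) X) {y : EuclideanSpace ℝ (Fin n)}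
    (hy : y ∈ e.target) : DifferentiableAt ℝ (fun z => F (e.symm z)) y :=
  ((hF e he).contDiffAt (e.open_target.mem_nhds hy)).differentiableAt (by simp)

theorem continuous_of_charts {Y : Type*} [TopologicalSpace Y] {F : X → Y}
    (hF : ∀ e ∈ atlas (EuclideanSpace ℝ (Fin n)) X,
      ContinuousOn (fun z => F (e.symm z)) e.target) : Continuous F := by
  refine continuous_iff_continuousAt.2 fun x => ?_
  let e := chartAt (EuclideanSpace ℝ (Fin n)) x
  have hx : x ∈ e.source := mem_chart_source _ x
  have hchart : ContinuousAt (fun z => F (e.symm z)) (e x) :=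
    (hF e (chart_mem_atlas _ _)).continuousAt (e.open_target.mem_nhds (e.map_source hx))
  refine (ContinuousAt.comp (f := e) hchart (e.continuousAt hx)).congr ?_
  filter_upwards [e.open_source.mem_nhds hx] with x' hx'
  rw [Function.comp_apply, e.left_inv hx']

theorem SmoothInCharts.continuous {F : X → ℝ} (hF : SmoothInCharts n F) : Continuous F :=
  continuous_of_charts fun e he => (hF e he).continuousOn

theorem sum_gradientInner_eq_zero {ι : Type*} {t : Finset ι} {ρ : ι → X → ℝ}
    (hρ : ∀ i ∈ t, SmoothInCharts n (ρ i)) (hsum : ∀ x, ∑ i ∈ t, ρ i x = 1)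
    (h : Cov2Tensor n X) (G : X → ℝ) (x : X) : ∑ i ∈ t, gradientInner h (ρ i) G x = 0 := by
  let e := chartAt (EuclideanSpace ℝ (Fin n)) x
  have hx : e x ∈ e.target := e.map_source (mem_chart_source _ x)
  have hgradient : ∑ i ∈ t, chartGradient e (ρ i) (e x) = 0 := by
    ext k
    have hderiv := HasFDerivAt.fun_sum (u := t) fun i hi =>
      ((hρ i hi).differentiableAt (chart_mem_atlas _ x) hx).hasFDerivAt
    simp only [hsum] at hderiv
    have hzero := hderiv.unique (hasFDerivAt_const (1 : ℝ) (e x))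
    simpa [chartGradient, Coord.pd] using DFunLike.congr_fun hzero (EuclideanSpace.single k 1)
  simp only [gradientInner, gradInner]
  rw [← sum_dotProduct, hgradient, zero_dotProduct]

variable [IsManifold (𝓡 n) ∞ X]

theorem smoothInCharts_of_contMDiff {F : X → ℝ} (hF : ContMDiff (𝓡 n) 𝓘(ℝ) ∞ F) :
    SmoothInCharts n F := fun _ he =>
  (hF.comp_contMDiffOn (contMDiffOn_symm_of_mem_maximalAtlas
    (IsManifold.subset_maximalAtlas he))).contDiffOn

theorem chartGradient_change {e e' : OpenPartialHomeomorph X (EuclideanSpace ℝ (Fin n))}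
    (he : e ∈ atlas (EuclideanSpace ℝ (Fin n)) X) (he' : e' ∈ atlas (EuclideanSpace ℝ (Fin n)) X)
    {F : X → ℝ} (hF : SmoothInCharts n F) {y : EuclideanSpace ℝ (Fin n)} (hy : y ∈ e.target)
    (hy' : e.symm y ∈ e'.source) :
    chartGradient e F y = (jacobian e e' y)ᵀ *ᵥ chartGradient e' F (e' (e.symm y)) := by
  have hnear : (fun z => F (e.symm z)) =ᶠ[𝓝 y] (fun z => F (e'.symm z)) ∘ (e' ∘ e.symm) := by
    filter_upwards [(e.continuousAt_symm hy).preimage_mem_nhds (e'.open_source.mem_nhds hy')]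
      with z hz
    simp [e'.left_inv hz]
  have hdiff : DifferentiableAt ℝ (fun z => F (e'.symm z)) ((e' ∘ e.symm) y) :=
    hF.differentiableAt he' (e'.map_source hy')
  ext k
  rw [chartGradient, Coord.pd, hnear.fderiv_eq,
    fderiv_comp y hdiff (differentiableAt_transition he he' hy hy'),
    ContinuousLinearMap.comp_apply, fderiv_transition_single, map_sum]
  simp only [map_smul, smul_eq_mul]
  rfl

theorem gradInner_change {e e' : OpenPartialHomeomorph X (EuclideanSpace ℝ (Fin n))}
    (he : e ∈ atlas (EuclideanSpace ℝ (Fin n)) X) (he' : e' ∈ atlas (EuclideanSpace ℝ (Fin n)) X)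
    (h : Cov2Tensor n X) {F G : X → ℝ} (hF : SmoothInCharts n F) (hG : SmoothInCharts n G)
    {y : EuclideanSpace ℝ (Fin n)} (hy : y ∈ e.target) (hy' : e.symm y ∈ e'.source) :
    gradInner e h F G y = gradInner e' h F G (e' (e.symm y)) := by
  have hJ : IsUnit (jacobian e e' y).det :=
    isUnit_iff_ne_zero.2 (det_jacobian_ne_zero he he' hy hy')
  have hJt : IsUnit (jacobian e e' y)ᵀ.det := by rwa [Matrix.det_transpose]
  rw [gradInner, gradInner, chartGradient_change he he' hF hy hy',
    chartGradient_change he he' hG hy hy', components_change he he' h hy hy', Matrix.mul_inv_rev,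
    Matrix.mul_inv_rev, Matrix.mulVec_mulVec, Matrix.mul_assoc, Matrix.mul_assoc,
    Matrix.nonsing_inv_mul _ hJt, Matrix.mul_one, Matrix.mulVec_transpose,
    ← Matrix.dotProduct_mulVec, Matrix.mulVec_mulVec, Matrix.mul_nonsing_inv_cancel_left _ _ hJ]

theorem gradientInner_symm_apply {e : OpenPartialHomeomorph X (EuclideanSpace ℝ (Fin n))}
    (he : e ∈ atlas (EuclideanSpace ℝ (Fin n)) X) (h : Cov2Tensor n X) {F G : X → ℝ}
    (hF : SmoothInCharts n F) (hG : SmoothInCharts n G) {y : EuclideanSpace ℝ (Fin n)}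
    (hy : y ∈ e.target) : gradientInner h F G (e.symm y) = gradInner e h F G y :=
  (gradInner_change he (chart_mem_atlas _ _) h hF hG hy (mem_chart_source _ _)).symm

theorem continuous_gradientInner {h : SmoothMetric n X} (hsmooth : SmoothComponents h.inner)
    {F G : X → ℝ} (hF : SmoothInCharts n F) (hG : SmoothInCharts n G) :
    Continuous (gradientInner h.inner F G) := by
  refine continuous_of_charts (n := n) fun e he => ?_
  refine ContinuousOn.congr (f := gradInner e h.inner F G) ?_ fun y hy =>
    gradientInner_symm_apply he h.inner hF hG hy
  have hgradient {F : X → ℝ} (hF : SmoothInCharts n F) (k : Fin n) :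
      ContinuousOn (fun y => chartGradient e F y k) e.target :=
    (Coord.contDiffOn_pd e.open_target (hF e he) k).continuousOn
  have hinv (i j : Fin n) : ContinuousOn (fun y => (components e h.inner y)⁻¹ i j) e.target :=
    (contDiffOn_inv_apply (hsmooth e he)
      (fun z hz => (posDef_components he h hz).det_pos.ne') i j).continuousOn
  change ContinuousOn (fun y => ∑ i, chartGradient e F y i *
    ∑ j, (components e h.inner y)⁻¹ i j * chartGradient e G y j) e.target
  exact continuousOn_finsetSum _ fun i _ => (hgradient hF i).mul
    (continuousOn_finsetSum _ fun j _ => (hinv i j).mul (hgradient hG j))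

variable [CompactSpace X] [MeasurableSpace X] [BorelSpace X]

theorem integral_mul_laplacian_of_tsupport_subset {h : SmoothMetric n X}
    (hsmooth : SmoothComponents h.inner) {ρ u q : X → ℝ}
    (hu : SmoothInCharts n u) (hρ : SmoothInCharts n ρ) (hq : Continuous q)
    {e : OpenPartialHomeomorph X (EuclideanSpace ℝ (Fin n))}
    (he : e ∈ atlas (EuclideanSpace ℝ (Fin n)) X) (hsupp : tsupport ρ ⊆ e.source)
    (hlaplacian : ∀ y ∈ e.target,
      Coord.laplacian (components e h.inner) (fun z => u (e.symm z)) y = q (e.symm y)) :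
    ∫ x, ρ x * q x ∂riemannianVolume h.inner =
      -∫ x, gradientInner h.inner ρ u x ∂riemannianVolume h.inner := by
  have htarget := tsupport_chartExtend_subset_target hsupp
  have hcont (i j : Fin n) := (hsmooth e he i j).continuousOn
  have hgreen := Coord.integral_mul_laplacian e.open_target (hsmooth e he)
    (fun z hz => posDef_components he h hz) (hu e he) (contDiff_chartExtend hsupp (hρ e he))
    (hasCompactSupport_chartExtend hsupp) htarget
  rw [integral_riemannianVolume he hcont (φ := fun x => ρ x * q x)
      (hρ.continuous.mul hq).aestronglyMeasurable (fun x hx => by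
        simp [image_eq_zero_of_notMem_tsupport fun h => hx (hsupp h)]),
    integral_riemannianVolume he hcont (continuous_gradientInner hsmooth hρ hu).aestronglyMeasurable
      (fun x hx => gradientInner_eq_zero_of_notMem_tsupport _ u fun h => hx (hsupp h))]
  rw [← setIntegral_eq_integral_of_forall_compl_eq_zero (s := e.target),
    ← setIntegral_eq_integral_of_forall_compl_eq_zero (s := e.target) (f := fun y =>
      ∑ i, Coord.pd i (chartExtend e ρ) y * _)] at hgreen
  · convert hgreen using 1
    · refine setIntegral_congr_fun e.open_target.measurableSet fun y hy => ?_
      rw [← hlaplacian y hy, chartExtend, indicator_of_mem hy, mul_left_comm]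
    · congr 1
      refine setIntegral_congr_fun e.open_target.measurableSet fun y hy => ?_
      simp only [pd_chartExtend e ρ hy, sum_chartGradient_mul_flux,
        gradientInner_symm_apply he h.inner hρ hu hy]
  · refine fun y hy => Finset.sum_eq_zero fun i _ => ?_
    rw [image_eq_zero_of_notMem_tsupport fun h => hy (htarget (Coord.tsupport_pd_subset _ i h)),
      zero_mul]
  · intro y hy
    rw [chartExtend, indicator_of_notMem hy, zero_mul]

theorem integral_laplacian_eq_zero [T2Space X] {h : SmoothMetric n X}
    (hsmooth : SmoothComponents h.inner) {u q : X → ℝ} (hu : SmoothInCharts n u)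
    (hq : Continuous q)
    (hlaplacian : ∀ e ∈ atlas (EuclideanSpace ℝ (Fin n)) X, ∀ y ∈ e.target,
      Coord.laplacian (components e h.inner) (fun z => u (e.symm z)) y = q (e.symm y)) :
    ∫ x, q x ∂riemannianVolume h.inner = 0 := by
  obtain ⟨t, ρ, hρ_smooth, -, hsum, hsupp⟩ := exists_partitionOfUnity (n := n) (X := X)
  have := isFiniteMeasure_riemannianVolume (h := h.inner) fun e he i j =>
    (hsmooth e he i j).continuousOn
  have hint {F : X → ℝ} (hF : Continuous F) : Integrable F (riemannianVolume h.inner) :=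
    hF.integrable_of_hasCompactSupport (HasCompactSupport.of_compactSpace _)
  have hρ (i : X) (hi : i ∈ t) := smoothInCharts_of_contMDiff (hρ_smooth i hi)
  calc
    ∫ x, q x ∂riemannianVolume h.inner
        = ∫ x, ∑ i ∈ t, ρ i x * q x ∂riemannianVolume h.inner := by
      simp only [← Finset.sum_mul, hsum, one_mul]
    _ = ∑ i ∈ t, ∫ x, ρ i x * q x ∂riemannianVolume h.inner :=
      integral_finsetSum _ fun i hi => hint ((hρ i hi).continuous.fun_mul hq)
    _ = ∑ i ∈ t, -∫ x, gradientInner h.inner (ρ i) u x ∂riemannianVolume h.inner :=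
      Finset.sum_congr rfl fun i hi => integral_mul_laplacian_of_tsupport_subset hsmooth hu
        (hρ i hi) hq (chart_mem_atlas _ _) (hsupp i hi) (hlaplacian _ (chart_mem_atlas _ _))
    _ = -∫ x, ∑ i ∈ t, gradientInner h.inner (ρ i) u x ∂riemannianVolume h.inner := by
      rw [Finset.sum_neg_distrib,
        integral_finsetSum _ fun i hi => hint (continuous_gradientInner hsmooth (hρ i hi) hu)]
    _ = 0 := by simp [sum_gradientInner_eq_zero hρ hsum]

end Gradient

/-! ### Expanding CMC Einstein flows in the Hubble time -/

namespace Coord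

variable {n : ℕ}

theorem tr_add (g S T : Matrix (Fin n) (Fin n) ℝ) : tr g (S + T) = tr g S + tr g T := by
  simp only [tr, Matrix.add_apply, mul_add, Finset.sum_add_distrib]

theorem tr_smul (g : Matrix (Fin n) (Fin n) ℝ) (c : ℝ) (T : Matrix (Fin n) (Fin n) ℝ) :
    tr g (c • T) = c * tr g T := by
  simp only [tr, Matrix.smul_apply, smul_eq_mul, Finset.mul_sum, mul_left_comm]

theorem tr_sub (g S T : Matrix (Fin n) (Fin n) ℝ) : tr g (S - T) = tr g S - tr g T := by
  simp only [tr, Matrix.sub_apply, mul_sub, Finset.sum_sub_distrib]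

theorem tr_mul_inv_mul {g T : Matrix (Fin n) (Fin n) ℝ} (hg : g.PosDef) (hT : T.IsSymm) :
    tr g (T * g⁻¹ * T) = normSq g T := by
  have hsymm : (T * g⁻¹ * T).IsSymm := by
    simp only [Matrix.IsSymm, Matrix.transpose_mul, hT.eq, (isSymm_of_posDef hg.inv).eq,
      Matrix.mul_assoc]
  rw [tr_eq_trace_of_isSymm g hsymm, normSq_eq_trace_sq hg hT, pow_two]
  simp only [Matrix.mul_assoc]

theorem hasDerivWithinAt_tr {M N : ℝ → Matrix (Fin n) (Fin n) ℝ}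
    {M' N' : Matrix (Fin n) (Fin n) ℝ} {s : Set ℝ} {t : ℝ}
    (hM : ∀ i j, HasDerivWithinAt (fun τ => M τ i j) (M' i j) s t)
    (hN : ∀ i j, HasDerivWithinAt (fun τ => N τ i j) (N' i j) s t) (h0 : (M t).det ≠ 0) :
    HasDerivWithinAt (fun τ => tr (M τ) (N τ))
      (tr (M t) N' - ((M t)⁻¹ * M' * (M t)⁻¹ * (N t)ᵀ).trace) s t := by
  refine (HasDerivWithinAt.fun_sum fun i _ => HasDerivWithinAt.fun_sum fun j _ =>
    (hasDerivWithinAt_inv_apply hM h0 i j).fun_mul (hN i j)).congr_deriv ?_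
  simp only [tr, Matrix.trace, Matrix.diag, Matrix.mul_apply (N := (N t)ᵀ),
    Matrix.transpose_apply, Finset.sum_add_distrib, neg_mul, Finset.sum_neg_distrib]
  ring

end Coord

section Flow

variable {n : ℕ} {X : Type*} [TopologicalSpace X] [ChartedSpace (EuclideanSpace ℝ (Fin n)) X]
  [IsManifold (𝓡 n) ∞ X] {I : Set ℝ} {L : ℝ → X → ℝ} {h : ℝ → SmoothMetric n X}
  {K : ℝ → Cov2Tensor n X} {H : ℝ → ℝ}

theorem IsEinsteinFlow.hasDerivWithinAt_tr (hflow : IsEinsteinFlow I L h K)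
    {e : OpenPartialHomeomorph X (EuclideanSpace ℝ (Fin n))}
    (he : e ∈ atlas (EuclideanSpace ℝ (Fin n)) X) {t : ℝ} (ht : t ∈ I)
    {y : EuclideanSpace ℝ (Fin n)} (hy : y ∈ e.target) :
    HasDerivWithinAt (fun τ => Coord.tr (components e (h τ).inner y) (components e (K τ) y))
      (L t (e.symm y) * (Coord.tr (components e (h t).inner y) (components e (K t) y) ^ 2
          + Coord.scalarCurv (components e (h t).inner) y)
        - Coord.laplacian (components e (h t).inner) (fun z => L t (e.symm z)) y) I t := by
  have hpos := posDef_components he (h t) hy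
  have hsymm := isSymm_components e (hflow.symm t ht) y
  set g := components e (h t).inner y
  set k := components e (K t) y
  set l := L t (e.symm y)
  set hess := Matrix.of fun i j =>
    Coord.hessian (components e (h t).inner) (fun z => L t (e.symm z)) i j y
  set ric := Matrix.of fun i j => Coord.ricci (components e (h t).inner) i j y
  have hh (i j : Fin n) : HasDerivWithinAt (fun τ => components e (h τ).inner y i j)
      (((-2 * l) • k) i j) I t := hflow.evolution_h e he t ht y hy i j
  have hK (i j : Fin n) : HasDerivWithinAt (fun τ => components e (K τ) y i j)
      (((l * Coord.tr g k) • k - (2 * l) • (k * g⁻¹ * k) - hess + l • ric) i j) I t := by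
    refine (hflow.evolution_K e he t ht y hy i j).congr_deriv ?_
    have hsquare : (k * g⁻¹ * k) i j = ∑ a, ∑ b, g⁻¹ a b * k i a * k b j := by
      simp only [Matrix.mul_apply, Finset.sum_mul]
      rw [Finset.sum_comm]
      simp only [mul_comm (k i _)]
    simp only [Matrix.add_apply, Matrix.sub_apply, Matrix.smul_apply, smul_eq_mul, hsquare]
    rfl
  refine (Coord.hasDerivWithinAt_tr hh hK hpos.det_pos.ne').congr_deriv ?_
  have hlaplacian : Coord.laplacian (components e (h t).inner) (fun z => L t (e.symm z)) y =
      Coord.tr g hess := rfl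
  have hscalar : Coord.scalarCurv (components e (h t).inner) y = Coord.tr g ric := rfl
  have htrace : (g⁻¹ * (-2 * l) • k * g⁻¹ * kᵀ).trace = -2 * l * Coord.normSq g k := by
    rw [Coord.normSq_eq_trace, isSymm_of_posDef hpos.inv]
    simp only [Matrix.mul_smul, Matrix.smul_mul, Matrix.trace_smul, smul_eq_mul]
  rw [htrace, hlaplacian, hscalar, Coord.tr_add, Coord.tr_sub, Coord.tr_sub, Coord.tr_smul,
    Coord.tr_smul, Coord.tr_smul, Coord.tr_mul_inv_mul hpos hsymm]
  ring

namespace IsExpandingCMCEinsteinFlow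

theorem mem_of_le (hflow : IsExpandingCMCEinsteinFlow I L h K H) {s t : ℝ} (hs : s ∈ I)
    (hst : s ≤ t) : t ∈ I := by
  obtain ⟨t₀, rfl | rfl⟩ := hflow.half_line
  · exact le_trans hs hst
  · exact lt_of_lt_of_le hs hst

theorem nonempty (hflow : IsExpandingCMCEinsteinFlow I L h K H) : I.Nonempty := by
  obtain ⟨t₀, rfl | rfl⟩ := hflow.half_line
  · exact nonempty_Ici
  · exact nonempty_Ioi

theorem uniqueDiffOn (hflow : IsExpandingCMCEinsteinFlow I L h K H) : UniqueDiffOn ℝ I := by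
  obtain ⟨t₀, rfl | rfl⟩ := hflow.half_line
  · exact uniqueDiffOn_Ici t₀
  · exact uniqueDiffOn_Ioi t₀

theorem dim_ne_zero (hflow : IsExpandingCMCEinsteinFlow I L h K H)
    (hubble : ∀ t ∈ I, t = -(n : ℝ) / H t) : n ≠ 0 := by
  rintro rfl
  have hzero : ∀ t ∈ I, t = 0 := fun t ht => by simpa using hubble t ht
  obtain ⟨s, hs⟩ := hflow.nonempty
  linarith [hzero s hs, hzero (s + 1) (hflow.mem_of_le hs (by linarith))]

theorem pos_of_mem (hflow : IsExpandingCMCEinsteinFlow I L h K H)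
    (hubble : ∀ t ∈ I, t = -(n : ℝ) / H t) {t : ℝ} (ht : t ∈ I) : 0 < t := by
  have hn : 0 < (n : ℝ) := Nat.cast_pos.2 (Nat.pos_of_ne_zero (hflow.dim_ne_zero hubble))
  rw [hubble t ht]
  exact div_pos_of_neg_of_neg (neg_lt_zero.2 hn) (hflow.neg t ht)

theorem meanCurvature_eq (hflow : IsExpandingCMCEinsteinFlow I L h K H)
    (hubble : ∀ t ∈ I, t = -(n : ℝ) / H t) {t : ℝ} (ht : t ∈ I) : H t = -(n : ℝ) / t := by
  rw [eq_div_iff (hflow.pos_of_mem hubble ht).ne', mul_comm,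
    (eq_div_iff (hflow.neg t ht).ne).1 (hubble t ht)]

theorem smoothComponents_metric (hflow : IsExpandingCMCEinsteinFlow I L h K H) {t : ℝ}
    (ht : t ∈ I) : SmoothComponents (h t).inner := fun e he i j =>
  (hflow.smooth_h e he i j).comp (f := fun y => (t, y)) (contDiffOn_const.prodMk contDiffOn_id)
    fun _ hy => ⟨ht, hy⟩

theorem smoothInCharts_lapse (hflow : IsExpandingCMCEinsteinFlow I L h K H) {t : ℝ} (ht : t ∈ I) :
    SmoothInCharts n (L t) := fun e he =>
  (hflow.smooth_L e he).comp (f := fun y => (t, y)) (contDiffOn_const.prodMk contDiffOn_id)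
    fun _ hy => ⟨ht, hy⟩

theorem lapse_equation (hflow : IsExpandingCMCEinsteinFlow I L h K H)
    (hubble : ∀ t ∈ I, t = -(n : ℝ) / H t)
    {e : OpenPartialHomeomorph X (EuclideanSpace ℝ (Fin n))}
    (he : e ∈ atlas (EuclideanSpace ℝ (Fin n)) X) {t : ℝ} (ht : t ∈ I)
    {y : EuclideanSpace ℝ (Fin n)} (hy : y ∈ e.target) :
    Coord.laplacian (components e (h t).inner) (fun z => L t (e.symm z)) y =
      L t (e.symm y) * Coord.normSq (components e (h t).inner y)
        (Coord.tracelessPart (components e (h t).inner y) (components e (K t) y))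
      - n / t ^ 2 * (1 - L t (e.symm y)) := by
  have hn : (n : ℝ) ≠ 0 := Nat.cast_ne_zero.2 (hflow.dim_ne_zero hubble)
  have ht0 : t ≠ 0 := (hflow.pos_of_mem hubble ht).ne'
  have htr : ∀ τ ∈ I, Coord.tr (components e (h τ).inner y) (components e (K τ) y) =
      -(n : ℝ) / τ := fun τ hτ => by
    rw [hflow.cmc e he τ hτ y hy, hflow.meanCurvature_eq hubble hτ]
  have hderiv : HasDerivWithinAt
      (fun τ => Coord.tr (components e (h τ).inner y) (components e (K τ) y)) (n / t ^ 2) I t := by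
    have hinv : HasDerivWithinAt (fun τ : ℝ => -(n : ℝ) / τ) (n / t ^ 2) I t :=
      ((hasDerivAt_inv ht0).const_mul (-(n : ℝ))).hasDerivWithinAt.congr_deriv (by field_simp)
    exact hinv.congr htr (htr t ht)
  have hevolution :=
    (hflow.uniqueDiffOn t ht).eq_deriv _ (hflow.hasDerivWithinAt_tr he ht hy) hderiv
  have hconstraint := hflow.hamiltonian_constraint e he t ht y hy
  rw [htr t ht] at hevolution hconstraint
  have hscalar := (sub_eq_iff_eq_add.1 (eq_neg_of_add_eq_zero_left hconstraint))
  rw [hscalar] at hevolution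
  rw [eq_sub_of_add_eq' (sub_eq_iff_eq_add.1 hevolution).symm]
  field_simp
  ring

theorem lapse_le_one [CompactSpace X] (hflow : IsExpandingCMCEinsteinFlow I L h K H)
    (hubble : ∀ t ∈ I, t = -(n : ℝ) / H t) {t : ℝ} (ht : t ∈ I) (x : X) : L t x ≤ 1 := by
  obtain ⟨x₀, -, hx₀⟩ := isCompact_univ.exists_isMaxOn ⟨x, mem_univ x⟩
    (hflow.smoothInCharts_lapse ht).continuous.continuousOn
  refine (hx₀ (mem_univ x)).trans ?_
  set e := chartAt (EuclideanSpace ℝ (Fin n)) x₀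
  have he : e ∈ atlas (EuclideanSpace ℝ (Fin n)) X := chart_mem_atlas _ _
  have hsource : x₀ ∈ e.source := mem_chart_source _ x₀
  have htarget : e x₀ ∈ e.target := e.map_source hsource
  have hpos := posDef_components he (h t) htarget
  have hmax : IsLocalMax (fun z => L t (e.symm z)) (e x₀) := Eventually.of_forall fun z =>
    (hx₀ (mem_univ _)).trans_eq (congrArg (L t) (e.left_inv hsource).symm)
  have hlaplacian := Coord.laplacian_nonpos_of_isLocalMax hpos
    (((hflow.smoothInCharts_lapse ht e he).contDiffAt (e.open_target.mem_nhds htarget)).of_le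
      (by simpa using (ENat.LEInfty.out : (2 : WithTop ℕ∞) ≤ ∞))) hmax
  rw [hflow.lapse_equation hubble he ht htarget, e.left_inv hsource] at hlaplacian
  have hshear := mul_nonneg (hflow.lapse_nonneg t ht x₀) (Coord.normSq_nonneg hpos
    (Coord.tracelessPart (components e (h t).inner (e x₀)) (components e (K t) (e x₀))))
  have hn : 0 < (n : ℝ) := Nat.cast_pos.2 (Nat.pos_of_ne_zero (hflow.dim_ne_zero hubble))
  have ht0 := hflow.pos_of_mem hubble ht
  have hnonneg : 0 ≤ n / t ^ 2 * (1 - L t x₀) := by linarith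
  exact sub_nonneg.1 (nonneg_of_mul_nonneg_right hnonneg (by positivity))

end IsExpandingCMCEinsteinFlow

/-- The function `|K⁰|²` on the manifold, computed in the preferred chart at each point. -/
noncomputable def shearSq (g : SmoothMetric n X) (k : Cov2Tensor n X) (x : X) : ℝ :=
  let e := chartAt (EuclideanSpace ℝ (Fin n)) x
  Coord.normSq (components e g.inner (e x))
    (Coord.tracelessPart (components e g.inner (e x)) (components e k (e x)))

theorem shearSq_nonneg (g : SmoothMetric n X) (k : Cov2Tensor n X) (x : X) : 0 ≤ shearSq g k x :=
  Coord.normSq_nonneg (posDef_components (chart_mem_atlas _ _) g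
    ((chartAt (EuclideanSpace ℝ (Fin n)) x).map_source (mem_chart_source _ x))) _

theorem shearSq_symm_apply {e : OpenPartialHomeomorph X (EuclideanSpace ℝ (Fin n))}
    (he : e ∈ atlas (EuclideanSpace ℝ (Fin n)) X) (g : SmoothMetric n X)
    {k : Cov2Tensor n X} (hk : ∀ (x : X) (v w : TangentSpace (𝓡 n) x), k x v w = k x w v)
    {y : EuclideanSpace ℝ (Fin n)} (hy : y ∈ e.target) :
    shearSq g k (e.symm y) = Coord.normSq (components e g.inner y)
      (Coord.tracelessPart (components e g.inner y) (components e k y)) := by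
  set e' := chartAt (EuclideanSpace ℝ (Fin n)) (e.symm y)
  have he' : e' ∈ atlas (EuclideanSpace ℝ (Fin n)) X := chart_mem_atlas _ _
  have hsource : e.symm y ∈ e'.source := mem_chart_source _ _
  rw [components_change he he' g.inner hy hsource, components_change he he' k hy hsource,
    Coord.normSq_tracelessPart_congr (posDef_components he' g (e'.map_source hsource))
      (isSymm_components e' hk _) (det_jacobian_ne_zero he he' hy hsource)]
  rfl

theorem continuousOn_prod_of_charts {X : Type*} [TopologicalSpace X]
    [ChartedSpace (EuclideanSpace ℝ (Fin n)) X] {F : ℝ → X → ℝ}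
    (hF : ∀ e ∈ atlas (EuclideanSpace ℝ (Fin n)) X, ContinuousOn
      (fun p : ℝ × EuclideanSpace ℝ (Fin n) => F p.1 (e.symm p.2)) (I ×ˢ e.target)) :
    ContinuousOn (fun p : ℝ × X => F p.1 p.2) (I ×ˢ univ) := by
  rintro ⟨t, x⟩ ⟨ht, -⟩
  set e := chartAt (EuclideanSpace ℝ (Fin n)) x
  have hx : x ∈ e.source := mem_chart_source _ x
  have hnhds : univ ×ˢ e.source ∈ 𝓝 (t, x) :=
    (isOpen_univ.prod e.open_source).mem_nhds ⟨mem_univ _, hx⟩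
  rw [← continuousWithinAt_inter hnhds]
  have hchart : ContinuousOn (fun p : ℝ × X => (p.1, e p.2)) (I ×ˢ e.source) :=
    continuousOn_fst.prodMk (e.continuousOn.comp continuousOn_snd fun p hp => hp.2)
  have hcomp := (hF e (chart_mem_atlas _ _)).comp hchart fun p hp => ⟨hp.1, e.map_source hp.2⟩
  refine ((hcomp.congr fun p hp => ?_) (t, x) ⟨ht, hx⟩).mono fun p hp => ⟨hp.1.1, hp.2.2⟩
  simp [e.left_inv hp.2]

namespace IsEinsteinFlow

theorem continuousOn_lapse (hflow : IsEinsteinFlow I L h K) :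
    ContinuousOn (fun p : ℝ × X => L p.1 p.2) (I ×ˢ univ) :=
  continuousOn_prod_of_charts (n := n) fun e he => (hflow.smooth_L e he).continuousOn

theorem continuousOn_shearSq (hflow : IsEinsteinFlow I L h K) :
    ContinuousOn (fun p : ℝ × X => shearSq (h p.1) (K p.1) p.2) (I ×ˢ univ) := by
  refine continuousOn_prod_of_charts (n := n) (F := fun t x => shearSq (h t) (K t) x) fun e he => ?_
  refine ContinuousOn.congr ?_ fun p hp => shearSq_symm_apply he (h p.1) (hflow.symm p.1 hp.1) hp.2
  have hg (i j : Fin n) := (hflow.smooth_h e he i j).continuousOn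
  have hk (i j : Fin n) := (hflow.smooth_K e he i j).continuousOn
  have hinv (i j : Fin n) : ContinuousOn (fun p : ℝ × EuclideanSpace ℝ (Fin n) =>
      (components e (h p.1).inner p.2)⁻¹ i j) (I ×ˢ e.target) :=
    (contDiffOn_inv_apply (hflow.smooth_h e he)
      (fun p hp => (posDef_components he (h p.1) hp.2).det_pos.ne') i j).continuousOn
  have htraceless (i j : Fin n) : ContinuousOn (fun p : ℝ × EuclideanSpace ℝ (Fin n) =>
      Coord.tracelessPart (components e (h p.1).inner p.2) (components e (K p.1) p.2) i j)
      (I ×ˢ e.target) :=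
    (hk i j).sub (ContinuousOn.mul (ContinuousOn.div_const (continuousOn_finsetSum _ fun a _ =>
      continuousOn_finsetSum _ fun b _ => (hinv a b).mul (hk a b)) _) (hg i j))
  exact continuousOn_finsetSum _ fun a _ => continuousOn_finsetSum _ fun b _ =>
    continuousOn_finsetSum _ fun c _ => continuousOn_finsetSum _ fun d _ =>
      (((hinv a c).mul (hinv b d)).mul (htraceless a b)).mul (htraceless c d)

theorem continuous_shearSq (hflow : IsEinsteinFlow I L h K) {t : ℝ} (ht : t ∈ I) :
    Continuous (shearSq (h t) (K t)) :=
  continuousOn_univ.1 <| hflow.continuousOn_shearSq.comp (f := fun x => (t, x))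
    (by fun_prop) fun _ _ => ⟨ht, mem_univ _⟩

end IsEinsteinFlow

namespace IsExpandingCMCEinsteinFlow

variable [CompactSpace X] [MeasurableSpace X] [BorelSpace X]

theorem isFiniteMeasure_volume (hflow : IsExpandingCMCEinsteinFlow I L h K H) {t : ℝ}
    (ht : t ∈ I) : IsFiniteMeasure (riemannianVolume (h t).inner) :=
  isFiniteMeasure_riemannianVolume fun e he i j =>
    (hflow.smoothComponents_metric ht e he i j).continuousOn

theorem lintegral_lapse_mul_shearSq [T2Space X] (hflow : IsExpandingCMCEinsteinFlow I L h K H)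
    (hubble : ∀ t ∈ I, t = -(n : ℝ) / H t) {t : ℝ} (ht : t ∈ I) :
    ∫⁻ x, ENNReal.ofReal (t * L t x * shearSq (h t) (K t) x) ∂riemannianVolume (h t).inner =
      ∫⁻ x, ENNReal.ofReal (n / t * (1 - L t x)) ∂riemannianVolume (h t).inner := by
  have := hflow.isFiniteMeasure_volume ht
  have ht0 := hflow.pos_of_mem hubble ht
  have hint {F : X → ℝ} (hF : Continuous F) : Integrable F (riemannianVolume (h t).inner) :=
    hF.integrable_of_hasCompactSupport (HasCompactSupport.of_compactSpace _)
  have hL := (hflow.smoothInCharts_lapse ht).continuous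
  have hS := hflow.continuous_shearSq ht
  have hshear := hint (F := fun x => t * L t x * shearSq (h t) (K t) x) (by fun_prop)
  have hlapse := hint (F := fun x => n / t * (1 - L t x)) (by fun_prop)
  have hlaplacian := integral_laplacian_eq_zero (hflow.smoothComponents_metric ht)
    (hflow.smoothInCharts_lapse ht)
    (q := fun x => L t x * shearSq (h t) (K t) x - n / t ^ 2 * (1 - L t x)) (by fun_prop)
    fun e he y hy => by
      rw [hflow.lapse_equation hubble he ht hy, shearSq_symm_apply he (h t) (hflow.symm t ht) hy]
  rw [← ofReal_integral_eq_lintegral_ofReal hshear, ← ofReal_integral_eq_lintegral_ofReal hlapse]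
  · congr 1
    rw [← sub_eq_zero, ← integral_sub hshear hlapse, ← mul_zero t, ← hlaplacian,
      ← integral_const_mul]
    congr 1 with x
    field_simp
  · exact Eventually.of_forall fun x => mul_nonneg (by positivity)
      (sub_nonneg.2 (hflow.lapse_le_one hubble ht x))
  · exact Eventually.of_forall fun x => mul_nonneg (mul_nonneg ht0.le (hflow.lapse_nonneg t ht x))
      (shearSq_nonneg _ _ _)

end IsExpandingCMCEinsteinFlow

end Flow

/-! ### Exponential decay with a variable rate -/

section Decay

variable {X : Type*} [TopologicalSpace X]

/-- The factor `exp (-∫_T^t θ(τ, x) dτ)`, which solves `∂ₜf = -θ f` with `f(T) = 1`. -/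
noncomputable def decay (θ : ℝ → X → ℝ) (T t : ℝ) (x : X) : ℝ :=
  Real.exp (-∫ τ in T..t, θ τ x)

theorem decay_pos {X : Type*} (θ : ℝ → X → ℝ) (T t : ℝ) (x : X) : 0 < decay θ T t x :=
  Real.exp_pos _

theorem bddBelow_range_decay {X : Type*} (θ : ℝ → X → ℝ) (T : ℝ) (x : X) :
    BddBelow (range fun t => decay θ T t x) :=
  ⟨0, forall_mem_range.2 fun t => (decay_pos θ T t x).le⟩

theorem decay_self {X : Type*} (θ : ℝ → X → ℝ) (T : ℝ) (x : X) : decay θ T T x = 1 := by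
  simp [decay]

variable {θ : ℝ → X → ℝ}

theorem continuous_rate_apply (hθ : Continuous fun p : ℝ × X => θ p.1 p.2)
    (x : X) : Continuous fun τ => θ τ x :=
  hθ.comp (Continuous.prodMk_left x)

theorem continuous_decay (hθ : Continuous fun p : ℝ × X => θ p.1 p.2)
    (T : ℝ) : Continuous fun p : ℝ × X => decay θ T p.1 p.2 := by
  refine Real.continuous_exp.comp (Continuous.neg ?_)
  exact intervalIntegral.continuous_parametric_intervalIntegral_of_continuous
    (f := fun (p : ℝ × X) τ => θ τ p.2) (by
      exact hθ.comp (continuous_snd.prodMk (continuous_snd.comp continuous_fst))) continuous_fst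

theorem continuous_decay_right (hθ : Continuous fun p : ℝ × X => θ p.1 p.2)
    (T t : ℝ) : Continuous (decay θ T t) :=
  (continuous_decay hθ T).comp (Continuous.prodMk_right t)

theorem hasDerivAt_decay (hθ : Continuous fun p : ℝ × X => θ p.1 p.2)
    (T t : ℝ) (x : X) :
    HasDerivAt (fun τ => decay θ T τ x) (-(θ t x * decay θ T t x)) t := by
  have hintegral := ((continuous_rate_apply hθ x).integral_hasStrictDerivAt T t).hasDerivAt
  exact hintegral.fun_neg.exp.congr_deriv (by rw [decay, mul_neg, mul_comm])

theorem antitone_decay (hθ : Continuous fun p : ℝ × X => θ p.1 p.2)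
    (h0 : ∀ τ x, 0 ≤ θ τ x) (T : ℝ) (x : X) : Antitone fun t => decay θ T t x :=
  antitone_of_deriv_nonpos (fun t => (hasDerivAt_decay hθ T t x).differentiableAt) fun t => by
    rw [(hasDerivAt_decay hθ T t x).deriv]
    exact neg_nonpos.2 (mul_nonneg (h0 t x) (decay_pos θ T t x).le)

theorem decay_le_one (hθ : Continuous fun p : ℝ × X => θ p.1 p.2)
    (h0 : ∀ τ x, 0 ≤ θ τ x) {T t : ℝ} (hTt : T ≤ t) (x : X) : decay θ T t x ≤ 1 :=
  (antitone_decay hθ h0 T x hTt).trans_eq (decay_self θ T x)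

theorem lintegral_rate_mul_decay (hθ : Continuous fun p : ℝ × X => θ p.1 p.2)
    (h0 : ∀ τ x, 0 ≤ θ τ x) (T : ℝ) {s S : ℝ} (hsS : s ≤ S) (x : X) :
    ∫⁻ τ in Icc s S, ENNReal.ofReal (θ τ x * decay θ T τ x) =
      ENNReal.ofReal (decay θ T s x - decay θ T S x) := by
  have hcont : Continuous fun τ => θ τ x * decay θ T τ x :=
    (continuous_rate_apply hθ x).mul ((continuous_decay hθ T).comp (Continuous.prodMk_left x))
  rw [← ofReal_integral_eq_lintegral_ofReal]
  · congr 1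
    rw [integral_Icc_eq_integral_Ioc, ← intervalIntegral.integral_of_le hsS]
    rw [intervalIntegral.integral_eq_sub_of_hasDerivAt
      (fun t _ => ((hasDerivAt_decay hθ T t x).fun_neg).congr_deriv (neg_neg _))
      (hcont.intervalIntegrable s S)]
    ring
  · exact hcont.continuousOn.integrableOn_compact isCompact_Icc
  · exact Eventually.of_forall fun τ => mul_nonneg (h0 τ x) (decay_pos θ T τ x).le

theorem tendsto_decay (hθ : Continuous fun p : ℝ × X => θ p.1 p.2)
    (h0 : ∀ τ x, 0 ≤ θ τ x) (T : ℝ) (x : X) :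
    Tendsto (fun t => decay θ T t x) atTop (𝓝 (⨅ t, decay θ T t x)) :=
  tendsto_atTop_ciInf (antitone_decay hθ h0 T x) (bddBelow_range_decay θ T x)

end Decay

/-! ### Evolution of the volume -/

section VolumeEvolution

variable {n : ℕ} {X : Type*} [TopologicalSpace X] [ChartedSpace (EuclideanSpace ℝ (Fin n)) X]

theorem setLIntegral_chartVolume [MeasurableSpace X] [BorelSpace X]
    {e : OpenPartialHomeomorph X (EuclideanSpace ℝ (Fin n))} {h : Cov2Tensor n X}
    (hcont : ∀ i j, ContinuousOn (fun y => components e h y i j) e.target) {F : X → ENNReal}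
    (hF : Measurable F) {A : Set X} (hA : MeasurableSet A) :
    ∫⁻ x in A, F x ∂chartVolume e h = ∫⁻ y in e.symm ⁻¹' A ∩ e.target,
      ENNReal.ofReal √(components e h y).det * F (e.symm y) := by
  have hsymm : AEMeasurable e.symm (volume.restrict e.target) :=
    e.continuousOn_symm.aemeasurable e.open_target.measurableSet
  have hdensity : AEMeasurable (fun y => ENNReal.ofReal √(components e h y).det)
      (volume.restrict e.target) :=
    ((continuousOn_sqrt_det hcont).aemeasurable e.open_target.measurableSet).ennreal_ofReal
  have hFA : Measurable (A.indicator F) := hF.indicator hA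
  rw [← lintegral_indicator hA, chartVolume,
    lintegral_map' hFA.aemeasurable (aemeasurable_chart_symm e _),
    lintegral_withDensity_eq_lintegral_mul₀ hdensity (g := fun y => A.indicator F (e.symm y))
      (hFA.comp_aemeasurable hsymm), ← lintegral_indicator e.open_target.measurableSet,
    ← lintegral_indicator (measurableSet_symm_preimage_inter_target e hA)]
  refine lintegral_congr fun y => ?_
  by_cases hy : y ∈ e.target <;> by_cases hyA : e.symm y ∈ A <;> simp [hyA, hy]

variable [IsManifold (𝓡 n) ∞ X] {I : Set ℝ} {L : ℝ → X → ℝ} {h : ℝ → SmoothMetric n X}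
  {K : ℝ → Cov2Tensor n X} {H : ℝ → ℝ}

/-- The rate `(n / t) (1 - L)` at which the normalized volume decreases, frozen before
time `T` so that it is continuous and nonnegative on all of `ℝ × X`. -/
noncomputable def volumeRate {X : Type*} (n : ℕ) (L : ℝ → X → ℝ) (T τ : ℝ) (x : X) : ℝ :=
  n / max τ T * (1 - L (max τ T) x)

theorem volumeRate_of_le {X : Type*} (n : ℕ) (L : ℝ → X → ℝ) {T τ : ℝ} (hτ : T ≤ τ) (x : X) :
    volumeRate n L T τ x = n / τ * (1 - L τ x) := by
  simp [volumeRate, max_eq_left hτ]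

/-- The rescaled volume `t⁻ⁿ dvol(X, h(t))`. -/
noncomputable def scaledVolume [MeasurableSpace X] (h : ℝ → SmoothMetric n X) (t : ℝ) : Measure X :=
  ENNReal.ofReal ((t ^ n)⁻¹) • riemannianVolume (h t).inner

theorem IsEinsteinFlow.hasDerivWithinAt_sqrt_det (hflow : IsEinsteinFlow I L h K)
    {e : OpenPartialHomeomorph X (EuclideanSpace ℝ (Fin n))}
    (he : e ∈ atlas (EuclideanSpace ℝ (Fin n)) X) {t : ℝ} (ht : t ∈ I)
    {y : EuclideanSpace ℝ (Fin n)} (hy : y ∈ e.target) :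
    HasDerivWithinAt (fun τ => √(components e (h τ).inner y).det)
      (-(L t (e.symm y) * Coord.tr (components e (h t).inner y) (components e (K t) y))
        * √(components e (h t).inner y).det) I t := by
  have hpos := posDef_components he (h t) hy
  have hh (i j : Fin n) : HasDerivWithinAt (fun τ => components e (h τ).inner y i j)
      (((-2 * L t (e.symm y)) • components e (K t) y) i j) I t :=
    hflow.evolution_h e he t ht y hy i j
  refine ((hasDerivWithinAt_det_of_ne_zero hh hpos.det_pos.ne').sqrt
    hpos.det_pos.ne').congr_deriv ?_
  rw [Matrix.mul_smul, Matrix.trace_smul, smul_eq_mul,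
    ← Coord.tr_eq_trace_of_isSymm _ (isSymm_components e (hflow.symm t ht) y)]
  have hsqrt := Real.sqrt_pos.2 hpos.det_pos
  nth_rewrite 1 [← Real.mul_self_sqrt hpos.det_pos.le]
  field_simp

namespace IsExpandingCMCEinsteinFlow

theorem max_mem (hflow : IsExpandingCMCEinsteinFlow I L h K H) {T : ℝ} (hT : T ∈ I) (τ : ℝ) :
    max τ T ∈ I :=
  hflow.mem_of_le hT (le_max_right _ _)

theorem continuous_volumeRate (hflow : IsExpandingCMCEinsteinFlow I L h K H)
    (hubble : ∀ t ∈ I, t = -(n : ℝ) / H t) {T : ℝ} (hT : T ∈ I) :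
    Continuous fun p : ℝ × X => volumeRate n L T p.1 p.2 := by
  have hL : Continuous fun p : ℝ × X => L (max p.1 T) p.2 :=
    continuousOn_univ.1 <| hflow.continuousOn_lapse.comp (f := fun p : ℝ × X => (max p.1 T, p.2))
      (by fun_prop) fun p _ => ⟨hflow.max_mem hT _, mem_univ _⟩
  refine (continuous_const.div (by fun_prop) fun p => ?_).mul (continuous_const.sub hL)
  exact (hflow.pos_of_mem hubble (hflow.max_mem hT _)).ne'

theorem volumeRate_nonneg [CompactSpace X] (hflow : IsExpandingCMCEinsteinFlow I L h K H)
    (hubble : ∀ t ∈ I, t = -(n : ℝ) / H t) {T : ℝ} (hT : T ∈ I) (τ : ℝ) (x : X) :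
    0 ≤ volumeRate n L T τ x :=
  mul_nonneg (div_nonneg n.cast_nonneg (hflow.pos_of_mem hubble (hflow.max_mem hT _)).le)
    (sub_nonneg.2 (hflow.lapse_le_one hubble (hflow.max_mem hT _) x))

theorem hasDerivWithinAt_inv_pow_mul_sqrt_det (hflow : IsExpandingCMCEinsteinFlow I L h K H)
    (hubble : ∀ t ∈ I, t = -(n : ℝ) / H t)
    {e : OpenPartialHomeomorph X (EuclideanSpace ℝ (Fin n))}
    (he : e ∈ atlas (EuclideanSpace ℝ (Fin n)) X) {t : ℝ} (ht : t ∈ I)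
    {y : EuclideanSpace ℝ (Fin n)} (hy : y ∈ e.target) :
    HasDerivWithinAt (fun τ => (τ ^ n)⁻¹ * √(components e (h τ).inner y).det)
      (-(n / t * (1 - L t (e.symm y))) * ((t ^ n)⁻¹ * √(components e (h t).inner y).det)) I t := by
  have ht0 := (hflow.pos_of_mem hubble ht).ne'
  have hpow : HasDerivWithinAt (fun τ : ℝ => (τ ^ n)⁻¹) (-(n / t) * (t ^ n)⁻¹) I t := by
    have hzpow := (hasDerivAt_zpow (-n : ℤ) t (.inl ht0)).hasDerivWithinAt (s := I)
    simp only [zpow_neg, zpow_natCast, zpow_sub_one₀ ht0] at hzpow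
    refine hzpow.congr_deriv ?_
    push_cast
    ring
  refine (hpow.fun_mul (hflow.hasDerivWithinAt_sqrt_det he ht hy)).congr_deriv ?_
  rw [hflow.cmc e he t ht y hy, hflow.meanCurvature_eq hubble ht]
  ring

theorem inv_pow_mul_sqrt_det_eq (hflow : IsExpandingCMCEinsteinFlow I L h K H)
    (hubble : ∀ t ∈ I, t = -(n : ℝ) / H t) {T : ℝ} (hT : T ∈ I)
    {e : OpenPartialHomeomorph X (EuclideanSpace ℝ (Fin n))}
    (he : e ∈ atlas (EuclideanSpace ℝ (Fin n)) X) {y : EuclideanSpace ℝ (Fin n)}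
    (hy : y ∈ e.target) {t : ℝ} (hTt : T ≤ t) :
    (t ^ n)⁻¹ * √(components e (h t).inner y).det =
      (T ^ n)⁻¹ * (√(components e (h T).inner y).det *
        decay (volumeRate n L T) T t (e.symm y)) := by
  set θ := volumeRate n L T
  set x := e.symm y
  have hdecay (τ : ℝ) : decay θ T τ x ≠ 0 := (decay_pos θ T τ x).ne'
  let w : ℝ → ℝ := fun τ => (τ ^ n)⁻¹ * √(components e (h τ).inner y).det * (decay θ T τ x)⁻¹
  have hderiv (τ : ℝ) (hτ : T ≤ τ) : HasDerivWithinAt w 0 I τ := by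
    have hinv := ((hasDerivAt_decay (hflow.continuous_volumeRate hubble hT) T τ x).fun_inv
      (hdecay τ)).hasDerivWithinAt (s := I)
    refine ((hflow.hasDerivWithinAt_inv_pow_mul_sqrt_det hubble he (hflow.mem_of_le hT hτ)
      hy).fun_mul hinv).congr_deriv ?_
    rw [volumeRate_of_le n L hτ]
    field_simp [hdecay τ]
    ring
  have hconst : w t = w T := constant_of_has_deriv_right_zero
    (fun τ hτ => (hderiv τ hτ.1).continuousWithinAt.mono fun σ hσ => hflow.mem_of_le hT hσ.1)
    (fun τ hτ => (hderiv τ hτ.1).mono fun σ hσ => hflow.mem_of_le hT (hτ.1.trans hσ)) t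
    (right_mem_Icc.2 hTt)
  simp only [w, decay_self, inv_one, mul_one] at hconst
  rw [← mul_assoc, ← hconst, inv_mul_cancel_right₀ (hdecay t)]

variable [CompactSpace X] [MeasurableSpace X] [BorelSpace X]

theorem scaledVolume_eq_withDensity (hflow : IsExpandingCMCEinsteinFlow I L h K H)
    (hubble : ∀ t ∈ I, t = -(n : ℝ) / H t) {T : ℝ} (hT : T ∈ I) {t : ℝ} (hTt : T ≤ t) :
    scaledVolume h t = (scaledVolume h T).withDensity
      fun x => ENNReal.ofReal (decay (volumeRate n L T) T t x) := by
  have hdecay : Measurable fun x => ENNReal.ofReal (decay (volumeRate n L T) T t x) :=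
    (continuous_decay_right (hflow.continuous_volumeRate hubble hT) T t).measurable.ennreal_ofReal
  have ht0 := hflow.pos_of_mem hubble (hflow.mem_of_le hT hTt)
  have hT0 := hflow.pos_of_mem hubble hT
  obtain ⟨F, -, hF⟩ := isCompact_univ.elim_nhds_subcover
    (fun x : X => (chartAt (EuclideanSpace ℝ (Fin n)) x).source)
    (fun x _ => chart_source_mem_nhds _ x)
  refine (Measure.ext_iff_of_biUnion_eq_univ (S := (F : Set X))
    (s := fun x => (chartAt (EuclideanSpace ℝ (Fin n)) x).source) F.countable_toSet
    (univ_subset_iff.1 hF)).2 fun i _ => ?_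
  set e := chartAt (EuclideanSpace ℝ (Fin n)) i
  have he : e ∈ atlas (EuclideanSpace ℝ (Fin n)) X := chart_mem_atlas _ _
  rw [scaledVolume, scaledVolume, restrict_withDensity e.open_source.measurableSet,
    Measure.restrict_smul,
    Measure.restrict_smul, riemannianVolume_restrict_source he,
    riemannianVolume_restrict_source he]
  ext A hA
  rw [withDensity_apply _ hA, Measure.restrict_smul, lintegral_smul_measure, Measure.smul_apply,
    chartVolume_apply e _ hA, setLIntegral_chartVolume
      (fun i j => (hflow.smoothComponents_metric hT e he i j).continuousOn) hdecay hA, smul_eq_mul,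
    smul_eq_mul, ← lintegral_const_mul' _ _ ENNReal.ofReal_ne_top,
    ← lintegral_const_mul' _ _ ENNReal.ofReal_ne_top]
  refine setLIntegral_congr_fun (measurableSet_symm_preimage_inter_target e hA) fun y hy => ?_
  rw [← ENNReal.ofReal_mul (by positivity), ← ENNReal.ofReal_mul (by positivity),
    ← ENNReal.ofReal_mul (by positivity), hflow.inv_pow_mul_sqrt_det_eq hubble hT he hy.2 hTt]

end IsExpandingCMCEinsteinFlow

end VolumeEvolution

/-! ### The distance in terms of the flow -/

section Relates

variable {n : ℕ} {V : Type*} [AddCommGroup V] [Module ℝ V] [TopologicalSpace V]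
  {g k : V →L[ℝ] V →L[ℝ] ℝ} {A : V →ₗ[ℝ] V} {b v : Module.Basis (Fin n) ℝ V}

theorem IsOrthonormalBasis.gramMatrix_eq_one (hb : IsOrthonormalBasis g b) :
    gramMatrix g b = 1 := by
  ext i j
  simp [gramMatrix, hb i j, Matrix.one_apply]

theorem Relates.cosetPoint_toMatrix (hA : Relates g k A) (hb : IsOrthonormalBasis g b) :
    cosetPoint (LinearMap.toMatrix b b A) = gramMatrix k b := by
  have hsum (i : Fin n) : A (b i) = ∑ m, LinearMap.toMatrix b b A m i • b m := by
    simpa only [LinearMap.toMatrix_apply] using (b.sum_repr (A (b i))).symm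
  have hgram : gramMatrix k b = gramMatrix g fun i => A (b i) := by
    ext i j
    exact hA.1 _ _
  rw [hgram, gramMatrix_of_eq_sum g hsum, hb.gramMatrix_eq_one, Matrix.mul_one, cosetPoint]

theorem Relates.cosetPoint_unimodularPart (hA : Relates g k A) (hb : IsOrthonormalBasis g b) :
    cosetPoint (LinearMap.toMatrix b b (unimodularPart n A)) = detNormalize (gramMatrix k b) := by
  have hdet : (gramMatrix k b).det = LinearMap.det A * LinearMap.det A := by
    rw [← hA.cosetPoint_toMatrix hb, cosetPoint, Matrix.det_mul, Matrix.det_transpose,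
      LinearMap.det_toMatrix]
  rw [unimodularPart, map_smul, cosetPoint, Matrix.transpose_smul, Matrix.smul_mul,
    Matrix.mul_smul, smul_smul, ← Real.mul_rpow hA.2.le hA.2.le, ← hdet, detNormalize,
    ← hA.cosetPoint_toMatrix hb, cosetPoint]

theorem conformalDist_gramMatrix_congr (hg : (gramMatrix g v).PosDef)
    (hk : (gramMatrix k v).PosDef) :
    conformalDist (gramMatrix k b) (gramMatrix g b) =
      conformalDist (gramMatrix k v) (gramMatrix g v) := by
  have hsum (i : Fin n) : b i = ∑ m, v.toMatrix b m i • v m := (v.sum_toMatrix_smul_self b i).symm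
  have hdet : (v.toMatrix b).det ≠ 0 :=
    Matrix.det_ne_zero_of_right_inverse (v.toMatrix_mul_toMatrix_flip b)
  rw [gramMatrix_of_eq_sum k hsum, gramMatrix_of_eq_sum g hsum,
    conformalDist_transpose_mul_mul hk hg hdet]

theorem Relates.symmDist_cosetPoint (hA : Relates g k A) (hb : IsOrthonormalBasis g b)
    (hg : (gramMatrix g v).PosDef) (hk : (gramMatrix k v).PosDef) :
    symmDist (cosetPoint (LinearMap.toMatrix b b (unimodularPart n A))) 1 =
      conformalDist (gramMatrix k v) (gramMatrix g v) := by
  rw [← conformalDist_gramMatrix_congr hg hk (b := b), conformalDist,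
    hA.cosetPoint_unimodularPart hb, hb.gramMatrix_eq_one,
    detNormalize_of_det_eq_one Matrix.det_one]

end Relates

section ConformalLength

variable {n : ℕ}

theorem Coord.normSq_smul (g : Matrix (Fin n) (Fin n) ℝ) (c : ℝ) (T : Matrix (Fin n) (Fin n) ℝ) :
    Coord.normSq g (c • T) = c ^ 2 * Coord.normSq g T := by
  simp only [Coord.normSq, Matrix.smul_apply, smul_eq_mul, Finset.mul_sum]
  exact Finset.sum_congr rfl fun i _ => Finset.sum_congr rfl fun j _ =>
    Finset.sum_congr rfl fun k _ => Finset.sum_congr rfl fun l _ => by ring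

theorem Coord.tracelessPart_smul (g : Matrix (Fin n) (Fin n) ℝ) (c : ℝ)
    (T : Matrix (Fin n) (Fin n) ℝ) :
    Coord.tracelessPart g (c • T) = c • Coord.tracelessPart g T := by
  rw [Coord.tracelessPart, Coord.tracelessPart, Coord.tr_smul, smul_sub, smul_smul, mul_div_assoc]

theorem conformalSpeed_smul (P : Matrix (Fin n) (Fin n) ℝ) (c : ℝ)
    (V : Matrix (Fin n) (Fin n) ℝ) : conformalSpeed P (c • V) = |c| * conformalSpeed P V := by
  rw [conformalSpeed, Coord.tracelessPart_smul, Coord.normSq_smul, Real.sqrt_mul (sq_nonneg c),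
    Real.sqrt_sq_eq_abs, conformalSpeed]

theorem conformalDist_le_lintegral_uIcc {γ W : ℝ → Matrix (Fin n) (Fin n) ℝ} {a b : ℝ}
    (hab : a ≠ b) (hγ : ∀ i j, ContDiffOn ℝ 1 (fun τ => γ τ i j) (uIcc a b))
    (hpos : ∀ τ ∈ uIcc a b, (γ τ).PosDef)
    (hW : ∀ τ ∈ uIcc a b, ∀ i j,
      HasDerivWithinAt (fun σ => γ σ i j) (W τ i j) (uIcc a b) τ) :
    conformalDist (γ a) (γ b) ≤
      ∫⁻ τ in uIcc a b, ENNReal.ofReal (conformalSpeed (γ τ) (W τ)) := by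
  set σ : ℝ → ℝ := ⇑(AffineMap.lineMap a b : ℝ →ᵃ[ℝ] ℝ)
  have himage : σ '' Icc 0 1 = uIcc a b := by rw [← segment_eq_image_lineMap, segment_eq_uIcc]
  have hmaps : MapsTo σ (Icc 0 1) (uIcc a b) := himage ▸ mapsTo_image σ _
  have hσ (u : ℝ) : HasDerivWithinAt σ (b - a) (Icc 0 1) u := AffineMap.hasDerivWithinAt_lineMap
  have hsmooth : ContDiffOn ℝ 1 σ (Icc 0 1) := by
    simp only [σ]
    fun_prop
  have hle := conformalDist_le_lintegral_conformalSpeed (γ := γ ∘ σ)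
    (W := fun u => (b - a) • W (σ u)) (fun i j => (hγ i j).comp hsmooth hmaps)
    (fun u hu => hpos _ (hmaps hu))
    (fun u hu i j => (hW _ (hmaps hu) i j).scomp u (hσ u) hmaps)
  simp only [Function.comp_apply, conformalSpeed_smul, σ, AffineMap.lineMap_apply_zero,
    AffineMap.lineMap_apply_one] at hle
  rw [← himage, lintegral_image_eq_lintegral_abs_deriv_mul measurableSet_Icc
    (fun u _ => hσ u) (AffineMap.lineMap_injective ℝ hab).injOn]
  simpa only [ENNReal.ofReal_mul (abs_nonneg _)] using hle

end ConformalLength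

theorem sq_lintegral_mul_le {α : Type*} [MeasurableSpace α] {μ : Measure α} {f g : α → ENNReal}
    (hf : AEMeasurable f μ) (hg : AEMeasurable g μ) :
    (∫⁻ a, f a * g a ∂μ) ^ 2 ≤ (∫⁻ a, f a ^ 2 ∂μ) * ∫⁻ a, g a ^ 2 ∂μ := by
  have hsq (c : ENNReal) : (c ^ (1 / 2 : ℝ)) ^ 2 = c := by
    rw [← ENNReal.rpow_mul_natCast, Nat.cast_ofNat, one_div_mul_cancel two_ne_zero,
      ENNReal.rpow_one]
  have hholder := ENNReal.lintegral_mul_le_Lp_mul_Lq μ Real.HolderConjugate.two_two hf hg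
  simpa only [mul_pow, hsq, ENNReal.rpow_two, Pi.mul_apply] using pow_le_pow_left' hholder 2

theorem lintegral_inv_Icc {a b : ℝ} (ha : 0 < a) (hab : a ≤ b) :
    ∫⁻ τ in Icc a b, ENNReal.ofReal τ⁻¹ = ENNReal.ofReal (Real.log (b / a)) := by
  rw [← integral_inv_of_pos ha (ha.trans_le hab), intervalIntegral.integral_of_le hab,
    ← integral_Icc_eq_integral_Ioc, ofReal_integral_eq_lintegral_ofReal]
  · exact ContinuousOn.integrableOn_compact isCompact_Icc
      (continuousOn_id.inv₀ fun τ hτ => (ha.trans_le hτ.1).ne')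
  · filter_upwards [ae_restrict_mem measurableSet_Icc] with τ hτ
    exact inv_nonneg.2 (ha.le.trans hτ.1)

theorem lintegral_sq_two_mul_inv_sqrt {a b : ℝ} (ha : 0 < a) (hab : a ≤ b) :
    ∫⁻ τ in Icc a b, ENNReal.ofReal (2 * (√τ)⁻¹) ^ 2 =
      ENNReal.ofReal (4 * Real.log (b / a)) := by
  rw [ENNReal.ofReal_mul zero_le_four, ← lintegral_inv_Icc ha hab,
    ← lintegral_const_mul _ (by fun_prop)]
  refine setLIntegral_congr_fun measurableSet_Icc fun τ hτ => ?_
  rw [← ENNReal.ofReal_pow (by positivity), ← ENNReal.ofReal_mul zero_le_four, mul_pow, inv_pow,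
    Real.sq_sqrt (ha.le.trans hτ.1)]
  norm_num

section FlowDistance

variable {n : ℕ} {X : Type*} [TopologicalSpace X] [ChartedSpace (EuclideanSpace ℝ (Fin n)) X]
  [IsManifold (𝓡 n) ∞ X] {I : Set ℝ} {L : ℝ → X → ℝ} {h : ℝ → SmoothMetric n X}
  {K : ℝ → Cov2Tensor n X} {H : ℝ → ℝ} {e : OpenPartialHomeomorph X (EuclideanSpace ℝ (Fin n))}
  {y : EuclideanSpace ℝ (Fin n)}

/-- The frame of a chart of the atlas, as a basis. -/
noncomputable def chartBasis (he : e ∈ atlas (EuclideanSpace ℝ (Fin n)) X) (hy : y ∈ e.target) :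
    Module.Basis (Fin n) ℝ (EuclideanSpace ℝ (Fin n)) :=
  basisOfLinearIndependentOfCardEqFinrank' (chartFrame e y) (linearIndependent_chartFrame he hy)
    (by simp)

theorem gramMatrix_chartBasis (he : e ∈ atlas (EuclideanSpace ℝ (Fin n)) X) (hy : y ∈ e.target)
    (T : Cov2Tensor n X) :
    gramMatrix (tensorAt T (e.symm y)) (chartBasis he hy) = components e T y := by
  rw [chartBasis, coe_basisOfLinearIndependentOfCardEqFinrank', components_eq_gramMatrix]

theorem symmDist_unimodularPart_eq_conformalDist {s Λ : ℝ} (hs : 0 < s)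
    (he : e ∈ atlas (EuclideanSpace ℝ (Fin n)) X) (hy : y ∈ e.target)
    {A : TangentSpace (𝓡 n) (e.symm y) →ₗ[ℝ] TangentSpace (𝓡 n) (e.symm y)}
    {b : Module.Basis (Fin n) ℝ (TangentSpace (𝓡 n) (e.symm y))}
    (hA : Relates (rescaledMetric h s 1 (e.symm y)) (rescaledMetric h s Λ (e.symm y)) A)
    (hb : IsOrthonormalBasis (rescaledMetric h s 1 (e.symm y)) b) :
    symmDist (cosetPoint (LinearMap.toMatrix b b (unimodularPart n A))) 1 =
      conformalDist (components e (h (s * Λ)).inner y) (components e (h s).inner y) := by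
  have hs' : 0 < (s ^ 2)⁻¹ := by positivity
  have hpos (t : ℝ) : (components e (h t).inner y).PosDef := posDef_components he (h t) hy
  have hgram (u : ℝ) : gramMatrix (tensorAt (rescaledMetric h s u) (e.symm y)) (chartBasis he hy) =
      (s ^ 2)⁻¹ • components e (h (s * u)).inner y := gramMatrix_chartBasis he hy _
  have hgram_pos (u : ℝ) :
      (gramMatrix (tensorAt (rescaledMetric h s u) (e.symm y)) (chartBasis he hy)).PosDef :=
    hgram u ▸ (hpos (s * u)).smul hs'
  refine (Relates.symmDist_cosetPoint (g := tensorAt (rescaledMetric h s 1) (e.symm y))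
    (k := tensorAt (rescaledMetric h s Λ) (e.symm y)) hA hb (hgram_pos 1) (hgram_pos Λ)).trans ?_
  rw [hgram, hgram, mul_one, conformalDist_smul_smul (hpos _) (hpos _) hs' hs']

namespace IsExpandingCMCEinsteinFlow

theorem conformalDist_metric_le (hflow : IsExpandingCMCEinsteinFlow I L h K H) {s S : ℝ}
    (hs : s ∈ I) (hsS : s < S) (he : e ∈ atlas (EuclideanSpace ℝ (Fin n)) X)
    (hy : y ∈ e.target) :
    conformalDist (components e (h S).inner y) (components e (h s).inner y) ≤
      ∫⁻ τ in Icc s S, ENNReal.ofReal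
        (2 * L τ (e.symm y) * √(shearSq (h τ) (K τ) (e.symm y))) := by
  have hIcc : uIcc S s = Icc s S := uIcc_of_ge hsS.le
  have hsub : uIcc S s ⊆ I := fun τ hτ => hflow.mem_of_le hs (hIcc ▸ hτ).1
  have hle := conformalDist_le_lintegral_uIcc hsS.ne' (γ := fun τ => components e (h τ).inner y)
    (W := fun τ => (-2 * L τ (e.symm y)) • components e (K τ) y)
    (fun i j => ((hflow.smooth_h e he i j).of_le (by simp)).comp (f := fun τ => (τ, y))
      (contDiffOn_id.prodMk contDiffOn_const) fun τ hτ => ⟨hsub hτ, hy⟩)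
    (fun τ _ => posDef_components he (h τ) hy)
    (fun τ hτ i j => (hflow.evolution_h e he τ (hsub hτ) y hy i j).mono hsub)
  refine hle.trans_eq ?_
  rw [hIcc]
  refine setLIntegral_congr_fun measurableSet_Icc fun τ hτ => ?_
  have hτI : τ ∈ I := hflow.mem_of_le hs hτ.1
  rw [conformalSpeed_smul, conformalSpeed, shearSq_symm_apply he (h τ) (hflow.symm τ hτI) hy,
    abs_mul, abs_neg, abs_two, abs_of_nonneg (hflow.lapse_nonneg τ hτI _)]

theorem sq_speed_le [CompactSpace X] (hflow : IsExpandingCMCEinsteinFlow I L h K H)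
    (hubble : ∀ t ∈ I, t = -(n : ℝ) / H t) {τ : ℝ} (hτ : τ ∈ I) (x : X) :
    (√τ * L τ x * √(shearSq (h τ) (K τ) x)) ^ 2 ≤
      τ * L τ x * shearSq (h τ) (K τ) x := by
  have hτ0 := (hflow.pos_of_mem hubble hτ).le
  have hL0 := hflow.lapse_nonneg τ hτ x
  have hL1 := hflow.lapse_le_one hubble hτ x
  have hshear := shearSq_nonneg (h τ) (K τ) x
  rw [mul_pow, mul_pow, Real.sq_sqrt hτ0, Real.sq_sqrt hshear]
  gcongr
  exact pow_le_of_le_one hL0 hL1 two_ne_zero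

theorem continuousOn_sqrt_mul_speed (hflow : IsExpandingCMCEinsteinFlow I L h K H) {s S : ℝ}
    (hs : s ∈ I) (x : X) :
    ContinuousOn (fun τ => √τ * L τ x * √(shearSq (h τ) (K τ) x))
      (Icc s S) := by
  have hmaps : MapsTo (fun τ => (τ, x)) (Icc s S) (I ×ˢ univ) :=
    fun τ hτ => ⟨hflow.mem_of_le hs hτ.1, mem_univ x⟩
  have hL : ContinuousOn (fun τ => L τ x) (Icc s S) :=
    hflow.continuousOn_lapse.comp (f := fun τ => (τ, x)) (by fun_prop) hmaps
  have hshear : ContinuousOn (fun τ => shearSq (h τ) (K τ) x) (Icc s S) :=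
    hflow.continuousOn_shearSq.comp (f := fun τ => (τ, x)) (by fun_prop) hmaps
  exact (Real.continuous_sqrt.continuousOn.mul hL).mul
    (Real.continuous_sqrt.comp_continuousOn hshear)

theorem sq_lintegral_speed_le [CompactSpace X] (hflow : IsExpandingCMCEinsteinFlow I L h K H)
    (hubble : ∀ t ∈ I, t = -(n : ℝ) / H t) {s S : ℝ} (hs : s ∈ I) (hsS : s ≤ S) (x : X) :
    (∫⁻ τ in Icc s S, ENNReal.ofReal (2 * L τ x * √(shearSq (h τ) (K τ) x))) ^ 2 ≤
      ENNReal.ofReal (4 * Real.log (S / s)) *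
        ∫⁻ τ in Icc s S, ENNReal.ofReal (τ * L τ x * shearSq (h τ) (K τ) x) := by
  have hs0 := hflow.pos_of_mem hubble hs
  -- Cauchy–Schwarz with the weight `τ`, which makes the constant depend on `S / s` only.
  have hsplit : EqOn
      (fun τ => ENNReal.ofReal (2 * L τ x * √(shearSq (h τ) (K τ) x)))
      (fun τ => ENNReal.ofReal (2 * (√τ)⁻¹) *
        ENNReal.ofReal (√τ * L τ x * √(shearSq (h τ) (K τ) x))) (Icc s S) := by
    intro τ hτ
    have hτ0 : 0 < √τ := Real.sqrt_pos.2 (hs0.trans_le hτ.1)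
    dsimp only
    rw [← ENNReal.ofReal_mul (by positivity)]
    congr 1
    field_simp
  have hmeas : AEMeasurable (fun τ => ENNReal.ofReal
      (√τ * L τ x * √(shearSq (h τ) (K τ) x))) (volume.restrict (Icc s S)) :=
    ((hflow.continuousOn_sqrt_mul_speed hs x).aemeasurable measurableSet_Icc).ennreal_ofReal
  rw [setLIntegral_congr_fun measurableSet_Icc hsplit]
  refine (sq_lintegral_mul_le (by fun_prop) hmeas).trans ?_
  rw [lintegral_sq_two_mul_inv_sqrt hs0 hsS]
  refine mul_le_mul_right (setLIntegral_mono' measurableSet_Icc fun τ hτ => ?_) _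
  have hτI := hflow.mem_of_le hs hτ.1
  have hL0 := hflow.lapse_nonneg τ hτI x
  rw [← ENNReal.ofReal_pow (by positivity)]
  exact ENNReal.ofReal_le_ofReal (hflow.sq_speed_le hubble hτI x)

theorem sq_conformalDist_metric_le [CompactSpace X] (hflow : IsExpandingCMCEinsteinFlow I L h K H)
    (hubble : ∀ t ∈ I, t = -(n : ℝ) / H t) {s S : ℝ} (hs : s ∈ I) (hsS : s < S)
    (he : e ∈ atlas (EuclideanSpace ℝ (Fin n)) X) (hy : y ∈ e.target) :
    conformalDist (components e (h S).inner y) (components e (h s).inner y) ^ 2 ≤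
      ENNReal.ofReal (4 * Real.log (S / s)) * ∫⁻ τ in Icc s S,
        ENNReal.ofReal (τ * L τ (e.symm y) * shearSq (h τ) (K τ) (e.symm y)) :=
  (pow_le_pow_left' (hflow.conformalDist_metric_le hs hsS he hy) 2).trans
    (hflow.sq_lintegral_speed_le hubble hs hsS.le _)

theorem eventually_conformalDist_metric_lt (hflow : IsExpandingCMCEinsteinFlow I L h K H)
    {s S : ℝ} (hs : s ∈ I) (hS : S ∈ I) (he : e ∈ atlas (EuclideanSpace ℝ (Fin n)) X)
    (hy : y ∈ e.target) {c : ENNReal}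
    (hlt : conformalDist (components e (h S).inner y) (components e (h s).inner y) < c) :
    ∀ᶠ z in 𝓝 y, conformalDist (components e (h S).inner z) (components e (h s).inner z) < c := by
  have hcont {t : ℝ} (ht : t ∈ I) : ContinuousAt (components e (h t).inner) y :=
    continuousAt_pi.2 fun i => continuousAt_pi.2 fun j =>
      (hflow.smoothComponents_metric ht e he i j).continuousOn.continuousAt
        (e.open_target.mem_nhds hy)
  have hnear := ((hcont hS).prodMk_nhds (hcont hs)).eventually (eventually_conformalDist_lt
    (posDef_components he (h S) hy) (posDef_components he (h s) hy) hlt)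
  filter_upwards [hnear, e.open_target.mem_nhds hy] with z hz hze
  exact hz (posDef_components he (h S) hze) (posDef_components he (h s) hze)

theorem measurable_of_eq_conformalDist [MeasurableSpace X] [BorelSpace X]
    (hflow : IsExpandingCMCEinsteinFlow I L h K H) {s S : ℝ} (hs : s ∈ I) (hS : S ∈ I)
    {D : X → ENNReal}
    (hD : ∀ e ∈ atlas (EuclideanSpace ℝ (Fin n)) X, ∀ y ∈ e.target, D (e.symm y) =
      conformalDist (components e (h S).inner y) (components e (h s).inner y)) :
    Measurable D := by
  refine measurable_of_Iio fun c => IsOpen.measurableSet (isOpen_iff_eventually.2 fun x hx => ?_)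
  set e := chartAt (EuclideanSpace ℝ (Fin n)) x
  have he : e ∈ atlas (EuclideanSpace ℝ (Fin n)) X := chart_mem_atlas _ _
  have hsource : x ∈ e.source := mem_chart_source _ x
  have hchart (z : X) (hz : z ∈ e.source) : D z = conformalDist
      (components e (h S).inner (e z)) (components e (h s).inner (e z)) := by
    rw [← hD e he (e z) (e.map_source hz), e.left_inv hz]
  have hnear := hflow.eventually_conformalDist_metric_lt hs hS he (e.map_source hsource)
    ((hchart x hsource).symm.trans_lt hx)
  filter_upwards [(e.continuousAt hsource).eventually hnear, e.open_source.mem_nhds hsource]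
    with z hz hze
  exact (hchart z hze).trans_lt hz

end IsExpandingCMCEinsteinFlow

end FlowDistance

/-! ### The limit of the rescaled volumes -/

theorem lintegral_setLIntegral_swap_of_continuousOn {X : Type*} [TopologicalSpace X]
    [MeasurableSpace X] [OpensMeasurableSpace X] {μ : Measure X} [SFinite μ] {F : ℝ → X → ℝ}
    {J : Set ℝ} (hJ : MeasurableSet J)
    (hF : ContinuousOn (fun p : ℝ × X => F p.1 p.2) (J ×ˢ univ)) :
    ∫⁻ x, (∫⁻ τ in J, ENNReal.ofReal (F τ x)) ∂μ =
      ∫⁻ τ in J, ∫⁻ x, ENNReal.ofReal (F τ x) ∂μ := by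
  have hrestrict : μ.prod (volume.restrict J) = (μ.prod volume).restrict (univ ×ˢ J) := by
    rw [← Measure.prod_restrict, Measure.restrict_univ]
  refine lintegral_lintegral_swap (AEMeasurable.ennreal_ofReal (f := fun p : X × ℝ => F p.2 p.1) ?_)
  rw [hrestrict]
  exact (hF.comp (f := Prod.swap) continuous_swap.continuousOn
    fun p hp => ⟨hp.2, mem_univ _⟩).aemeasurable (MeasurableSet.univ.prod hJ)

section LimitVolume

variable {n : ℕ} {X : Type*} [TopologicalSpace X] [ChartedSpace (EuclideanSpace ℝ (Fin n)) X]
  [IsManifold (𝓡 n) ∞ X] [MeasurableSpace X] {I : Set ℝ} {L : ℝ → X → ℝ}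
  {h : ℝ → SmoothMetric n X} {K : ℝ → Cov2Tensor n X} {H : ℝ → ℝ}

/-- The limit of the rescaled volumes, by its density with respect to the one at time `T`. -/
noncomputable def limitVolume (L : ℝ → X → ℝ) (h : ℝ → SmoothMetric n X) (T : ℝ) : Measure X :=
  (scaledVolume h T).withDensity fun x => ENNReal.ofReal (⨅ t, decay (volumeRate n L T) T t x)

theorem tendsto_scaledVolume_sub_scaledVolume {μ : Measure X} [IsFiniteMeasure μ]
    (hμ : IsLimitVolume h μ) {Λ : ℝ} (hΛ : 0 < Λ) :
    Tendsto (fun s => scaledVolume h s univ - scaledVolume h (s * Λ) univ) atTop (𝓝 0) := by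
  have hvolume : Tendsto (fun s => scaledVolume h s univ) atTop (𝓝 (μ univ)) :=
    hμ univ MeasurableSet.univ
  have hsub := ENNReal.Tendsto.sub hvolume (hvolume.comp (tendsto_id.atTop_mul_const hΛ))
    (Or.inl (measure_ne_top μ univ))
  rwa [tsub_self] at hsub

namespace IsExpandingCMCEinsteinFlow

variable [CompactSpace X] [BorelSpace X]

theorem isFiniteMeasure_scaledVolume (hflow : IsExpandingCMCEinsteinFlow I L h K H)
    {t : ℝ} (ht : t ∈ I) : IsFiniteMeasure (scaledVolume h t) := by
  have := hflow.isFiniteMeasure_volume ht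
  exact Measure.smul_finite _ ENNReal.ofReal_ne_top

theorem limitVolume_le_scaledVolume (hflow : IsExpandingCMCEinsteinFlow I L h K H)
    (hubble : ∀ t ∈ I, t = -(n : ℝ) / H t) {T t : ℝ} (hT : T ∈ I) (hTt : T ≤ t) :
    limitVolume L h T ≤ scaledVolume h t := by
  rw [limitVolume, hflow.scaledVolume_eq_withDensity hubble hT hTt]
  exact withDensity_mono <| Eventually.of_forall fun x =>
    ENNReal.ofReal_le_ofReal (ciInf_le (bddBelow_range_decay _ T x) t)

theorem isFiniteMeasure_limitVolume (hflow : IsExpandingCMCEinsteinFlow I L h K H)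
    (hubble : ∀ t ∈ I, t = -(n : ℝ) / H t) {T : ℝ} (hT : T ∈ I) :
    IsFiniteMeasure (limitVolume L h T) :=
  have := hflow.isFiniteMeasure_scaledVolume hT
  isFiniteMeasure_of_le _ (hflow.limitVolume_le_scaledVolume hubble hT le_rfl)

theorem isLimitVolume_limitVolume (hflow : IsExpandingCMCEinsteinFlow I L h K H)
    (hubble : ∀ t ∈ I, t = -(n : ℝ) / H t) {T : ℝ} (hT : T ∈ I) :
    IsLimitVolume h (limitVolume L h T) := by
  intro A hA
  have hθ := hflow.continuous_volumeRate hubble hT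
  have hrate := hflow.volumeRate_nonneg hubble hT
  have := hflow.isFiniteMeasure_scaledVolume hT
  have hvolume : (fun t => ∫⁻ x in A, ENNReal.ofReal (decay (volumeRate n L T) T t x)
      ∂scaledVolume h T) =ᶠ[atTop] fun t => scaledVolume h t A := by
    filter_upwards [eventually_ge_atTop T] with t ht
    rw [hflow.scaledVolume_eq_withDensity hubble hT ht, withDensity_apply _ hA]
  rw [limitVolume, withDensity_apply _ hA]
  refine (tendsto_lintegral_filter_of_dominated_convergence (fun _ => 1)
    (Eventually.of_forall fun t => (continuous_decay_right hθ T t).measurable.ennreal_ofReal)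
    ?_ (by simp) (Eventually.of_forall fun x => ?_)).congr' hvolume
  · filter_upwards [eventually_ge_atTop T] with t ht
    exact Eventually.of_forall fun x => ENNReal.ofReal_le_one.2 (decay_le_one hθ hrate ht x)
  · exact (ENNReal.continuous_ofReal.tendsto _).comp (tendsto_decay hθ hrate T x)

theorem lintegral_rate_scaledVolume (hflow : IsExpandingCMCEinsteinFlow I L h K H)
    (hubble : ∀ t ∈ I, t = -(n : ℝ) / H t) {s S : ℝ} (hs : s ∈ I) (hsS : s ≤ S) :
    ∫⁻ τ in Icc s S, ∫⁻ x, ENNReal.ofReal (n / τ * (1 - L τ x)) ∂scaledVolume h τ =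
      scaledVolume h s univ - scaledVolume h S univ := by
  have := hflow.isFiniteMeasure_scaledVolume hs
  have := hflow.isFiniteMeasure_scaledVolume (hflow.mem_of_le hs hsS)
  have hθ := hflow.continuous_volumeRate hubble hs
  have hrate := hflow.volumeRate_nonneg hubble hs
  set θ := volumeRate n L s
  have hdecay (τ : ℝ) : Measurable fun x => ENNReal.ofReal (decay θ s τ x) :=
    (continuous_decay_right hθ s τ).measurable.ennreal_ofReal
  have hvolume {τ : ℝ} (hτ : s ≤ τ) := hflow.scaledVolume_eq_withDensity hubble hs hτ
  have hvolume_univ : ∫⁻ x, ENNReal.ofReal (decay θ s S x) ∂scaledVolume h s =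
      scaledVolume h S univ := by
    rw [hvolume hsS, withDensity_apply _ MeasurableSet.univ, Measure.restrict_univ]
  calc ∫⁻ τ in Icc s S, ∫⁻ x, ENNReal.ofReal (n / τ * (1 - L τ x)) ∂scaledVolume h τ
      = ∫⁻ τ in Icc s S, ∫⁻ x, ENNReal.ofReal (θ τ x * decay θ s τ x) ∂scaledVolume h s := by
        refine setLIntegral_congr_fun measurableSet_Icc fun τ hτ => ?_
        have hmeas : Measurable fun x => ENNReal.ofReal (θ τ x) :=
          (hθ.comp (Continuous.prodMk_right τ)).measurable.ennreal_ofReal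
        simp only [← volumeRate_of_le n L hτ.1]
        rw [hvolume hτ.1, lintegral_withDensity_eq_lintegral_mul _ (hdecay τ) hmeas]
        exact lintegral_congr fun x => by
          rw [ENNReal.ofReal_mul (hrate τ x), mul_comm, Pi.mul_apply]
    _ = ∫⁻ x, (∫⁻ τ in Icc s S, ENNReal.ofReal (θ τ x * decay θ s τ x)) ∂scaledVolume h s :=
        (lintegral_setLIntegral_swap_of_continuousOn measurableSet_Icc
          (hθ.mul (continuous_decay hθ s)).continuousOn).symm
    _ = ∫⁻ x, (1 - ENNReal.ofReal (decay θ s S x)) ∂scaledVolume h s := by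
        simp only [lintegral_rate_mul_decay hθ hrate s hsS, decay_self,
          ENNReal.ofReal_sub _ (decay_pos θ s S _).le, ENNReal.ofReal_one]
    _ = scaledVolume h s univ - scaledVolume h S univ := by
        rw [lintegral_sub (hdecay S) (hvolume_univ ▸ measure_ne_top _ _) (Eventually.of_forall
          fun x => ENNReal.ofReal_le_one.2 (decay_le_one hθ hrate hsS x)), lintegral_one,
          hvolume_univ]

theorem lintegral_energy_limitVolume_le [T2Space X] (hflow : IsExpandingCMCEinsteinFlow I L h K H)
    (hubble : ∀ t ∈ I, t = -(n : ℝ) / H t) {T s S : ℝ} (hT : T ∈ I) (hTs : T ≤ s) (hsS : s ≤ S) :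
    ∫⁻ x, (∫⁻ τ in Icc s S, ENNReal.ofReal (τ * L τ x * shearSq (h τ) (K τ) x))
        ∂limitVolume L h T ≤
      scaledVolume h s univ - scaledVolume h S univ := by
  have := hflow.isFiniteMeasure_limitVolume hubble hT
  have hs := hflow.mem_of_le hT hTs
  have hsub : Icc s S ×ˢ univ ⊆ I ×ˢ (univ : Set X) :=
    prod_mono_left fun τ hτ => hflow.mem_of_le hs hτ.1
  have hcont : ContinuousOn
      (fun p : ℝ × X => p.1 * L p.1 p.2 * shearSq (h p.1) (K p.1) p.2) (Icc s S ×ˢ univ) :=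
    ((continuousOn_fst.mul hflow.continuousOn_lapse).mul hflow.continuousOn_shearSq).mono hsub
  calc ∫⁻ x, (∫⁻ τ in Icc s S, ENNReal.ofReal (τ * L τ x * shearSq (h τ) (K τ) x))
        ∂limitVolume L h T
      = ∫⁻ τ in Icc s S, ∫⁻ x, ENNReal.ofReal (τ * L τ x * shearSq (h τ) (K τ) x)
          ∂limitVolume L h T :=
        lintegral_setLIntegral_swap_of_continuousOn measurableSet_Icc hcont
    _ ≤ ∫⁻ τ in Icc s S, ∫⁻ x, ENNReal.ofReal (τ * L τ x * shearSq (h τ) (K τ) x)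
          ∂scaledVolume h τ :=
        setLIntegral_mono' measurableSet_Icc fun τ hτ => lintegral_mono'
          (hflow.limitVolume_le_scaledVolume hubble hT (hTs.trans hτ.1)) le_rfl
    _ = ∫⁻ τ in Icc s S, ∫⁻ x, ENNReal.ofReal (n / τ * (1 - L τ x)) ∂scaledVolume h τ := by
        refine setLIntegral_congr_fun measurableSet_Icc fun τ hτ => ?_
        simp only [scaledVolume, lintegral_smul_measure]
        rw [hflow.lintegral_lapse_mul_shearSq hubble (hflow.mem_of_le hs hτ.1)]
    _ = scaledVolume h s univ - scaledVolume h S univ :=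
        hflow.lintegral_rate_scaledVolume hubble hs hsS

end IsExpandingCMCEinsteinFlow

end LimitVolume

section SquareNorm

variable {n : ℕ} {X : Type*} [TopologicalSpace X] [ChartedSpace (EuclideanSpace ℝ (Fin n)) X]
  [IsManifold (𝓡 n) ∞ X] {I : Set ℝ} {L : ℝ → X → ℝ} {h : ℝ → SmoothMetric n X}
  {K : ℝ → Cov2Tensor n X} {H : ℝ → ℝ} {s Λ : ℝ}
  {A : ∀ x : X, TangentSpace (𝓡 n) x →ₗ[ℝ] TangentSpace (𝓡 n) x}
  {b : ∀ x : X, Module.Basis (Fin n) ℝ (TangentSpace (𝓡 n) x)}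

namespace IsExpandingCMCEinsteinFlow

theorem measurable_symmDist_unimodularPart [MeasurableSpace X] [BorelSpace X]
    (hflow : IsExpandingCMCEinsteinFlow I L h K H)
    (hubble : ∀ t ∈ I, t = -(n : ℝ) / H t) (hs : s ∈ I) (hΛ : 1 ≤ Λ)
    (hA : ∀ x, Relates (rescaledMetric h s 1 x) (rescaledMetric h s Λ x) (A x))
    (hb : ∀ x, IsOrthonormalBasis (rescaledMetric h s 1 x) (b x)) :
    Measurable fun x =>
      symmDist (cosetPoint (LinearMap.toMatrix (b x) (b x) (unimodularPart n (A x)))) 1 := by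
  have hs0 := hflow.pos_of_mem hubble hs
  exact hflow.measurable_of_eq_conformalDist hs
    (hflow.mem_of_le hs (le_mul_of_one_le_right hs0.le hΛ)) fun e he y hy =>
      symmDist_unimodularPart_eq_conformalDist hs0 he hy (hA _) (hb _)

theorem sq_symmDist_unimodularPart_le [CompactSpace X]
    (hflow : IsExpandingCMCEinsteinFlow I L h K H)
    (hubble : ∀ t ∈ I, t = -(n : ℝ) / H t) (hs : s ∈ I) (hΛ : 1 < Λ)
    (hA : ∀ x, Relates (rescaledMetric h s 1 x) (rescaledMetric h s Λ x) (A x))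
    (hb : ∀ x, IsOrthonormalBasis (rescaledMetric h s 1 x) (b x)) (x : X) :
    symmDist (cosetPoint (LinearMap.toMatrix (b x) (b x) (unimodularPart n (A x)))) 1 ^ 2 ≤
      ENNReal.ofReal (4 * Real.log Λ) *
        ∫⁻ τ in Icc s (s * Λ), ENNReal.ofReal (τ * L τ x * shearSq (h τ) (K τ) x) := by
  have hs0 := hflow.pos_of_mem hubble hs
  have hchart {e : OpenPartialHomeomorph X (EuclideanSpace ℝ (Fin n))}
      (he : e ∈ atlas (EuclideanSpace ℝ (Fin n)) X) {y : EuclideanSpace ℝ (Fin n)}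
      (hy : y ∈ e.target) := by
    have hle := hflow.sq_conformalDist_metric_le hubble hs (lt_mul_of_one_lt_right hs0 hΛ) he hy
    rwa [mul_div_cancel_left₀ _ hs0.ne',
      ← symmDist_unimodularPart_eq_conformalDist hs0 he hy (hA _) (hb _)] at hle
  have hle := hchart (chart_mem_atlas _ x) (mem_chart_target _ x)
  rwa [(chartAt _ x).left_inv (mem_chart_source _ x)] at hle

theorem lintegral_sq_symmDist_unimodularPart_le [T2Space X] [CompactSpace X] [MeasurableSpace X]
    [BorelSpace X] (hflow : IsExpandingCMCEinsteinFlow I L h K H)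
    (hubble : ∀ t ∈ I, t = -(n : ℝ) / H t) {T : ℝ} (hT : T ∈ I) (hTs : T ≤ s) (hΛ : 1 < Λ)
    (hA : ∀ x, Relates (rescaledMetric h s 1 x) (rescaledMetric h s Λ x) (A x))
    (hb : ∀ x, IsOrthonormalBasis (rescaledMetric h s 1 x) (b x)) :
    ∫⁻ x, symmDist (cosetPoint (LinearMap.toMatrix (b x) (b x) (unimodularPart n (A x)))) 1 ^ 2
        ∂limitVolume L h T ≤
      ENNReal.ofReal (4 * Real.log Λ) *
        (scaledVolume h s univ - scaledVolume h (s * Λ) univ) := by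
  have hs := hflow.mem_of_le hT hTs
  refine (lintegral_mono (hflow.sq_symmDist_unimodularPart_le hubble hs hΛ hA hb)).trans ?_
  rw [lintegral_const_mul' _ _ ENNReal.ofReal_ne_top]
  exact mul_le_mul_right (hflow.lintegral_energy_limitVolume_le hubble hT hTs
    (le_mul_of_one_le_right (hflow.pos_of_mem hubble hs).le hΛ.le)) _

end IsExpandingCMCEinsteinFlow

end SquareNorm

theorem tendsto_eLpNorm_two_of_tendsto_lintegral_sq {α ι : Type*} [MeasurableSpace α]
    {μ : Measure α} {l : Filter ι} {D : ι → α → ENNReal}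
    (hD : Tendsto (fun s => ∫⁻ x, D s x ^ 2 ∂μ) l (𝓝 0)) :
    Tendsto (fun s => eLpNorm (D s) 2 μ) l (𝓝 0) := by
  have hnorm (s : ι) : eLpNorm (D s) 2 μ = (∫⁻ x, D s x ^ 2 ∂μ) ^ (1 / 2 : ℝ) := by
    rw [eLpNorm_eq_lintegral_rpow_enorm_toReal two_ne_zero ENNReal.ofNat_ne_top]
    simp
  simpa [hnorm] using hD.ennrpow_const (1 / 2)

theorem proposition1p42_general (n : ℕ) (X : Type*) [TopologicalSpace X]
    [ChartedSpace (EuclideanSpace ℝ (Fin n)) X] [IsManifold (𝓡 n) ∞ X]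
    [T2Space X] [CompactSpace X] [MeasurableSpace X] [BorelSpace X]
    (I : Set ℝ) (L : ℝ → X → ℝ) (h : ℝ → SmoothMetric n X) (K : ℝ → Cov2Tensor n X) (H : ℝ → ℝ)
    (hflow : IsExpandingCMCEinsteinFlow I L h K H)
    (hubble : ∀ t ∈ I, t = -(n : ℝ) / H t) :
    ∃ dvolInf : Measure X, IsLimitVolume h dvolInf ∧
      ∀ Λ : ℝ, 1 < Λ →
      ∀ (A : ℝ → ∀ x : X, TangentSpace (𝓡 n) x →ₗ[ℝ] TangentSpace (𝓡 n) x)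
        (b : ℝ → ∀ x : X, Module.Basis (Fin n) ℝ (TangentSpace (𝓡 n) x)),
      (∀ᶠ s in atTop, ∀ x,
        Relates (rescaledMetric h s 1 x) (rescaledMetric h s Λ x) (A s x) ∧
        IsOrthonormalBasis (rescaledMetric h s 1 x) (b s x)) →
      (∀ᶠ s in atTop, MemLp (fun x : X => symmDist
        (cosetPoint (LinearMap.toMatrix (b s x) (b s x) (unimodularPart n (A s x)))) 1)
        2 dvolInf) ∧
      Tendsto (fun s => eLpNorm (fun x : X => symmDist
        (cosetPoint (LinearMap.toMatrix (b s x) (b s x) (unimodularPart n (A s x)))) 1)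
        2 dvolInf) atTop (𝓝 0) := by
  obtain ⟨T, hT⟩ := hflow.nonempty
  have hlimit := hflow.isLimitVolume_limitVolume hubble hT
  refine ⟨limitVolume L h T, hlimit, fun Λ hΛ A b hAb => ?_⟩
  have := hflow.isFiniteMeasure_limitVolume hubble hT
  have hloss := ENNReal.Tendsto.const_mul (tendsto_scaledVolume_sub_scaledVolume hlimit
    (zero_lt_one.trans hΛ)) (Or.inr (ENNReal.ofReal_ne_top (r := 4 * Real.log Λ)))
  rw [mul_zero] at hloss
  have hnorm := tendsto_eLpNorm_two_of_tendsto_lintegral_sq <|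
    tendsto_of_tendsto_of_tendsto_of_le_of_le' tendsto_const_nhds hloss
      (Eventually.of_forall fun _ => zero_le) <| by
        filter_upwards [hAb, eventually_ge_atTop T] with s hs hTs
        exact hflow.lintegral_sq_symmDist_unimodularPart_le hubble hT hTs hΛ
          (fun x => (hs x).1) fun x => (hs x).2
  refine ⟨?_, hnorm⟩
  filter_upwards [hAb, eventually_ge_atTop T, hnorm.eventually_lt_const ENNReal.zero_lt_top]
    with s hs hTs hfin
  exact ⟨(hflow.measurable_symmDist_unimodularPart hubble (hflow.mem_of_le hT hTs) hΛ.le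
    (fun x => (hs x).1) fun x => (hs x).2).aestronglyMeasurable, hfin⟩

theorem proposition1p42 (n : ℕ) (X : Type*) [TopologicalSpace X]
    [ChartedSpace (EuclideanSpace ℝ (Fin n)) X] [IsManifold (𝓡 n) ∞ X]
    [T2Space X] [CompactSpace X] [ConnectedSpace X] [MeasurableSpace X] [BorelSpace X]
    (I : Set ℝ) (L : ℝ → X → ℝ) (h : ℝ → SmoothMetric n X) (K : ℝ → Cov2Tensor n X) (H : ℝ → ℝ)
    (hflow : IsExpandingCMCEinsteinFlow I L h K H)
    -- the time parameter is the Hubble time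
    (hubble : ∀ t ∈ I, t = -(n : ℝ) / H t) :
    ∃ dvolInf : Measure X, IsLimitVolume h dvolInf ∧
      ∀ Λ : ℝ, 1 < Λ →
      -- any choice, for all large `s`, of the endomorphisms `H_{s,Λ}(x)` and of orthonormal
      -- bases of `(T_x X, h_s(x,1))`
      ∀ (A : ℝ → ∀ x : X, TangentSpace (𝓡 n) x →ₗ[ℝ] TangentSpace (𝓡 n) x)
        (b : ℝ → ∀ x : X, Module.Basis (Fin n) ℝ (TangentSpace (𝓡 n) x)),
      (∀ᶠ s in atTop, ∀ x,
        Relates (rescaledMetric h s 1 x) (rescaledMetric h s Λ x) (A s x) ∧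
        IsOrthonormalBasis (rescaledMetric h s 1 x) (b s x)) →
      -- the function `x ↦ d_symm(H¹_{s,Λ}(x), I_n)` lies in `L²` and tends to `0` there
      (∀ᶠ s in atTop, MemLp (fun x : X => symmDist
        (cosetPoint (LinearMap.toMatrix (b s x) (b s x) (unimodularPart n (A s x)))) 1)
        2 dvolInf) ∧
      Tendsto (fun s => eLpNorm (fun x : X => symmDist
        (cosetPoint (LinearMap.toMatrix (b s x) (b s x) (unimodularPart n (A s x)))) 1)
        2 dvolInf) atTop (𝓝 0) := by
  exact proposition1p42_general n X I L h K H hflow hubble
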